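/- Let $N\ge 3$ and write $x=(y,z)\in\mathbb R^2\times\mathbb R^{N-2}=\mathbb R^N$, $r=|y|=\sqrt{x_1^2+x_2^2}$, $2^*=\frac{2N}{N-2}$. Let $\mathcal{SO}=SO(2)\times\{I_{N-2}\}\subset SO(N)$ act on $\mathbb R^N$; a function $u:\mathbb R^N\to\mathbb R$ is $\mathcal{SO}$-invariant if for every $g\in\mathcal{SO}$, $u(gx)=u(x)$ for a.e. $x$. *Spaces.* $\mathcal D^{1,2}(\mathbb R^N)$ is the space of all $u\in L^{2^*}(\mathbb R^N)$ with weak gradient in $L^2$, and $\mathcal D^{1,2}(\mathbb R^N,\mathbb R^N)$ is the space of vector fields with all components in $\mathcal D^{1,2}(\mathbb R^N)$, with norm $\left(\int|\nabla U|^2\right)^{1/2}$. Let $X=\{u\in\mathcal D^{1,2}(\mathbb R^N):\int u^2/r^2\,dx<\infty\}$, with norm $\left(\int|\nabla u|^2+u^2/r^2\,dx\right)^{1/2}$, and let $X_{\mathcal{SO}}$ be the subspace of $\mathcal{SO}$-invariant functions of $X$. Let $\mathcal F$ be the set of vector fields of the form $\frac{v(x)}{r}(-x_2,x_1,0)$ (a.e.)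 with $v$ $\mathcal{SO}$-invariant, and $\mathcal D_{\mathcal F}=\mathcal D^{1,2}(\mathbb R^N,\mathbb R^N)\cap\mathcal F$. *Nonlinearities.* Let $f:\mathbb R^N\times\mathbb R\to\mathbb R$ be a Carathéodory function such that, for every $g\in\mathcal{SO}$ and every $\xi\in\mathbb Z^{N-2}$, $f(gx,s)=f(x,s)$ and $f(x+(0,\xi),s)=f(x,s)$ for a.e. $x\in\mathbb R^N$ and every $s\in\mathbb R$, and assume that there is $C>0$ with $|f(x,s)|\le C|s|^{2^*-1}$ for a.e. $x$ and every $s$. Let $h:\mathbb R^N\times\mathbb R^N\to\mathbb R^N$ satisfy, for a.e. $x$, $h(x,0)=0$ and $h(x,\alpha w)=f(x,\alpha)w$ for all $\alpha\in\mathbb R$ and all unit vectors $w\in\mathbb R^N$. *Energies and weak solutions.* Put $F(x,s)=\int_0^s f(x,t)\,dt$, $H(x,\xi)=\int_0^1 h(x,t\xi)\cdot\xi\,dt$, $$J(u)=\int_{\mathbb R^N}\tfrac12\Bigl(|\nabla u|^2+\frac{u^2}{r^2}\Bigr)-F(x,u)\,dx\quad(u\in X),$$ $$E(U)=\int_{\mathbb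 R^N}\tfrac12|\nabla\times U|^2-H(x,U)\,dx\quad(U\in\mathcal D^{1,2}(\mathbb R^N,\mathbb R^N)),$$ where in every dimension $\int|\nabla\times U|^2\,dx$ denotes $\int|\nabla U|^2-(\nabla\cdot U)^2\,dx$. A weak solution of $-\Delta u+\frac{u}{r^2}=f(x,u)$ is a critical point of $J$ on $X$ (the Fréchet differential of $J$ at $u$ exists and is zero), and a weak solution of $\nabla\times\nabla\times U=h(x,U)$ is a critical point of $E$ on $\mathcal D^{1,2}(\mathbb R^N,\mathbb R^N)$. **Theorem.** Let $u:\mathbb R^N\to\mathbb R$ and $U:\mathbb R^N\to\mathbb R^N$ satisfy $U(x)=\frac{u(x)}{r}(-x_2,x_1,0)$ for a.e. $x\in\mathbb R^N$. 1. $U\in\mathcal D_{\mathcal F}$ if and only if $u\in X_{\mathcal{SO}}$. 2. In that case $\nabla\cdot U=0$ a.e., the integrands of $J(u)$ and $E(U)$ are integrable, and $J(u)=E(U)$. 3. $u\in X_{\mathcal{SO}}$ and $u$ is a weak solution of $-\Delta u+\frac{u}{r^2}=f(x,u)$ if and only if $U\in\mathcal D_{\mathcal F}$ and $U$ is a weak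 solution of $\nabla\times\nabla\times U=h(x,U)$. -/

import Mathlib

open MeasureTheory
open scoped ContDiff Matrix

namespace CurlCurl

noncomputable section

/-- The space `ℝ^N = ℝ^2 × ℝ^(N-2)` (used for `N ≥ 3`) with its Euclidean norm.  A point is
`x = (y, z)`, with `y i = x (Sum.inl i)` and `z j = x (Sum.inr j)`; in particular the first two
coordinates `x₁, x₂` are `x (Sum.inl 0)` and `x (Sum.inl 1)`. -/
abbrev RN (N : ℕ) : Type := EuclideanSpace ℝ (Fin 2 ⊕ Fin (N - 2))

/-- The Sobolev critical exponent `2^* = 2N/(N-2)`, for `N ≥ 3`. -/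
def twoStar (N : ℕ) : ℝ := 2 * (N : ℝ) / ((N : ℝ) - 2)

variable {N : ℕ}

/-- `r = |y| = √(x₁² + x₂²)`. -/
def rad (x : RN N) : ℝ := Real.sqrt (x (Sum.inl 0) ^ 2 + x (Sum.inl 1) ^ 2)

/-- The vector `(-x₂, x₁, 0)`. -/
def rotVec (x : RN N) : RN N := WithLp.toLp 2 (Sum.elim ![-x (Sum.inl 1), x (Sum.inl 0)] 0)

/-- The action on `ℝ^N` of the block matrix with diagonal blocks `g ∈ SO(2)` and `I_(N-2)`. -/
def soAct (g : Matrix.specialOrthogonalGroup (Fin 2) ℝ) (x : RN N) : RN N :=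
  WithLp.toLp 2 (Matrix.fromBlocks (g : Matrix (Fin 2) (Fin 2) ℝ) 0 0 1 *ᵥ x.ofLp)

/-- The vector `(0, ξ)` with `ξ ∈ ℤ^(N-2)`. -/
def zShift (ξ : Fin (N - 2) → ℤ) : RN N := WithLp.toLp 2 (Sum.elim 0 (fun j => (ξ j : ℝ)))

/-- `SO(2) × {I}`-invariance of (the a.e. class of) a scalar function. -/
def SOInvariant (u : RN N → ℝ) : Prop :=
  ∀ g : Matrix.specialOrthogonalGroup (Fin 2) ℝ, ∀ᵐ x ∂(volume : Measure (RN N)),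
    u (soAct g x) = u x

/-! ### Weak derivatives and function spaces -/

/-- `w` is the weak partial derivative of `u` in the `i`-th coordinate direction. -/
def HasWeakPartial (i : Fin 2 ⊕ Fin (N - 2)) (u w : RN N → ℝ) : Prop :=
  LocallyIntegrable u volume ∧ LocallyIntegrable w volume ∧
    ∀ φ : RN N → ℝ, ContDiff ℝ ∞ φ → HasCompactSupport φ →
      ∫ x, w x * φ x = -∫ x, u x * fderiv ℝ φ x (EuclideanSpace.single i 1)

open Classical in
/-- The weak partial derivative `∂ᵢ u` (a representative, unique up to null sets; the zero function
if there is none). -/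
def weakPartial (i : Fin 2 ⊕ Fin (N - 2)) (u : RN N → ℝ) : RN N → ℝ :=
  if h : ∃ w, HasWeakPartial i u w then h.choose else 0

/-- The space `D^{1,2}(ℝ^N)`: functions in `L^{2^*}` with weak gradient in `L²`. -/
def D12 (N : ℕ) : Set (RN N → ℝ) :=
  {u | MemLp u (ENNReal.ofReal (twoStar N)) volume ∧
    ∀ i, ∃ w, HasWeakPartial i u w ∧ MemLp w 2 volume}

/-- The space `D^{1,2}(ℝ^N, ℝ^N)`. -/
def D12Vec (N : ℕ) : Set (RN N → RN N) :=
  {U | ∀ j, (fun x => U x j) ∈ D12 N}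

/-- `|∇u|²`. -/
def gradSq (u : RN N → ℝ) (x : RN N) : ℝ := ∑ i, weakPartial i u x ^ 2

/-- `|∇U|²`, the squared Euclidean norm of the Jacobian matrix. -/
def gradSqVec (U : RN N → RN N) (x : RN N) : ℝ := ∑ j, gradSq (fun y => U y j) x

/-- The weak divergence `∇ · U`. -/
def divergence (U : RN N → RN N) (x : RN N) : ℝ := ∑ i, weakPartial i (fun y => U y i) x

/-- The space `X` of all `u ∈ D^{1,2}(ℝ^N)` with `∫ u²/r² < ∞`. -/
def spaceX (N : ℕ) : Set (RN N → ℝ) :=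
  {u | u ∈ D12 N ∧ Integrable (fun x => u x ^ 2 / rad x ^ 2) volume}

/-- The subspace of `SO(2) × {I}`-invariant functions in `X`. -/
def spaceXSO (N : ℕ) : Set (RN N → ℝ) := {u | u ∈ spaceX N ∧ SOInvariant u}

/-- `U(x) = (u(x)/r) (-x₂, x₁, 0)` for a.e. `x`. -/
def Related (u : RN N → ℝ) (U : RN N → RN N) : Prop :=
  ∀ᵐ x ∂(volume : Measure (RN N)), U x = (u x / rad x) • rotVec x

/-- The space `𝓕` of fields `U = (u/r) (-x₂, x₁, 0)` with some invariant `u`. -/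
def spaceF (N : ℕ) : Set (RN N → RN N) := {U | ∃ u : RN N → ℝ, SOInvariant u ∧ Related u U}

/-- `D_𝓕 = D^{1,2}(ℝ^N, ℝ^N) ∩ 𝓕`. -/
def spaceDF (N : ℕ) : Set (RN N → RN N) := D12Vec N ∩ spaceF N

/-- The norm `(∫ |∇u|² + u²/r²)^{1/2}` of `X`. -/
def normX (u : RN N → ℝ) : ℝ := Real.sqrt (∫ x, (gradSq u x + u x ^ 2 / rad x ^ 2))

/-- The norm `(∫ |∇U|²)^{1/2}` of `D^{1,2}(ℝ^N, ℝ^N)`. -/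
def normD12Vec (U : RN N → RN N) : ℝ := Real.sqrt (∫ x, gradSqVec U x)

/-! ### Energies and solutions -/

/-- `F(x,s) = ∫₀ˢ f(x,t) dt`. -/
def primF (f : RN N → ℝ → ℝ) (x : RN N) (s : ℝ) : ℝ := ∫ t in (0 : ℝ)..s, f x t

/-- `H(x,ξ) = ∫₀¹ h(x,tξ)·ξ dt`. -/
def primH (h : RN N → RN N → RN N) (x ξ : RN N) : ℝ :=
  ∫ t in (0 : ℝ)..1, inner ℝ (h x (t • ξ)) ξ

/-- The integrand of `J` (with `a = 1`). -/
def densityJ (f : RN N → ℝ → ℝ) (u : RN N → ℝ) (x : RN N) : ℝ :=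
  1 / 2 * (gradSq u x + u x ^ 2 / rad x ^ 2) - primF f x (u x)

/-- The integrand of `E`; the integral of `|∇×U|²` is by definition, in every dimension, the
integral of `|∇U|² - (∇·U)²`. -/
def densityE (h : RN N → RN N → RN N) (U : RN N → RN N) (x : RN N) : ℝ :=
  1 / 2 * (gradSqVec U x - divergence U x ^ 2) - primH h x (U x)

/-- The energy `J(u) = ∫ ½(|∇u|² + u²/r²) - F(x,u) dx`. -/
def energyJ (f : RN N → ℝ → ℝ) (u : RN N → ℝ) : ℝ := ∫ x, densityJ f u x

/-- The energy `E(U) = ∫ ½|∇×U|² - H(x,U) dx`. -/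
def energyE (h : RN N → RN N → RN N) (U : RN N → RN N) : ℝ := ∫ x, densityE h U x

/-- `u ∈ V` is a critical point of the functional `Φ` on the space `V` with (semi)norm `nrm`:
`Φ` is Fréchet differentiable at `u` with differential zero, that is
`Φ (u + v) - Φ u = o(nrm v)` as `nrm v → 0`, `v ∈ V`. -/
def IsCriticalPoint {α : Type*} [AddCommGroup α] (V : Set α) (nrm : α → ℝ) (Φ : α → ℝ) (u : α) :
    Prop :=
  u ∈ V ∧ ∀ ε > 0, ∃ δ > 0, ∀ v ∈ V, nrm v < δ → |Φ (u + v) - Φ u| ≤ ε * nrm v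

/-- Weak solutions of `-Δu + u/r² = f(x,u)`: critical points of `J` on `X`. -/
def IsSolutionSchrodinger (f : RN N → ℝ → ℝ) (u : RN N → ℝ) : Prop :=
  IsCriticalPoint (spaceX N) normX (energyJ f) u

/-- Weak solutions of `∇×∇×U = h(x,U)`: critical points of `E` on `D^{1,2}(ℝ^N, ℝ^N)`. -/
def IsSolutionCurlCurl (h : RN N → RN N → RN N) (U : RN N → RN N) : Prop :=
  IsCriticalPoint (D12Vec N) normD12Vec (energyE h) U

/-! ### Assumptions on the nonlinearities -/

/-- `f` is a Carathéodory function, invariant under `SO(2) × {I}` and `ℤ^(N-2)`-periodic in the last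
`N - 2` components of `x`. -/
structure ConditionF1 (f : RN N → ℝ → ℝ) : Prop where
  aemeasurable : ∀ s : ℝ, AEMeasurable (fun x => f x s) volume
  continuous : ∀ᵐ x ∂(volume : Measure (RN N)), Continuous (f x)
  invariant : ∀ g : Matrix.specialOrthogonalGroup (Fin 2) ℝ,
    ∀ᵐ x ∂(volume : Measure (RN N)), ∀ s : ℝ, f (soAct g x) s = f x s
  periodic : ∀ ξ : Fin (N - 2) → ℤ,
    ∀ᵐ x ∂(volume : Measure (RN N)), ∀ s : ℝ, f (x + zShift ξ) s = f x s

/-- `h(x,0) = 0` and `h(x,αw) = f(x,α)w` for all `α ∈ ℝ` and all unit vectors `w`. -/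
def Compatible (f : RN N → ℝ → ℝ) (h : RN N → RN N → RN N) : Prop :=
  ∀ᵐ x ∂(volume : Measure (RN N)),
    h x 0 = 0 ∧ ∀ (α : ℝ) (w : RN N), ‖w‖ = 1 → h x (α • w) = f x α • w

end

end CurlCurl

open CurlCurl

/-!
Off the axis `r = 0` the field is `U = u τ`, where `τ = (-x₂, x₁, 0) / r` is a smooth unit field.
With `ρ = (x₁, x₂, 0) / r` one has `∂ᵢ τⱼ = -τᵢ ρⱼ / r`, hence `∂ᵢ Uⱼ = ∂ᵢ u τⱼ - u τᵢ ρⱼ / r`, and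
since `τ` and `ρ` are orthonormal `|∇U|² = |∇u|² + u² / r²` (`Related.gradSqVec_ae_eq`).

The axis has codimension two, so it is invisible to `L²` functions: a cutoff equal to `1` off an
`ε`-neighbourhood of the axis, with gradient `O(1/ε)`, has bounded Dirichlet energy on bounded sets.
Weak derivatives off the axis are therefore weak derivatives on `ℝ^N`
(`HasWeakPartialOn.of_offAxis`), and an equation `-div G = g` tested with functions supported off the
axis holds for all test functions (`divergence_equation_of_offAxis`). This gives the equivalence
`U ∈ D_𝓕 ↔ u ∈ X_SO`.

Invariance of `u` under rotations means `∑ τᵢ ∂ᵢ u = 0`, which is `div U = 0`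
(`Related.divergence_ae_eq`). Compatibility of `f` and `h` gives `H(x, ξ) = F(x, |ξ|)` with `F` even
in `s`, so the densities of `J(u)` and `E(U)` agree almost everywhere.

If `U` is critical for `E`, then `u` is critical for `J`: for `v ∈ X` and `V = v τ`,
`E(U + V) - E(U) = J(u + v) - J(u) - ½ ∫ (div V)²`, the norms of `v` and `V` coincide, and the last
integral is quadratic in that norm (`Related.isSolutionSchrodinger`).

Conversely, `E` is Fréchet differentiable on `D^{1,2}` (`energyE_expansion`); this rests on the
Sobolev inequality (`exists_sobolev`) and on the fact that the remainder of the superposition operator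
of `h` is small in `L^{(2^*)'}` (`Compatible.exists_remainder_le`). If `u` is critical for `J`, the
identity above shows that `E'(U)` vanishes in all angular directions `v τ`. For a test function `φ`
supported off the axis, replacing the direction `φ eⱼ` by its angular projection `φ τⱼ τ` does not
change `E'(U)`, since the difference is the integral of `u` against an angular derivative
(`Related.integral_gradient_angular_projection`). Thus `E'(U)` vanishes on all `φ eⱼ`; removability of
the axis and density of test functions in `D^{1,2}` extend this to every direction
(`Related.isSolutionCurlCurl`).
-/

noncomputable section

namespace CurlCurl

section

variable {N : ℕ}

/-! ### Test functions and weak partial derivatives on open sets -/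

/-- The classical partial derivative in the `i`-th coordinate direction. -/
def pd (i : Fin 2 ⊕ Fin (N - 2)) (φ : RN N → ℝ) (x : RN N) : ℝ :=
  fderiv ℝ φ x (EuclideanSpace.single i 1)

/-- Test functions: smooth and compactly supported. -/
structure IsTest (φ : RN N → ℝ) : Prop where
  smooth : ContDiff ℝ ∞ φ
  compact : HasCompactSupport φ

lemma pd_mul {i : Fin 2 ⊕ Fin (N - 2)} {ζ φ : RN N → ℝ} {x : RN N}
    (hζ : DifferentiableAt ℝ ζ x) (hφ : DifferentiableAt ℝ φ x) :
    pd i (fun y => ζ y * φ y) x = pd i ζ x * φ x + ζ x * pd i φ x := by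
  simp only [pd]
  rw [fderiv_fun_mul hζ hφ]
  simp
  ring

lemma tsupport_pd_subset (i : Fin 2 ⊕ Fin (N - 2)) (φ : RN N → ℝ) :
    tsupport (pd i φ) ⊆ tsupport φ := tsupport_fderiv_apply_subset ℝ _

lemma contDiff_pd {i : Fin 2 ⊕ Fin (N - 2)} {φ : RN N → ℝ} (hφ : ContDiff ℝ ∞ φ) :
    ContDiff ℝ ∞ (pd i φ) :=
  (hφ.fderiv_right (m := ∞) (by simp)).clm_apply contDiff_const

lemma contDiffOn_pd {i : Fin 2 ⊕ Fin (N - 2)} {φ : RN N → ℝ} {s : Set (RN N)} (hs : IsOpen s)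
    (hφ : ContDiffOn ℝ ∞ φ s) : ContDiffOn ℝ ∞ (pd i φ) s :=
  (hφ.fderiv_of_isOpen hs (m := ∞) (by simp)).clm_apply contDiffOn_const

namespace IsTest

variable {φ ψ : RN N → ℝ}

lemma continuous (hφ : IsTest φ) : Continuous φ := hφ.smooth.continuous

lemma differentiable (hφ : IsTest φ) : Differentiable ℝ φ := hφ.smooth.differentiable (by simp)

lemma pd (hφ : IsTest φ) (i : Fin 2 ⊕ Fin (N - 2)) : IsTest (pd i φ) :=
  ⟨contDiff_pd hφ.smooth, hφ.compact.fderiv_apply ℝ _⟩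

lemma mul_left {ζ : RN N → ℝ} (hφ : IsTest φ) (hζ : ContDiff ℝ ∞ ζ) :
    IsTest (fun x => ζ x * φ x) := ⟨hζ.mul hφ.smooth, hφ.compact.mul_left⟩

lemma add (hφ : IsTest φ) (hψ : IsTest ψ) : IsTest (fun x => φ x + ψ x) :=
  ⟨hφ.smooth.add hψ.smooth, hφ.compact.add hψ.compact⟩

/-- A function that is smooth on an open set becomes a test function after multiplication by a test
function supported in that set. -/
lemma mul_left_of_contDiffOn {ζ : RN N → ℝ} {s : Set (RN N)} (hs : IsOpen s) (hφ : IsTest φ)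
    (hφs : tsupport φ ⊆ s) (hζ : ContDiffOn ℝ ∞ ζ s) : IsTest (fun x => ζ x * φ x) := by
  refine ⟨contDiff_iff_contDiffAt.2 fun x => ?_, hφ.compact.mul_left⟩
  by_cases hx : x ∈ tsupport φ
  · exact (hζ.contDiffAt (hs.mem_nhds (hφs hx))).mul hφ.smooth.contDiffAt
  · refine (contDiffAt_const (c := (0 : ℝ))).congr_of_eventuallyEq ?_
    filter_upwards [notMem_tsupport_iff_eventuallyEq.1 hx] with y hy
    simp [hy]

lemma memLp (hφ : IsTest φ) (p : ENNReal) : MemLp φ p volume :=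
  hφ.continuous.memLp_of_hasCompactSupport hφ.compact

end IsTest

lemma tsupport_mul_subset_right' (ζ φ : RN N → ℝ) :
    tsupport (fun x => ζ x * φ x) ⊆ tsupport φ :=
  closure_mono (Function.support_mul_subset_right ζ φ)

lemma integrable_mul_of_tsupport_subset {s : Set (RN N)} {w φ : RN N → ℝ}
    (hw : LocallyIntegrableOn w s volume) (hφ : Continuous φ) (hc : HasCompactSupport φ)
    (hφs : tsupport φ ⊆ s) : Integrable (fun x => w x * φ x) volume := by
  have h1 : IntegrableOn w (tsupport φ) volume := hw.integrableOn_compact_subset hφs hc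
  have h2 : IntegrableOn (fun x => w x * φ x) (tsupport φ) volume :=
    h1.mul_continuousOn hφ.continuousOn hc
  refine (integrableOn_iff_integrable_of_support_subset ?_).1 h2
  exact (Function.support_mul_subset_right w φ).trans (subset_tsupport φ)

lemma integrable_mul_test {w φ : RN N → ℝ}
    (hw : LocallyIntegrable w volume) (hφ : IsTest φ) :
    Integrable (fun x => w x * φ x) volume :=
  integrable_mul_of_tsupport_subset (s := Set.univ) (locallyIntegrableOn_univ.2 hw)
    hφ.continuous hφ.compact (Set.subset_univ _)

/-- `w` is the weak partial derivative of `u` in the `i`-th coordinate direction on the open set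
`s`: the defining identity is tested against test functions supported in `s` only. -/
def HasWeakPartialOn (s : Set (RN N)) (i : Fin 2 ⊕ Fin (N - 2)) (u w : RN N → ℝ) : Prop :=
  LocallyIntegrableOn u s volume ∧ LocallyIntegrableOn w s volume ∧
    ∀ φ : RN N → ℝ, IsTest φ → tsupport φ ⊆ s →
      ∫ x, w x * φ x = -∫ x, u x * pd i φ x

lemma hasWeakPartialOn_univ {i : Fin 2 ⊕ Fin (N - 2)} {u w : RN N → ℝ} :
    HasWeakPartialOn Set.univ i u w ↔ HasWeakPartial i u w := by
  simp only [HasWeakPartialOn, HasWeakPartial, locallyIntegrableOn_univ]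
  refine and_congr Iff.rfl (and_congr Iff.rfl ⟨fun h φ h1 h2 => ?_, fun h φ h1 _ => ?_⟩)
  · exact h φ ⟨h1, h2⟩ (Set.subset_univ _)
  · exact h φ h1.smooth h1.compact

namespace HasWeakPartialOn

variable {s t : Set (RN N)} {i : Fin 2 ⊕ Fin (N - 2)} {u u' w w' : RN N → ℝ}

lemma mono (h : HasWeakPartialOn s i u w) (hts : t ⊆ s) : HasWeakPartialOn t i u w :=
  ⟨h.1.mono_set hts, h.2.1.mono_set hts, fun φ hφ hφt => h.2.2 φ hφ (hφt.trans hts)⟩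

lemma congr (h : HasWeakPartialOn s i u w) (hu : u =ᵐ[volume] u') (hw : w =ᵐ[volume] w') :
    HasWeakPartialOn s i u' w' := by
  refine ⟨h.1.congr (ae_restrict_of_ae hu), h.2.1.congr (ae_restrict_of_ae hw),
    fun φ hφ hφs => ?_⟩
  rw [integral_congr_ae (g := fun x => w x * φ x), h.2.2 φ hφ hφs,
    integral_congr_ae (f := fun x => u x * pd i φ x)]
  · filter_upwards [hu] with x hx; rw [hx]
  · filter_upwards [hw] with x hx; rw [hx]

lemma unique (hs : IsOpen s) (h : HasWeakPartialOn s i u w) (h' : HasWeakPartialOn s i u w') :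
    ∀ᵐ x ∂(volume : Measure (RN N)), x ∈ s → w x = w' x := by
  have := hs.ae_eq_zero_of_integral_contDiff_smul_eq_zero (μ := volume)
    (f := fun x => w x - w' x) (h.2.1.sub h'.2.1) (by
      intro g hg hgc hgs
      have hgt : IsTest g := ⟨hg, hgc⟩
      have h1 := integrable_mul_of_tsupport_subset h.2.1 hgt.continuous hgc hgs
      have h2 := integrable_mul_of_tsupport_subset h'.2.1 hgt.continuous hgc hgs
      have : ∀ x, g x • (w x - w' x) = w x * g x - w' x * g x := fun x => by
        simp only [smul_eq_mul]; ring
      simp_rw [this]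
      rw [integral_sub h1 h2, h.2.2 g hgt hgs, h'.2.2 g hgt hgs, sub_self])
  filter_upwards [this] with x hx hxs
  exact sub_eq_zero.1 (hx hxs)

lemma add (h : HasWeakPartialOn s i u w) (h' : HasWeakPartialOn s i u' w') :
    HasWeakPartialOn s i (fun x => u x + u' x) (fun x => w x + w' x) := by
  refine ⟨h.1.add h'.1, h.2.1.add h'.2.1, fun φ hφ hφs => ?_⟩
  have hp := hφ.pd i
  have hps := (tsupport_pd_subset i φ).trans hφs
  simp only [add_mul]
  rw [integral_add, integral_add, h.2.2 φ hφ hφs, h'.2.2 φ hφ hφs]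
  · ring
  all_goals first
    | exact integrable_mul_of_tsupport_subset h.1 hp.continuous hp.compact hps
    | exact integrable_mul_of_tsupport_subset h'.1 hp.continuous hp.compact hps
    | exact integrable_mul_of_tsupport_subset h.2.1 hφ.continuous hφ.compact hφs
    | exact integrable_mul_of_tsupport_subset h'.2.1 hφ.continuous hφ.compact hφs

/-- The product rule for a weakly differentiable function and a function smooth on `s`. -/
lemma mul_left (hs : IsOpen s) {ζ : RN N → ℝ} (hζ : ContDiffOn ℝ ∞ ζ s)
    (h : HasWeakPartialOn s i u w) :
    HasWeakPartialOn s i (fun x => ζ x * u x) (fun x => ζ x * w x + pd i ζ x * u x) := by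
  have hpζ : ContDiffOn ℝ ∞ (pd i ζ) s := contDiffOn_pd hs hζ
  have hl := hs.isLocallyClosed
  refine ⟨h.1.continuousOn_mul hζ.continuousOn hl,
    (h.2.1.continuousOn_mul hζ.continuousOn hl).add
      (h.1.continuousOn_mul hpζ.continuousOn hl), fun φ hφ hφs => ?_⟩
  have hζφ := hφ.mul_left_of_contDiffOn hs hφs hζ
  have hζφs := (tsupport_mul_subset_right' ζ φ).trans hφs
  have hpd := hφ.pd i
  have hpds := (tsupport_pd_subset i φ).trans hφs
  have t1 := hφ.mul_left_of_contDiffOn hs hφs hpζ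
  have t1s := (tsupport_mul_subset_right' (CurlCurl.pd i ζ) φ).trans hφs
  have t2 := hpd.mul_left_of_contDiffOn hs hpds hζ
  have t2s := (tsupport_mul_subset_right' ζ (CurlCurl.pd i φ)).trans hpds
  have e1 : ∀ x, pd i (fun y => ζ y * φ y) x = pd i ζ x * φ x + ζ x * pd i φ x := by
    intro x
    by_cases hx : x ∈ s
    · exact pd_mul ((hζ.contDiffAt (hs.mem_nhds hx)).differentiableAt (by simp))
        (hφ.differentiable x)
    -- Off `s` both sides vanish, and no differentiability of `ζ` is available or needed.
    · have hx1 : φ x = 0 := image_eq_zero_of_notMem_tsupport fun hc => hx (hφs hc)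
      have hx2 : pd i φ x = 0 := image_eq_zero_of_notMem_tsupport fun hc => hx (hpds hc)
      have hx3 : pd i (fun y => ζ y * φ y) x = 0 :=
        image_eq_zero_of_notMem_tsupport fun hc => hx (hζφs (tsupport_pd_subset _ _ hc))
      rw [hx1, hx2, hx3]; ring
  have key := h.2.2 _ hζφ hζφs
  have i1 := integrable_mul_of_tsupport_subset h.2.1 hζφ.continuous hζφ.compact hζφs
  have i2 := integrable_mul_of_tsupport_subset h.1 t1.continuous t1.compact t1s
  have i3 := integrable_mul_of_tsupport_subset h.1 t2.continuous t2.compact t2s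
  have e2 : ∀ x, (ζ x * w x + pd i ζ x * u x) * φ x
      = w x * (ζ x * φ x) + u x * (pd i ζ x * φ x) := fun x => by ring
  have e3 : ∀ x, ζ x * u x * pd i φ x = u x * (ζ x * pd i φ x) := fun x => by ring
  simp_rw [e2, e3]
  rw [integral_add i1 i2, key]
  simp_rw [e1, mul_add]
  rw [integral_add i2 i3]
  ring

lemma const_mul (hs : IsOpen s) (c : ℝ) (h : HasWeakPartialOn s i u w) :
    HasWeakPartialOn s i (fun x => c * u x) (fun x => c * w x) := by
  have := h.mul_left hs (ζ := fun _ => c) contDiffOn_const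
  simpa [pd] using this

lemma zero : HasWeakPartialOn s i (fun _ => 0) (fun _ => 0) :=
  ⟨locallyIntegrableOn_zero, locallyIntegrableOn_zero, fun φ _ _ => by simp⟩

lemma sum {κ : Type*} (S : Finset κ) {u w : κ → RN N → ℝ}
    (h : ∀ k ∈ S, HasWeakPartialOn s i (u k) (w k)) :
    HasWeakPartialOn s i (fun x => ∑ k ∈ S, u k x) (fun x => ∑ k ∈ S, w k x) := by
  classical
  induction S using Finset.induction_on with
  | empty => simpa using zero
  | insert a S ha ih =>
    simp only [Finset.sum_insert ha]
    exact (h a (Finset.mem_insert_self a S)).add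
      (ih fun k hk => h k (Finset.mem_insert_of_mem hk))

end HasWeakPartialOn

/-! ### Weak partial derivatives and the space `D^{1,2}` -/

/-- The critical exponent as an extended nonnegative real. -/
def critExp (N : ℕ) : ENNReal := ENNReal.ofReal (twoStar N)

lemma two_lt_twoStar (hN : 3 ≤ N) : 2 < twoStar N := by
  have h : (3 : ℝ) ≤ N := by exact_mod_cast hN
  rw [twoStar, lt_div_iff₀ (by linarith)]
  linarith

lemma two_le_critExp (hN : 3 ≤ N) : 2 ≤ critExp N := by
  rw [critExp, ← ENNReal.ofReal_ofNat 2]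
  exact ENNReal.ofReal_le_ofReal (two_lt_twoStar hN).le

lemma one_le_critExp (hN : 3 ≤ N) : 1 ≤ critExp N :=
  le_trans (by norm_num) (two_le_critExp hN)

lemma critExp_ne_top : critExp N ≠ ⊤ := ENNReal.ofReal_ne_top

namespace HasWeakPartial

variable {i : Fin 2 ⊕ Fin (N - 2)} {u u' w w' : RN N → ℝ}

lemma ae_eq (h : HasWeakPartial i u w) (h' : HasWeakPartial i u w') : w =ᵐ[volume] w' := by
  have := (hasWeakPartialOn_univ.2 h).unique isOpen_univ (hasWeakPartialOn_univ.2 h')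
  filter_upwards [this] with x hx using hx (Set.mem_univ x)

lemma congr (h : HasWeakPartial i u w) (hu : u =ᵐ[volume] u') (hw : w =ᵐ[volume] w') :
    HasWeakPartial i u' w' :=
  hasWeakPartialOn_univ.1 ((hasWeakPartialOn_univ.2 h).congr hu hw)

lemma add (h : HasWeakPartial i u w) (h' : HasWeakPartial i u' w') :
    HasWeakPartial i (fun x => u x + u' x) (fun x => w x + w' x) :=
  hasWeakPartialOn_univ.1 ((hasWeakPartialOn_univ.2 h).add (hasWeakPartialOn_univ.2 h'))

lemma const_mul (c : ℝ) (h : HasWeakPartial i u w) :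
    HasWeakPartial i (fun x => c * u x) (fun x => c * w x) :=
  hasWeakPartialOn_univ.1 ((hasWeakPartialOn_univ.2 h).const_mul isOpen_univ c)

lemma mul_left {ζ : RN N → ℝ} (hζ : ContDiff ℝ ∞ ζ) (h : HasWeakPartial i u w) :
    HasWeakPartial i (fun x => ζ x * u x) (fun x => ζ x * w x + pd i ζ x * u x) :=
  hasWeakPartialOn_univ.1 ((hasWeakPartialOn_univ.2 h).mul_left isOpen_univ hζ.contDiffOn)

lemma integral_eq (h : HasWeakPartial i u w) {φ : RN N → ℝ} (hφ : IsTest φ) :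
    ∫ x, w x * φ x = -∫ x, u x * pd i φ x := h.2.2 φ hφ.smooth hφ.compact

lemma weakPartial (h : HasWeakPartial i u w) : HasWeakPartial i u (weakPartial i u) := by
  have hex : ∃ w, HasWeakPartial i u w := ⟨w, h⟩
  rw [CurlCurl.weakPartial, dif_pos hex]
  exact hex.choose_spec

lemma weakPartial_ae_eq (h : HasWeakPartial i u w) : CurlCurl.weakPartial i u =ᵐ[volume] w :=
  h.weakPartial.ae_eq h

end HasWeakPartial

lemma IsTest.hasWeakPartial {φ : RN N → ℝ} (hφ : IsTest φ) (i : Fin 2 ⊕ Fin (N - 2)) :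
    HasWeakPartial i φ (CurlCurl.pd i φ) := by
  refine ⟨hφ.continuous.locallyIntegrable, (hφ.pd i).continuous.locallyIntegrable,
    fun ψ h1 h2 => ?_⟩
  have hψ : IsTest ψ := ⟨h1, h2⟩
  have := integral_mul_fderiv_eq_neg_fderiv_mul_of_integrable (μ := (volume : Measure (RN N)))
    (f := φ) (g := ψ) (v := EuclideanSpace.single i 1)
    (integrable_mul_test (hφ.pd i).continuous.locallyIntegrable hψ)
    (integrable_mul_test hφ.continuous.locallyIntegrable (hψ.pd i))
    (integrable_mul_test hφ.continuous.locallyIntegrable hψ)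
    (fun x _ => hφ.differentiable x) (fun x _ => hψ.differentiable x)
  rw [this, neg_neg]
  rfl

namespace D12

variable {u v : RN N → ℝ}

lemma memLp (h : u ∈ D12 N) : MemLp u (critExp N) volume := h.1

lemma hasWeakPartial (h : u ∈ D12 N) (i : Fin 2 ⊕ Fin (N - 2)) :
    HasWeakPartial i u (weakPartial i u) := by
  obtain ⟨w, hw, -⟩ := h.2 i
  exact hw.weakPartial

lemma memLp_weakPartial (h : u ∈ D12 N) (i : Fin 2 ⊕ Fin (N - 2)) :
    MemLp (weakPartial i u) 2 volume := by
  obtain ⟨w, hw, hw2⟩ := h.2 i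
  exact hw2.ae_eq hw.weakPartial_ae_eq.symm

lemma add (hu : u ∈ D12 N) (hv : v ∈ D12 N) : (fun x => u x + v x) ∈ D12 N :=
  ⟨hu.1.add hv.1, fun i => ⟨_, (hasWeakPartial hu i).add (hasWeakPartial hv i),
    (memLp_weakPartial hu i).add (memLp_weakPartial hv i)⟩⟩

lemma const_mul (c : ℝ) (hu : u ∈ D12 N) : (fun x => c * u x) ∈ D12 N :=
  ⟨hu.1.const_mul c, fun i => ⟨_, (hasWeakPartial hu i).const_mul c,
    (memLp_weakPartial hu i).const_mul c⟩⟩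

lemma of_test (hu : IsTest u) : u ∈ D12 N :=
  ⟨hu.memLp _, fun i => ⟨_, hu.hasWeakPartial i, (hu.pd i).memLp _⟩⟩

lemma weakPartial_add (hu : u ∈ D12 N) (hv : v ∈ D12 N) (i : Fin 2 ⊕ Fin (N - 2)) :
    weakPartial i (fun x => u x + v x) =ᵐ[volume] fun x => weakPartial i u x + weakPartial i v x :=
  ((hasWeakPartial hu i).add (hasWeakPartial hv i)).weakPartial_ae_eq

lemma weakPartial_const_mul (c : ℝ) (hu : u ∈ D12 N) (i : Fin 2 ⊕ Fin (N - 2)) :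
    weakPartial i (fun x => c * u x) =ᵐ[volume] fun x => c * weakPartial i u x :=
  ((hasWeakPartial hu i).const_mul c).weakPartial_ae_eq

end D12

lemma IsTest.weakPartial_ae_eq {φ : RN N → ℝ} (hφ : IsTest φ) (i : Fin 2 ⊕ Fin (N - 2)) :
    weakPartial i φ =ᵐ[volume] CurlCurl.pd i φ := (hφ.hasWeakPartial i).weakPartial_ae_eq

end

section

variable {N : ℕ}

/-! ### Mollification -/

/-- Convolution of `u` with the normalised bump function `b`. -/
def mollify (b : ContDiffBump (0 : RN N)) (u : RN N → ℝ) : RN N → ℝ :=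
  convolution (b.normed volume) u (ContinuousLinearMap.lsmul ℝ ℝ) volume

lemma mollify_apply (b : ContDiffBump (0 : RN N)) (u : RN N → ℝ) (x : RN N) :
    mollify b u x = ∫ t, b.normed volume t * u (x - t) := rfl

lemma mollify_apply_swap (b : ContDiffBump (0 : RN N)) (u : RN N → ℝ) (x : RN N) :
    mollify b u x = ∫ t, b.normed volume (x - t) * u t := by
  rw [mollify, convolution_eq_swap]; rfl

lemma contDiff_mollify (b : ContDiffBump (0 : RN N)) {u : RN N → ℝ}
    (hu : LocallyIntegrable u volume) : ContDiff ℝ ∞ (mollify b u) :=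
  b.hasCompactSupport_normed.contDiff_convolution_left (n := ⊤) _ b.contDiff_normed hu

lemma isTest_mollify (b : ContDiffBump (0 : RN N)) {u : RN N → ℝ}
    (hu : LocallyIntegrable u volume) (hc : HasCompactSupport u) : IsTest (mollify b u) :=
  ⟨contDiff_mollify b hu, b.hasCompactSupport_normed.convolution _ hc⟩

lemma isTest_normed (b : ContDiffBump (0 : RN N)) : IsTest (b.normed volume) :=
  ⟨b.contDiff_normed, b.hasCompactSupport_normed⟩

lemma pd_mollify (b : ContDiffBump (0 : RN N)) {i : Fin 2 ⊕ Fin (N - 2)} {u w : RN N → ℝ}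
    (h : HasWeakPartial i u w) : pd i (mollify b u) = mollify b w := by
  funext x
  have hb : IsTest (b.normed volume) := isTest_normed b
  have hd := b.hasCompactSupport_normed.hasFDerivAt_convolution_left
    (ContinuousLinearMap.lsmul ℝ ℝ) (μ := volume) (hb.smooth.of_le (by simp)) h.1 x
  have hex : ConvolutionExistsAt (fderiv ℝ (b.normed volume)) u x
      (ContinuousLinearMap.precompL (RN N) (ContinuousLinearMap.lsmul ℝ ℝ)) volume :=
    (hb.compact.fderiv (𝕜 := ℝ)).convolutionExists_left _
      (hb.smooth.continuous_fderiv (by simp)) h.1 x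
  -- `t ↦ ρ (x - t)` is a test function whose partial derivative is `-∂ᵢρ (x - t)`.
  have hφ : IsTest (fun t => b.normed volume (x - t)) := by
    refine ⟨hb.smooth.comp (contDiff_const.sub contDiff_id), ?_⟩
    exact hb.compact.comp_homeomorph (Homeomorph.subLeft x)
  have hpd : ∀ t, pd i (fun t => b.normed volume (x - t)) t = -pd i (b.normed volume) (x - t) := by
    intro t
    have h1 : HasFDerivAt (fun t : RN N => x - t) (-ContinuousLinearMap.id ℝ (RN N)) t :=
      (hasFDerivAt_id t).const_sub x
    have h2 := (hb.differentiable (x - t)).hasFDerivAt.comp t h1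
    have h3 : fderiv ℝ (fun t => b.normed volume (x - t)) t = _ := h2.fderiv
    simp only [pd, h3]
    simp
  have key := h.integral_eq hφ
  rw [mollify_apply_swap]
  have e1 : ∀ t, b.normed volume (x - t) * w t = w t * b.normed volume (x - t) :=
    fun t => mul_comm _ _
  simp_rw [e1]
  rw [key]
  simp_rw [hpd, mul_neg, integral_neg, neg_neg]
  have hd2 : fderiv ℝ (mollify b u) x = _ := hd.fderiv
  rw [pd, hd2, convolution_def, ContinuousLinearMap.integral_apply hex.integrable,
    ← integral_sub_left_eq_self _ volume x]
  refine integral_congr_ae (Filter.Eventually.of_forall fun t => ?_)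
  simp [pd, mul_comm]

/-- Mollification is a contraction of `L^p`: by Jensen's inequality for the probability measure
`ρ(t) dt`, `|ρ * u|^p ≤ ρ * |u|^p`. -/
lemma eLpNorm_mollify_le (b : ContDiffBump (0 : RN N)) {u : RN N → ℝ} {p : ENNReal}
    (hp : 1 ≤ p) (hpt : p ≠ ⊤) (hu : AEStronglyMeasurable u volume) :
    eLpNorm (mollify b u) p volume ≤ eLpNorm u p volume := by
  obtain ⟨v, hv, huv⟩ := hu
  have hm : mollify b u = mollify b v :=
    convolution_congr _ (ae_eq_refl (b.normed volume)) huv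
  rw [hm, eLpNorm_congr_ae huv]
  have hvm : Measurable v := hv.measurable
  set ρ : RN N → ENNReal := fun t => ENNReal.ofReal (b.normed volume t) with hρ
  have hρm : Measurable ρ := b.continuous_normed.measurable.ennreal_ofReal
  set ν : Measure (RN N) := volume.withDensity ρ with hν
  have hprob : IsProbabilityMeasure ν := by
    constructor
    rw [hν, withDensity_apply _ MeasurableSet.univ, Measure.restrict_univ,
      ← ofReal_integral_eq_lintegral_ofReal b.integrable_normed
        (Filter.Eventually.of_forall b.nonneg_normed), b.integral_normed]
    simp
  have hp0 : p ≠ 0 := (lt_of_lt_of_le one_pos hp).ne'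
  have hq : 1 ≤ p.toReal := by
    rw [← ENNReal.toReal_one]; exact (ENNReal.toReal_le_toReal (by simp) hpt).2 hp
  have hq0 : 0 < p.toReal := by linarith
  rw [eLpNorm_eq_lintegral_rpow_enorm_toReal hp0 hpt,
    eLpNorm_eq_lintegral_rpow_enorm_toReal hp0 hpt]
  gcongr ?_ ^ _
  have hpt1 : ∀ x, ‖mollify b v x‖ₑ ^ p.toReal ≤ ∫⁻ t, ‖v (x - t)‖ₑ ^ p.toReal ∂ν := by
    intro x
    have hmx : Measurable fun t => v (x - t) := hvm.comp (measurable_const.sub measurable_id)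
    have h1 : ‖mollify b v x‖ₑ ≤ ∫⁻ t, ‖v (x - t)‖ₑ ∂ν := by
      rw [mollify_apply, hν, lintegral_withDensity_eq_lintegral_mul _ hρm hmx.enorm]
      refine (enorm_integral_le_lintegral_enorm _).trans_eq (lintegral_congr fun t => ?_)
      rw [enorm_mul, Pi.mul_apply, Real.enorm_of_nonneg (b.nonneg_normed t)]
    have h2 := eLpNorm'_le_eLpNorm'_of_exponent_le one_pos hq ν
      (hmx.aestronglyMeasurable (μ := ν))
    simp only [eLpNorm', ENNReal.rpow_one, one_div, inv_one] at h2
    calc ‖mollify b v x‖ₑ ^ p.toReal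
        ≤ ((∫⁻ t, ‖v (x - t)‖ₑ ^ p.toReal ∂ν) ^ (p.toReal)⁻¹) ^ p.toReal := by
          gcongr; exact h1.trans h2
      _ = _ := by rw [← ENNReal.rpow_mul, inv_mul_cancel₀ hq0.ne', ENNReal.rpow_one]
  calc ∫⁻ x, ‖mollify b v x‖ₑ ^ p.toReal
      ≤ ∫⁻ x, ∫⁻ t, ‖v (x - t)‖ₑ ^ p.toReal ∂ν := lintegral_mono hpt1
    _ = ∫⁻ t, (∫⁻ x, ‖v (x - t)‖ₑ ^ p.toReal) ∂ν := by
        refine lintegral_lintegral_swap ?_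
        exact ((hvm.comp (measurable_fst.sub measurable_snd)).enorm.pow_const _).aemeasurable
    _ = ∫⁻ _t, (∫⁻ x, ‖v x‖ₑ ^ p.toReal) ∂ν := by
        refine lintegral_congr fun t => ?_
        exact lintegral_sub_right_eq_self (fun x => ‖v x‖ₑ ^ p.toReal) t
    _ = ∫⁻ x, ‖v x‖ₑ ^ p.toReal := by simp

lemma mollify_sub (b : ContDiffBump (0 : RN N)) {u v : RN N → ℝ}
    (hu : LocallyIntegrable u volume) (hv : LocallyIntegrable v volume) :
    mollify b (fun x => u x - v x) = fun x => mollify b u x - mollify b v x := by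
  funext x
  have h1 := (b.hasCompactSupport_normed (μ := volume)).convolutionExists_left
    (ContinuousLinearMap.lsmul ℝ ℝ) b.continuous_normed hu x
  have h2 := (b.hasCompactSupport_normed (μ := volume)).convolutionExists_left
    (ContinuousLinearMap.lsmul ℝ ℝ) b.continuous_normed hv x
  have := integral_sub h1.integrable h2.integrable
  simp only [mollify_apply]
  simp only [ContinuousLinearMap.lsmul_apply, smul_eq_mul] at this
  rw [← this]
  simp_rw [mul_sub]

/-- For continuous compactly supported `g`, the mollifications converge uniformly and are supported in
a fixed compact set, hence converge in `L^p`. -/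
lemma mollify_approx_of_continuous {g : RN N → ℝ} (hg : Continuous g) (hc : HasCompactSupport g)
    {p : ENNReal} {ε : ENNReal} (hε : ε ≠ 0) :
    ∃ r > 0, ∀ b : ContDiffBump (0 : RN N), b.rOut ≤ r →
      eLpNorm (fun x => mollify b g x - g x) p volume ≤ ε := by
  set K := Metric.cthickening 1 (tsupport g) with hK
  have hKc : IsCompact K := (show IsCompact (tsupport g) from hc).cthickening
  set M := volume K ^ (1 / p.toReal) with hM
  have hMt : M ≠ ⊤ := ENNReal.rpow_ne_top_of_nonneg (by positivity) hKc.measure_lt_top.ne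
  obtain ⟨η, hη, hηε⟩ : ∃ η : ℝ, 0 < η ∧ ENNReal.ofReal η * M ≤ ε := by
    obtain ⟨δ, hδ, hδM⟩ := ENNReal.exists_nnreal_pos_mul_lt hMt hε
    exact ⟨δ, hδ, by simpa using hδM.le⟩
  obtain ⟨r, hr, hgr⟩ := Metric.uniformContinuous_iff.1
    (hc.uniformContinuous_of_continuous hg) η hη
  refine ⟨min r 1, by positivity, fun b hb => ?_⟩
  have hbd : ∀ x, ‖mollify b g x - g x‖ ≤ η := by
    intro x
    rw [← dist_eq_norm]
    refine ContDiffBump.dist_normed_convolution_le hg.aestronglyMeasurable fun y hy => ?_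
    refine (hgr ?_).le
    exact lt_of_lt_of_le (Metric.mem_ball.1 hy) (hb.trans (min_le_left _ _))
  have hsupp : ∀ x, x ∉ K → mollify b g x - g x = 0 := by
    intro x hx
    have hgx : ∀ y ∈ Metric.ball x b.rOut, g y = 0 := by
      intro y hy
      by_contra hne
      apply hx
      refine Metric.mem_cthickening_of_dist_le x y 1 _ (subset_tsupport g hne) ?_
      rw [dist_comm]
      exact ((Metric.mem_ball.1 hy).le.trans hb).trans (min_le_right _ _)
    have h0 : g x = 0 := hgx x (Metric.mem_ball_self b.rOut_pos)
    have := b.normed_convolution_eq_right (g := g) (μ := volume) (x₀ := x)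
      fun y hy => by rw [hgx y hy, h0]
    rw [mollify, this, sub_self]
  calc eLpNorm (fun x => mollify b g x - g x) p volume
      ≤ eLpNorm (K.indicator fun _ => η) p volume := by
        refine eLpNorm_mono_real fun x => ?_
        by_cases hx : x ∈ K
        · rw [Set.indicator_of_mem hx]; exact hbd x
        · rw [Set.indicator_of_notMem hx, hsupp x hx, norm_zero]
    _ ≤ ‖η‖ₑ * M := eLpNorm_indicator_const_le _ _
    _ ≤ ε := by rwa [Real.enorm_of_nonneg hη.le]

/-- Mollifications of an `L^p` function converge to it in `L^p` as the radius of the bump function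
tends to zero. -/
lemma mollify_approx {u : RN N → ℝ} {p : ENNReal} (hp : 1 ≤ p) (hpt : p ≠ ⊤)
    (hu : MemLp u p volume) {ε : ENNReal} (hε : ε ≠ 0) :
    ∃ r > 0, ∀ b : ContDiffBump (0 : RN N), b.rOut ≤ r →
      eLpNorm (fun x => mollify b u x - u x) p volume ≤ ε := by
  have hε3 : ε / 3 ≠ 0 := by simp [hε]
  obtain ⟨g, hgc, hgu, hg, hgp⟩ := hu.exists_hasCompactSupport_eLpNorm_sub_le hpt hε3
  obtain ⟨r, hr, hrb⟩ := mollify_approx_of_continuous (p := p) hg hgc hε3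
  refine ⟨r, hr, fun b hb => ?_⟩
  have hul := hu.locallyIntegrable hp
  have hgl := hgp.locallyIntegrable hp
  have hsub := hu.sub hgp
  have e : (fun x => mollify b u x - u x) = fun x => mollify b (fun y => u y - g y) x
      + ((mollify b g x - g x) + (g x - u x)) := by
    funext x
    rw [mollify_sub b hul hgl]; ring
  have m1 : AEStronglyMeasurable (mollify b fun y => u y - g y) volume :=
    (contDiff_mollify b (hul.sub hgl)).continuous.aestronglyMeasurable
  have m2 : AEStronglyMeasurable (fun x => mollify b g x - g x) volume :=
    ((contDiff_mollify b hgl).continuous.sub hg).aestronglyMeasurable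
  have m3 : AEStronglyMeasurable (fun x => g x - u x) volume :=
    hgp.aestronglyMeasurable.sub hu.aestronglyMeasurable
  rw [e]
  refine (eLpNorm_add_le m1 (m2.add m3) hp).trans ?_
  refine (add_le_add_right (eLpNorm_add_le m2 m3 hp) _).trans ?_
  have b1 : eLpNorm (mollify b fun y => u y - g y) p volume ≤ ε / 3 :=
    (eLpNorm_mollify_le b hp hpt hsub.aestronglyMeasurable).trans hgu
  have b3 : eLpNorm (fun x => g x - u x) p volume ≤ ε / 3 := by
    rw [show (fun x => g x - u x) = g - u from rfl, eLpNorm_sub_comm]; exact hgu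
  calc _ ≤ ε / 3 + (ε / 3 + ε / 3) := add_le_add b1 (add_le_add (hrb b hb) b3)
    _ = ε := by rw [← add_assoc, ENNReal.add_thirds]

/-! ### Truncation at infinity -/

lemma eLpNorm_tail_le {u : RN N → ℝ} {p : ENNReal} (hpt : p ≠ ⊤)
    (hu : MemLp u p volume) {ε : ENNReal} (hε : ε ≠ 0) :
    ∃ R₀ > 0, ∀ R ≥ R₀, eLpNorm ({x | R ≤ ‖x‖}.indicator u) p volume ≤ ε := by
  obtain ⟨g, hgc, hgu, -, -⟩ := hu.exists_hasCompactSupport_eLpNorm_sub_le hpt hε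
  obtain ⟨R₀, hR₀, hg0⟩ := hgc.exists_pos_le_norm
  refine ⟨R₀, hR₀, fun R hR => le_trans (eLpNorm_mono fun x => ?_) hgu⟩
  by_cases hx : R ≤ ‖x‖
  · rw [Set.indicator_of_mem (by exact hx), Pi.sub_apply, hg0 x (hR.le.trans hx), sub_zero]
  · rw [Set.indicator_of_notMem (by exact hx), norm_zero]; exact norm_nonneg _

/-- The cutoff function `χ(x/R)`, equal to `1` for `|x| ≤ R` and to `0` for `|x| ≥ 2R`. -/
def ballCutoff (R : ℝ) (x : RN N) : ℝ :=
  (⟨1, 2, one_pos, one_lt_two⟩ : ContDiffBump (0 : RN N)) (R⁻¹ • x)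

lemma contDiff_ballCutoff (R : ℝ) : ContDiff ℝ ∞ (ballCutoff R : RN N → ℝ) :=
  (ContDiffBump.contDiff _).comp (contDiff_const_smul R⁻¹)

lemma ballCutoff_nonneg (R : ℝ) (x : RN N) : 0 ≤ ballCutoff R x := ContDiffBump.nonneg _

lemma ballCutoff_le_one (R : ℝ) (x : RN N) : ballCutoff R x ≤ 1 := ContDiffBump.le_one _

lemma ballCutoff_eq_one {R : ℝ} (hR : 0 < R) {x : RN N} (hx : ‖x‖ ≤ R) : ballCutoff R x = 1 := by
  refine ContDiffBump.one_of_mem_closedBall _ ?_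
  rw [mem_closedBall_zero_iff, norm_smul, norm_inv, Real.norm_of_nonneg hR.le, inv_mul_le_iff₀ hR]
  simpa using hx

lemma ballCutoff_eq_zero {R : ℝ} (hR : 0 < R) {x : RN N} (hx : 2 * R ≤ ‖x‖) :
    ballCutoff R x = 0 := by
  refine ContDiffBump.zero_of_le_dist _ ?_
  rw [dist_zero_right, norm_smul, norm_inv, Real.norm_of_nonneg hR.le, le_inv_mul_iff₀ hR]
  linarith

lemma hasCompactSupport_ballCutoff {R : ℝ} (hR : 0 < R) :
    HasCompactSupport (ballCutoff R : RN N → ℝ) := by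
  refine HasCompactSupport.intro (isCompact_closedBall 0 (2 * R)) fun x hx => ?_
  rw [mem_closedBall_zero_iff, not_le] at hx
  exact ballCutoff_eq_zero hR hx.le

lemma exists_abs_pd_ballCutoff_le :
    ∃ C > 0, ∀ R > 0, ∀ (i : Fin 2 ⊕ Fin (N - 2)) (x : RN N),
      |pd i (ballCutoff R) x| ≤ C / R := by
  set χ : ContDiffBump (0 : RN N) := ⟨1, 2, one_pos, one_lt_two⟩ with hχ
  obtain ⟨C, hC⟩ := (χ.hasCompactSupport.fderiv (𝕜 := ℝ)).exists_bound_of_continuous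
    ((χ.contDiff (n := ⊤)).continuous_fderiv (by simp))
  refine ⟨|C| + 1, by positivity, fun R hR i x => ?_⟩
  have h1 : HasFDerivAt (fun x : RN N => R⁻¹ • x) (R⁻¹ • ContinuousLinearMap.id ℝ (RN N)) x :=
    (hasFDerivAt_id x).const_smul R⁻¹
  have h2 := (((χ.contDiff (n := ⊤)).differentiable (by simp)) (R⁻¹ • x)).hasFDerivAt.comp x h1
  have h3 : fderiv ℝ (ballCutoff R : RN N → ℝ) x = _ := h2.fderiv
  rw [pd, h3]
  simp only [ContinuousLinearMap.comp_apply, smul_apply,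
    ContinuousLinearMap.id_apply, map_smul, smul_eq_mul, abs_mul, abs_inv, abs_of_pos hR]
  have h4 : |fderiv ℝ χ (R⁻¹ • x) (EuclideanSpace.single i 1)| ≤ |C| + 1 := by
    have := (fderiv ℝ χ (R⁻¹ • x)).le_opNorm (EuclideanSpace.single i 1)
    simp only [PiLp.norm_single, norm_one, mul_one, Real.norm_eq_abs] at this
    linarith [hC (R⁻¹ • x), le_abs_self C]
  rw [div_eq_inv_mul]
  gcongr

lemma pd_ballCutoff_eq_zero {R : ℝ} (hR : 0 < R) {i : Fin 2 ⊕ Fin (N - 2)} {x : RN N}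
    (hx : ‖x‖ < R ∨ 2 * R < ‖x‖) : pd i (ballCutoff R) x = 0 := by
  rcases hx with hx | hx
  · have : (ballCutoff R : RN N → ℝ) =ᶠ[nhds x] fun _ => 1 := by
      filter_upwards [continuous_norm.continuousAt.eventually_lt_const hx] with y hy
      exact ballCutoff_eq_one hR hy.le
    rw [pd, this.fderiv_eq]; simp
  · have : (ballCutoff R : RN N → ℝ) =ᶠ[nhds x] fun _ => 0 := by
      filter_upwards [continuous_norm.continuousAt.eventually_const_lt hx] with y hy
      exact ballCutoff_eq_zero hR hy.le
    rw [pd, this.fderiv_eq]; simp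

lemma finrank_RN (hN : 3 ≤ N) : Module.finrank ℝ (RN N) = N := by
  simp; omega

/-- The `L^N` norm of the gradient of the cutoff function is bounded in `R` (it is scale
invariant). -/
lemma exists_eLpNorm_pd_ballCutoff_le (hN : 3 ≤ N) :
    ∃ C : ENNReal, C ≠ ⊤ ∧ ∀ R > 0, ∀ i : Fin 2 ⊕ Fin (N - 2),
      eLpNorm (pd i (ballCutoff R : RN N → ℝ)) N volume ≤ C := by
  obtain ⟨C, hC0, hC⟩ := exists_abs_pd_ballCutoff_le (N := N)
  have hN0 : (N : ℝ) ≠ 0 := by positivity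
  refine ⟨ENNReal.ofReal (2 * C) * volume (Metric.closedBall (0 : RN N) 1) ^ (1 / (N : ℝ)),
    ENNReal.mul_ne_top ENNReal.ofReal_ne_top (ENNReal.rpow_ne_top_of_nonneg (by positivity)
      measure_closedBall_lt_top.ne), fun R hR i => ?_⟩
  calc eLpNorm (pd i (ballCutoff R : RN N → ℝ)) N volume
      ≤ eLpNorm ((Metric.closedBall (0 : RN N) (2 * R)).indicator fun _ => C / R) N volume := by
        refine eLpNorm_mono_real fun x => ?_
        by_cases hx : x ∈ Metric.closedBall (0 : RN N) (2 * R)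
        · rw [Set.indicator_of_mem hx]; exact hC R hR i x
        · rw [Set.indicator_of_notMem hx, pd_ballCutoff_eq_zero hR (Or.inr ?_), norm_zero]
          simpa using hx
    _ ≤ ‖C / R‖ₑ * volume (Metric.closedBall (0 : RN N) (2 * R)) ^ (1 / (N : ENNReal).toReal) :=
        eLpNorm_indicator_const_le _ _
    _ = _ := by
        rw [Measure.addHaar_closedBall' _ _ (by positivity), finrank_RN hN,
          ENNReal.mul_rpow_of_nonneg _ _ (by positivity), ← mul_assoc,
          Real.enorm_of_nonneg (by positivity), ENNReal.toReal_natCast,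
          ENNReal.ofReal_rpow_of_nonneg (by positivity) (by positivity),
          ← ENNReal.ofReal_mul (by positivity), ← Real.rpow_natCast, ← Real.rpow_mul (by positivity),
          mul_one_div_cancel hN0, Real.rpow_one]
        congr 2
        field_simp

lemma holderTriple_critExp (hN : 3 ≤ N) : ENNReal.HolderTriple N (critExp N) 2 := by
  constructor
  have h : (3 : ℝ) ≤ N := by exact_mod_cast hN
  have h2 := two_lt_twoStar hN
  rw [critExp, ← ENNReal.ofReal_natCast, ← ENNReal.ofReal_ofNat 2,
    ← ENNReal.ofReal_inv_of_pos (by positivity), ← ENNReal.ofReal_inv_of_pos (by linarith),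
    ← ENNReal.ofReal_inv_of_pos (by norm_num), ← ENNReal.ofReal_add (by positivity)
      (inv_nonneg.2 (by linarith))]
  congr 1
  rw [twoStar]
  have : (N : ℝ) - 2 ≠ 0 := by linarith
  field_simp
  ring

/-- Truncation: a function of `D^{1,2}` is approximated by compactly supported ones, since
`‖u ∇χ_R‖₂ ≤ ‖u‖_{L^{2^*}(|x| ≥ R)} ‖∇χ_R‖_N`. -/
lemma D12.exists_compactSupport_approx (hN : 3 ≤ N) {u : RN N → ℝ} (hu : u ∈ D12 N)
    {ε : ENNReal} (hε : ε ≠ 0) :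
    ∃ v ∈ D12 N, HasCompactSupport v ∧ eLpNorm (fun x => u x - v x) (critExp N) volume ≤ ε ∧
      ∀ i, eLpNorm (fun x => weakPartial i u x - weakPartial i v x) 2 volume ≤ ε := by
  obtain ⟨C, hCt, hC⟩ := exists_eLpNorm_pd_ballCutoff_le hN
  have hε2 : ε / 2 ≠ 0 := by simp [hε]
  -- `C` bounds `‖∇χ_R‖_N` for all `R`, so a tail of `u` below `η` in `L^{2^*}`, with `η C < ε / 2`,
  -- makes the commutator `u ∇χ_R` small.
  obtain ⟨η, hη, hηC⟩ := ENNReal.exists_nnreal_pos_mul_lt hCt hε2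
  have hη0 : (η : ENNReal) ≠ 0 := by simpa using hη.ne'
  obtain ⟨R₁, hR₁, h1⟩ := eLpNorm_tail_le critExp_ne_top hu.1
    (show min ε (η : ENNReal) ≠ 0 from (lt_min (pos_iff_ne_zero.2 hε) (pos_iff_ne_zero.2 hη0)).ne')
  choose R₂ hR₂ h2 using fun i => eLpNorm_tail_le (by simp) (memLp_weakPartial hu i) hε2
  set R := R₁ + ∑ i, R₂ i with hRdef
  have hS : 0 ≤ ∑ i, R₂ i := Finset.sum_nonneg fun i _ => (hR₂ i).le
  have hR : 0 < R := by positivity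
  have hRR₁ : R₁ ≤ R := by linarith
  have hRR₂ : ∀ i, R₂ i ≤ R := fun i => by
    have := Finset.single_le_sum (f := R₂) (fun j _ => (hR₂ j).le) (Finset.mem_univ i)
    linarith
  have hcut := contDiff_ballCutoff (N := N) R
  have hcutm : AEStronglyMeasurable (ballCutoff R : RN N → ℝ) volume :=
    hcut.continuous.aestronglyMeasurable
  have hpdm : ∀ i, AEStronglyMeasurable (pd i (ballCutoff R : RN N → ℝ)) volume := fun i =>
    (contDiff_pd hcut).continuous.aestronglyMeasurable
  have hset : MeasurableSet {x : RN N | R ≤ ‖x‖} := measurableSet_le measurable_const measurable_norm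
  have hw : ∀ i, HasWeakPartial i (fun x => ballCutoff R x * u x) _ := fun i =>
    (hasWeakPartial hu i).mul_left hcut
  -- the truncation error is supported in `|x| ≥ R`
  have tail : ∀ g : RN N → ℝ, ∀ x, ‖g x - ballCutoff R x * g x‖
      ≤ ‖{x : RN N | R ≤ ‖x‖}.indicator g x‖ := by
    intro g x
    by_cases hx : R ≤ ‖x‖
    · rw [Set.indicator_of_mem (by exact hx), ← one_sub_mul, norm_mul]
      refine mul_le_of_le_one_left (norm_nonneg _) ?_
      rw [Real.norm_eq_abs, abs_le]
      constructor <;> linarith [ballCutoff_nonneg R x, ballCutoff_le_one R x]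
    · rw [ballCutoff_eq_one hR (not_le.1 hx).le]; simp
  -- Hölder with exponents `1/2 = 1/N + 1/2^*`; `∇χ_R` vanishes in `|x| < R`.
  have hprod : ∀ i, eLpNorm (fun x => pd i (ballCutoff R) x * u x) 2 volume ≤ C * η := by
    intro i
    have e : (fun x => pd i (ballCutoff R) x * u x)
        = pd i (ballCutoff R) • ({x : RN N | R ≤ ‖x‖}.indicator u) := by
      funext x
      by_cases hx : R ≤ ‖x‖
      · simp [Set.indicator_of_mem (show x ∈ {x : RN N | R ≤ ‖x‖} from hx)]
      · simp [pd_ballCutoff_eq_zero hR (Or.inl (not_le.1 hx))]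
    have := holderTriple_critExp hN
    rw [e]
    refine (eLpNorm_smul_le_mul_eLpNorm (p := N) (q := critExp N)
      (hu.1.aestronglyMeasurable.indicator hset) (hpdm i)).trans ?_
    exact mul_le_mul' (hC R hR i) ((h1 R hRR₁).trans (min_le_right _ _))
  have hmem : MemLp (fun x => ballCutoff R x * u x) (critExp N) volume := by
    refine hu.1.mono (hcutm.mul hu.1.aestronglyMeasurable) (Filter.Eventually.of_forall fun x => ?_)
    rw [norm_mul]
    refine mul_le_of_le_one_left (norm_nonneg _) ?_
    rw [Real.norm_of_nonneg (ballCutoff_nonneg R x)]; exact ballCutoff_le_one R x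
  have hv : (fun x => ballCutoff R x * u x) ∈ D12 N := by
    refine ⟨hmem, fun i => ⟨_, hw i, MemLp.add ?_ ?_⟩⟩
    · have hwi := memLp_weakPartial hu i
      refine hwi.mono (hcutm.mul hwi.aestronglyMeasurable) (Filter.Eventually.of_forall fun x => ?_)
      rw [norm_mul]
      refine mul_le_of_le_one_left (norm_nonneg _) ?_
      rw [Real.norm_of_nonneg (ballCutoff_nonneg R x)]; exact ballCutoff_le_one R x
    · exact ⟨(hpdm i).mul hu.1.aestronglyMeasurable, (hprod i).trans_lt
        (ENNReal.mul_lt_top hCt.lt_top ENNReal.coe_lt_top)⟩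
  refine ⟨_, hv, (hasCompactSupport_ballCutoff hR).mul_right, ?_, fun i => ?_⟩
  · exact (eLpNorm_mono (tail u)).trans ((h1 R hRR₁).trans (min_le_left _ _))
  · have hwi := memLp_weakPartial hu i
    have e : (fun x => weakPartial i u x - weakPartial i (fun x => ballCutoff R x * u x) x)
        =ᵐ[volume] fun x => (weakPartial i u x - ballCutoff R x * weakPartial i u x)
          - pd i (ballCutoff R) x * u x := by
      filter_upwards [(hw i).weakPartial_ae_eq] with x hx
      rw [hx]; ring
    rw [eLpNorm_congr_ae e]
    refine (eLpNorm_sub_le (hwi.aestronglyMeasurable.sub (hcutm.mul hwi.aestronglyMeasurable))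
      ((hpdm i).mul hu.1.aestronglyMeasurable) (by norm_num)).trans ?_
    calc _ ≤ ε / 2 + ε / 2 := by
          refine add_le_add ((eLpNorm_mono (tail _)).trans (h2 i R (hRR₂ i))) ((hprod i).trans ?_)
          rw [mul_comm]; exact hηC.le
      _ = ε := ENNReal.add_halves ε

/-! ### Density of test functions and the Sobolev inequality -/

/-- Test functions are dense in `D^{1,2}`. -/
lemma D12.exists_test_approx (hN : 3 ≤ N) {u : RN N → ℝ} (hu : u ∈ D12 N)
    {ε : ENNReal} (hε : ε ≠ 0) :
    ∃ φ : RN N → ℝ, IsTest φ ∧ eLpNorm (fun x => u x - φ x) (critExp N) volume ≤ ε ∧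
      ∀ i, eLpNorm (fun x => weakPartial i u x - pd i φ x) 2 volume ≤ ε := by
  have hε2 : ε / 2 ≠ 0 := by simp [hε]
  obtain ⟨v, hv, hvc, h1, h2⟩ := exists_compactSupport_approx hN hu hε2
  obtain ⟨r₀, hr₀, h3⟩ := mollify_approx (one_le_critExp hN) critExp_ne_top hv.1 hε2
  choose r hr h4 using fun i => mollify_approx (by norm_num) (by simp) (memLp_weakPartial hv i) hε2
  obtain ⟨s, hs, hs₀, hsi⟩ : ∃ s > 0, s ≤ r₀ ∧ ∀ i, s ≤ r i := by
    have hne : (Finset.univ : Finset (Fin 2 ⊕ Fin (N - 2))).Nonempty := ⟨Sum.inl 0, by simp⟩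
    refine ⟨min r₀ (Finset.univ.inf' hne r), lt_min hr₀ ?_, min_le_left _ _, fun i =>
      (min_le_right _ _).trans (Finset.inf'_le _ (Finset.mem_univ i))⟩
    exact (Finset.lt_inf'_iff _).2 fun i _ => hr i
  let b : ContDiffBump (0 : RN N) := ⟨s / 2, s, by positivity, by linarith⟩
  have hvl := hv.1.locallyIntegrable (one_le_critExp hN)
  have hb := isTest_mollify b hvl hvc
  refine ⟨mollify b v, hb, ?_, fun i => ?_⟩
  · have e : (fun x => u x - mollify b v x)
        = fun x => (u x - v x) - (mollify b v x - v x) := by funext x; ring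
    rw [e]
    refine (eLpNorm_sub_le (hu.1.aestronglyMeasurable.sub hv.1.aestronglyMeasurable)
      (hb.continuous.aestronglyMeasurable.sub hv.1.aestronglyMeasurable)
      (one_le_critExp hN)).trans ?_
    exact (add_le_add h1 (h3 b hs₀)).trans_eq (ENNReal.add_halves ε)
  · have hui := (memLp_weakPartial hu i).aestronglyMeasurable
    have hvi := (memLp_weakPartial hv i).aestronglyMeasurable
    have e : (fun x => weakPartial i u x - pd i (mollify b v) x)
        = fun x => (weakPartial i u x - weakPartial i v x)
          - (mollify b (weakPartial i v) x - weakPartial i v x) := by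
      funext x; rw [pd_mollify b (hasWeakPartial hv i)]; ring
    rw [e]
    refine (eLpNorm_sub_le (hui.sub hvi) (AEStronglyMeasurable.sub ?_ hvi) (by norm_num)).trans ?_
    · exact (contDiff_mollify b (hasWeakPartial hv i).2.1).continuous.aestronglyMeasurable
    · exact (add_le_add (h2 i) (h4 i b (hsi i))).trans_eq (ENNReal.add_halves ε)

lemma norm_fderiv_le_sum_pd (φ : RN N → ℝ) (x : RN N) :
    ‖fderiv ℝ φ x‖ ≤ ∑ i, |pd i φ x| := by
  refine ContinuousLinearMap.opNorm_le_bound _ (Finset.sum_nonneg fun _ _ => abs_nonneg _)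
    fun y => ?_
  have hy : y = ∑ i, y i • EuclideanSpace.single i (1 : ℝ) := by
    ext j
    simp [Pi.single_apply, -Fintype.sum_sum_type]
  conv_lhs => rw [hy, map_sum]
  refine (norm_sum_le _ _).trans ?_
  rw [Finset.sum_mul]
  refine Finset.sum_le_sum fun i _ => ?_
  rw [map_smul, norm_smul, mul_comm, pd, Real.norm_eq_abs]
  gcongr
  exact PiLp.norm_apply_le y i

/-- The Sobolev inequality for test functions. -/
lemma exists_sobolev_test (hN : 3 ≤ N) :
    ∃ C : ENNReal, C ≠ ⊤ ∧ ∀ φ : RN N → ℝ, IsTest φ →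
      eLpNorm φ (critExp N) volume ≤ C * ∑ i, eLpNorm (pd i φ) 2 volume := by
  refine ⟨SNormLESNormFDerivOfEqConst ℝ (volume : Measure (RN N)) ((2 : NNReal) : ℝ),
    ENNReal.coe_ne_top, fun φ hφ => ?_⟩
  have h : (3 : ℝ) ≤ N := by exact_mod_cast hN
  have h2 := two_lt_twoStar hN
  have hexp : ((twoStar N).toNNReal : ℝ)⁻¹
      = ((2 : NNReal)⁻¹ : NNReal) - ((Module.finrank ℝ (RN N) : ℕ) : ℝ)⁻¹ := by
    rw [finrank_RN hN, Real.coe_toNNReal _ (by linarith), twoStar]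
    have : (N : ℝ) - 2 ≠ 0 := by linarith
    push_cast
    field_simp
  have := eLpNorm_le_eLpNorm_fderiv_of_eq (volume : Measure (RN N)) (u := φ)
    (hφ.smooth.of_le (by simp)) hφ.compact (p := 2) (p' := (twoStar N).toNNReal)
    (by norm_num) (by rw [finrank_RN hN]; omega) hexp
  refine this.trans ?_
  gcongr
  have hsum : ∑ i, eLpNorm (pd i φ) 2 volume = ∑ i, eLpNorm (fun x => |pd i φ x|) 2 volume :=
    Finset.sum_congr rfl fun i _ => (eLpNorm_norm (pd i φ)).symm
  rw [hsum]
  refine le_trans ?_ (eLpNorm_sum_le (fun i _ =>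
    ((hφ.pd i).continuous.abs.aestronglyMeasurable)) (by norm_num))
  refine eLpNorm_mono_real fun x => ?_
  rw [Finset.sum_apply]
  exact norm_fderiv_le_sum_pd φ x

/-- The Sobolev inequality on `D^{1,2}`. -/
lemma exists_sobolev (hN : 3 ≤ N) :
    ∃ C : ENNReal, C ≠ ⊤ ∧ ∀ u ∈ D12 N,
      eLpNorm u (critExp N) volume ≤ C * ∑ i, eLpNorm (weakPartial i u) 2 volume := by
  obtain ⟨C, hC, hS⟩ := exists_sobolev_test hN
  refine ⟨C, hC, fun u hu => ?_⟩
  set m : ENNReal := (Fintype.card (Fin 2 ⊕ Fin (N - 2)) : ENNReal) with hm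
  have hK : 1 + C * m ≠ ⊤ := by finiteness
  refine ENNReal.le_of_forall_pos_le_add fun δ hδ _ => ?_
  have hδ0 : (δ : ENNReal) ≠ 0 := by simpa using hδ.ne'
  obtain ⟨ε, hε, hεK⟩ := ENNReal.exists_nnreal_pos_mul_lt hK hδ0
  have hε0 : (ε : ENNReal) ≠ 0 := by simpa using hε.ne'
  obtain ⟨φ, hφ, h1, h2⟩ := D12.exists_test_approx hN hu hε0
  have hpd : ∀ i, eLpNorm (pd i φ) 2 volume ≤ eLpNorm (weakPartial i u) 2 volume + ε := by
    intro i
    have e : pd i φ = fun x => weakPartial i u x - (weakPartial i u x - pd i φ x) := by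
      funext x; ring
    have hwi := (D12.memLp_weakPartial hu i).aestronglyMeasurable
    rw [e]
    refine (eLpNorm_sub_le hwi (hwi.sub (hφ.pd i).continuous.aestronglyMeasurable)
      (by norm_num)).trans ?_
    gcongr
    exact h2 i
  calc eLpNorm u (critExp N) volume
      = eLpNorm (fun x => φ x + (u x - φ x)) (critExp N) volume := by simp
    _ ≤ eLpNorm φ (critExp N) volume + ε := by
        refine (eLpNorm_add_le hφ.continuous.aestronglyMeasurable
          (hu.1.aestronglyMeasurable.sub hφ.continuous.aestronglyMeasurable)
          (one_le_critExp hN)).trans ?_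
        gcongr
        exact h1
    _ ≤ C * ∑ i, (eLpNorm (weakPartial i u) 2 volume + ε) + ε := by
        gcongr
        exact (hS φ hφ).trans (by gcongr with i; exact hpd i)
    _ = C * ∑ i, eLpNorm (weakPartial i u) 2 volume + ε * (1 + C * m) := by
        rw [Finset.sum_add_distrib, Finset.sum_const, Finset.card_univ, nsmul_eq_mul, ← hm]
        ring
    _ ≤ _ := by gcongr

end

section

variable {N : ℕ}

/-! ### The axis `r = 0` is removable -/

/-- `r²` as a polynomial in the coordinates. -/
def radSq (x : RN N) : ℝ := x (Sum.inl 0) ^ 2 + x (Sum.inl 1) ^ 2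

/-- The complement of the axis `r = 0`. -/
def offAxis (N : ℕ) : Set (RN N) := {x | rad x ≠ 0}

lemma radSq_nonneg (x : RN N) : 0 ≤ radSq x := by unfold radSq; positivity

lemma rad_sq (x : RN N) : rad x ^ 2 = radSq x := Real.sq_sqrt (radSq_nonneg x)

lemma rad_nonneg (x : RN N) : 0 ≤ rad x := Real.sqrt_nonneg _

lemma contDiff_coord (i : Fin 2 ⊕ Fin (N - 2)) : ContDiff ℝ ∞ (fun x : RN N => x i) :=
  (EuclideanSpace.proj (𝕜 := ℝ) i).contDiff

lemma contDiff_radSq : ContDiff ℝ ∞ (radSq : RN N → ℝ) :=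
  ((contDiff_coord _).pow 2).add ((contDiff_coord _).pow 2)

lemma continuous_rad : Continuous (rad : RN N → ℝ) :=
  Real.continuous_sqrt.comp contDiff_radSq.continuous

lemma mem_offAxis {x : RN N} : x ∈ offAxis N ↔ 0 < rad x :=
  ⟨fun h => (rad_nonneg x).lt_of_ne' h, fun h => h.ne'⟩

lemma radSq_pos {x : RN N} (hx : x ∈ offAxis N) : 0 < radSq x := by
  rw [← rad_sq]; exact pow_pos (mem_offAxis.1 hx) 2

lemma isOpen_offAxis : IsOpen (offAxis N) := isOpen_ne_fun continuous_rad continuous_const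

lemma ae_mem_offAxis : ∀ᵐ x ∂(volume : Measure (RN N)), x ∈ offAxis N := by
  set p : Submodule ℝ (RN N) :=
    LinearMap.ker (EuclideanSpace.proj (𝕜 := ℝ) (Sum.inl 0 : Fin 2 ⊕ Fin (N - 2))).toLinearMap
    with hp
  have hne : p ≠ ⊤ := by
    intro h
    have : (EuclideanSpace.single (Sum.inl 0) 1 : RN N) ∈ p := h ▸ Submodule.mem_top
    simp [hp] at this
  have h0 := Measure.addHaar_submodule (volume : Measure (RN N)) p hne
  rw [ae_iff]
  refine measure_mono_null (fun x hx => ?_) h0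
  have hx' : rad x = 0 := not_not.1 hx
  have h1 : radSq x = 0 := by rw [← rad_sq, hx']; ring
  have h2 : x (Sum.inl 0) = 0 := by
    unfold radSq at h1
    nlinarith [sq_nonneg (x (Sum.inl 0)), sq_nonneg (x (Sum.inl 1))]
  simpa [hp] using h2

/-- A cutoff function vanishing for `r ≤ ε` and equal to `1` for `r ≥ √2 ε`. -/
def axisCutoff (ε : ℝ) (x : RN N) : ℝ := Real.smoothTransition (radSq x / ε ^ 2 - 1)

lemma contDiff_axisCutoff (ε : ℝ) : ContDiff ℝ ∞ (axisCutoff ε : RN N → ℝ) :=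
  (Real.smoothTransition.contDiff (n := ⊤)).comp
    ((contDiff_radSq.div_const _).sub contDiff_const)

lemma axisCutoff_nonneg (ε : ℝ) (x : RN N) : 0 ≤ axisCutoff ε x := Real.smoothTransition.nonneg _

lemma axisCutoff_le_one (ε : ℝ) (x : RN N) : axisCutoff ε x ≤ 1 := Real.smoothTransition.le_one _

lemma norm_axisCutoff_le_one (ε : ℝ) (x : RN N) : ‖axisCutoff ε x‖ ≤ 1 := by
  rw [Real.norm_of_nonneg (axisCutoff_nonneg ε x)]; exact axisCutoff_le_one ε x

lemma axisCutoff_eq_zero {ε : ℝ} (hε : 0 < ε) {x : RN N} (hx : radSq x ≤ ε ^ 2) :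
    axisCutoff ε x = 0 := by
  refine Real.smoothTransition.zero_of_nonpos ?_
  rw [sub_nonpos, div_le_one (by positivity)]; exact hx

lemma axisCutoff_eq_one {ε : ℝ} (hε : 0 < ε) {x : RN N} (hx : 2 * ε ^ 2 ≤ radSq x) :
    axisCutoff ε x = 1 := by
  refine Real.smoothTransition.one_of_one_le ?_
  rw [le_sub_iff_add_le, le_div_iff₀ (by positivity)]; linarith

lemma tsupport_axisCutoff_subset {ε : ℝ} (hε : 0 < ε) :
    tsupport (axisCutoff ε : RN N → ℝ) ⊆ offAxis N := by
  have hcl : IsClosed {x : RN N | ε ^ 2 ≤ radSq x} :=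
    isClosed_le continuous_const contDiff_radSq.continuous
  have hsub : tsupport (axisCutoff ε : RN N → ℝ) ⊆ {x : RN N | ε ^ 2 ≤ radSq x} := by
    refine closure_minimal (fun x hx => ?_) hcl
    by_contra hlt
    exact hx (axisCutoff_eq_zero hε (not_le.1 hlt).le)
  intro x hx
  have h1 : ε ^ 2 ≤ radSq x := hsub hx
  intro h0
  rw [← rad_sq, h0] at h1
  nlinarith

lemma tendsto_axisCutoff {x : RN N} (hx : x ∈ offAxis N) :
    Filter.Tendsto (fun ε => axisCutoff ε x) (nhdsWithin 0 (Set.Ioi 0)) (nhds 1) := by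
  refine tendsto_const_nhds.congr' ?_
  have h1 : Filter.Tendsto (fun ε : ℝ => 2 * ε ^ 2) (nhdsWithin 0 (Set.Ioi 0)) (nhds (2 * 0 ^ 2)) :=
    (Continuous.tendsto (by fun_prop) 0).mono_left nhdsWithin_le_nhds
  filter_upwards [h1.eventually_lt_const (show 2 * (0 : ℝ) ^ 2 < radSq x by simpa using radSq_pos hx),
    self_mem_nhdsWithin] with ε hε h0
  exact (axisCutoff_eq_one h0 hε.le).symm

lemma exists_abs_deriv_smoothTransition_le :
    ∃ C > 0, ∀ t : ℝ, |deriv Real.smoothTransition t| ≤ C := by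
  have hcont : Continuous (deriv Real.smoothTransition) :=
    (Real.smoothTransition.contDiff (n := ⊤)).continuous_deriv (by simp)
  obtain ⟨C, hC⟩ := isCompact_Icc.exists_bound_of_continuousOn (s := Set.Icc (0 : ℝ) 1)
    hcont.continuousOn
  refine ⟨|C| + 1, by positivity, fun t => ?_⟩
  rcases lt_or_ge t 0 with h | h
  · have : Real.smoothTransition =ᶠ[nhds t] fun _ => 0 := by
      filter_upwards [gt_mem_nhds h] with s hs using Real.smoothTransition.zero_of_nonpos hs.le
    rw [this.deriv_eq]; simp; positivity
  rcases lt_or_ge 1 t with h1 | h1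
  · have : Real.smoothTransition =ᶠ[nhds t] fun _ => 1 := by
      filter_upwards [lt_mem_nhds h1] with s hs using Real.smoothTransition.one_of_one_le hs.le
    rw [this.deriv_eq]; simp; positivity
  · have := hC t ⟨h, h1⟩
    rw [Real.norm_eq_abs] at this
    linarith [le_abs_self C]

lemma hasFDerivAt_radSq (x : RN N) :
    HasFDerivAt (radSq : RN N → ℝ)
      ((2 * x (Sum.inl 0)) • (EuclideanSpace.proj (𝕜 := ℝ) (Sum.inl 0) : RN N →L[ℝ] ℝ)
        + (2 * x (Sum.inl 1)) • (EuclideanSpace.proj (𝕜 := ℝ) (Sum.inl 1) : RN N →L[ℝ] ℝ)) x := by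
  have h (i : Fin 2 ⊕ Fin (N - 2)) : HasFDerivAt (fun x : RN N => x i)
      (EuclideanSpace.proj (𝕜 := ℝ) i : RN N →L[ℝ] ℝ) x :=
    (EuclideanSpace.proj (𝕜 := ℝ) i : RN N →L[ℝ] ℝ).hasFDerivAt
  have := ((h (Sum.inl 0)).pow 2).add ((h (Sum.inl 1)).pow 2)
  refine this.congr_fderiv ?_
  simp

lemma pd_radSq (i : Fin 2 ⊕ Fin (N - 2)) (x : RN N) :
    pd i radSq x = 2 * x (Sum.inl 0) * (if i = Sum.inl 0 then 1 else 0)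
      + 2 * x (Sum.inl 1) * (if i = Sum.inl 1 then 1 else 0) := by
  rw [pd, (hasFDerivAt_radSq x).fderiv]
  simp [eq_comm]

lemma pd_axisCutoff (ε : ℝ) (i : Fin 2 ⊕ Fin (N - 2)) (x : RN N) :
    pd i (axisCutoff ε) x
      = deriv Real.smoothTransition (radSq x / ε ^ 2 - 1) * (pd i radSq x / ε ^ 2) := by
  have h1 : HasFDerivAt (fun x : RN N => radSq x / ε ^ 2 - 1)
      ((ε ^ 2)⁻¹ • fderiv ℝ (radSq : RN N → ℝ) x) x := by
    have := (((contDiff_radSq (N := N)).differentiable (by simp) x).hasFDerivAt.const_mul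
      (ε ^ 2)⁻¹).sub_const 1
    refine this.congr_of_eventuallyEq (Filter.Eventually.of_forall fun y => ?_)
    simp only [div_eq_inv_mul]
  have h2 : HasDerivAt Real.smoothTransition _ (radSq x / ε ^ 2 - 1) :=
    (((Real.smoothTransition.contDiff (n := ⊤)).differentiable (by simp)) _).hasDerivAt
  have h3 : fderiv ℝ (axisCutoff ε : RN N → ℝ) x = _ := (h2.comp_hasFDerivAt x h1).fderiv
  rw [pd, h3]
  simp [pd, div_eq_inv_mul]

lemma exists_abs_pd_axisCutoff_le :
    ∃ C > 0, ∀ ε > 0, ∀ (i : Fin 2 ⊕ Fin (N - 2)) (x : RN N),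
      radSq x ≤ 2 * ε ^ 2 → |pd i (axisCutoff ε) x| ≤ C / ε := by
  obtain ⟨C, hC0, hC⟩ := exists_abs_deriv_smoothTransition_le
  refine ⟨C * 8, by positivity, fun ε hε i x hx => ?_⟩
  have hb : ∀ k : Fin 2, |x (Sum.inl k)| ≤ 2 * ε := by
    intro k
    refine abs_le_of_sq_le_sq ?_ (by positivity)
    unfold radSq at hx
    fin_cases k
    · simp only [Fin.zero_eta]
      nlinarith [sq_nonneg (x (Sum.inl 1)), sq_nonneg (x (Sum.inl 0))]
    · simp only [Fin.mk_one]
      nlinarith [sq_nonneg (x (Sum.inl 1)), sq_nonneg (x (Sum.inl 0))]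
  have hpd : |pd i radSq x| ≤ 8 * ε := by
    rw [pd_radSq]
    have h0 := hb 0
    have h1 := hb 1
    refine (abs_add_le _ _).trans ?_
    have e : ∀ (a : ℝ) (p : Prop) [Decidable p], |2 * a * (if p then 1 else 0)| ≤ 2 * |a| := by
      intro a p _
      split_ifs <;> simp [abs_mul]
    linarith [e (x (Sum.inl 0)) (i = Sum.inl 0), e (x (Sum.inl 1)) (i = Sum.inl 1)]
  rw [pd_axisCutoff, abs_mul, abs_div, abs_of_pos (show (0 : ℝ) < ε ^ 2 by positivity)]
  calc _ ≤ C * (8 * ε / ε ^ 2) := by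
        gcongr
        exact hC _
    _ = C * 8 / ε := by field_simp

lemma pd_axisCutoff_eq_zero {ε : ℝ} (hε : 0 < ε) {i : Fin 2 ⊕ Fin (N - 2)} {x : RN N}
    (hx : 2 * ε ^ 2 < radSq x) : pd i (axisCutoff ε) x = 0 := by
  have : (axisCutoff ε : RN N → ℝ) =ᶠ[nhds x] fun _ => 1 := by
    filter_upwards [contDiff_radSq.continuous.continuousAt.eventually_const_lt hx] with y hy
    exact axisCutoff_eq_one hε hy.le
  rw [pd, this.fderiv_eq]; simp

/-- The tube of radius `√2 ε` around the axis, intersected with a ball. -/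
def tube (R ε : ℝ) : Set (RN N) := {x | radSq x ≤ 2 * ε ^ 2} ∩ Metric.closedBall 0 R

lemma measurableSet_tube (R ε : ℝ) : MeasurableSet (tube R ε : Set (RN N)) :=
  (measurableSet_le contDiff_radSq.continuous.measurable measurable_const).inter
    Metric.isClosed_closedBall.measurableSet

/-- The axis has codimension two: the volume of the tube is `O(ε²)`. -/
lemma volume_tube_le {R : ℝ} (hR : 0 ≤ R) {ε : ℝ} (hε : 0 < ε) :
    volume (tube R ε : Set (RN N)) ≤ ENNReal.ofReal (16 * (2 * R) ^ (N - 2) * ε ^ 2) := by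
  -- The tube lies in the box `[-2ε, 2ε]² × [-R, R]^(N-2)`.
  set B : Set (Fin 2 ⊕ Fin (N - 2) → ℝ) :=
    Set.univ.pi (Sum.elim (fun _ => Set.Icc (-(2 * ε)) (2 * ε)) fun _ => Set.Icc (-R) R) with hB
  have hBm : MeasurableSet B := by
    refine MeasurableSet.univ_pi fun i => ?_
    rcases i with i | i <;> exact measurableSet_Icc
  have hsub : (tube R ε : Set (RN N)) ⊆ WithLp.ofLp ⁻¹' B := by
    rintro x ⟨hx1, hx2⟩ i -
    rcases i with k | j
    · simp only [Sum.elim_inl, ← abs_le, Set.mem_Icc]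
      refine abs_le_of_sq_le_sq ?_ (by positivity)
      simp only [Set.mem_ofPred_eq, radSq] at hx1
      fin_cases k
      · simp only [Fin.zero_eta]
        nlinarith [sq_nonneg (x (Sum.inl 1)), sq_nonneg (x (Sum.inl 0))]
      · simp only [Fin.mk_one]
        nlinarith [sq_nonneg (x (Sum.inl 1)), sq_nonneg (x (Sum.inl 0))]
    · simp only [Sum.elim_inr, ← abs_le, Set.mem_Icc]
      rw [mem_closedBall_zero_iff] at hx2
      exact (PiLp.norm_apply_le x (Sum.inr j)).trans hx2
  refine (measure_mono hsub).trans ?_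
  rw [(PiLp.volume_preserving_ofLp _).measure_preimage hBm.nullMeasurableSet, hB, volume_pi_pi,
    Fintype.prod_sum_type]
  simp only [Sum.elim_inl, Sum.elim_inr, Real.volume_Icc, Finset.prod_const, Finset.card_univ,
    Fintype.card_fin]
  rw [← ENNReal.ofReal_pow (by linarith), ← ENNReal.ofReal_pow (by linarith),
    ← ENNReal.ofReal_mul (by positivity)]
  refine ENNReal.ofReal_le_ofReal (le_of_eq ?_)
  rw [show R - -R = 2 * R by ring]
  ring

/-- By the Cauchy-Schwarz inequality and the `O(ε²)` bound on the volume of the tube where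
`|∇η_ε| ≤ C/ε` is supported, `∫ g ∂ᵢη_ε → 0` for every compactly supported `g ∈ L²`. -/
lemma tendsto_integral_mul_pd_axisCutoff {g : RN N → ℝ} (hg : MemLp g 2 volume) {R : ℝ}
    (hR : 0 ≤ R) (hgR : ∀ x, R < ‖x‖ → g x = 0) (i : Fin 2 ⊕ Fin (N - 2)) :
    Filter.Tendsto (fun ε => ∫ x, g x * pd i (axisCutoff ε) x) (nhdsWithin 0 (Set.Ioi 0))
      (nhds 0) := by
  obtain ⟨C, hC0, hC⟩ := exists_abs_pd_axisCutoff_le (N := N)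
  set K : ℝ := 16 * (2 * R) ^ (N - 2) with hK
  have hK0 : 0 ≤ K := by positivity
  set M : ℝ := C * √K + 1 with hM
  have hM0 : 0 < M := by positivity
  have hvol : ∀ ε > 0, volume (tube R ε : Set (RN N)) ≤ ENNReal.ofReal (K * ε ^ 2) :=
    fun ε hε => volume_tube_le hR hε
  have main : ∀ ε > 0, ‖∫ x, g x * pd i (axisCutoff ε) x‖ₑ
      ≤ ENNReal.ofReal M * eLpNorm ((tube R ε).indicator g) 2 volume := by
    intro ε hε
    have e : (fun x => g x * pd i (axisCutoff ε) x)
        = ((tube R ε).indicator (pd i (axisCutoff ε))) • ((tube R ε).indicator g) := by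
      funext x
      by_cases hx : x ∈ tube R ε
      · simp [Set.indicator_of_mem hx, mul_comm]
      · simp only [Pi.smul_apply', Set.indicator_of_notMem hx, smul_zero]
        by_cases h1 : radSq x ≤ 2 * ε ^ 2
        · have : R < ‖x‖ := by
            by_contra hle
            exact hx ⟨h1, by simpa using hle⟩
          rw [hgR x this, zero_mul]
        · rw [pd_axisCutoff_eq_zero hε (not_le.1 h1), mul_zero]
    have hpdm : AEStronglyMeasurable (pd i (axisCutoff ε : RN N → ℝ)) volume :=
      (contDiff_pd (contDiff_axisCutoff ε)).continuous.aestronglyMeasurable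
    have hmt := measurableSet_tube (N := N) R ε
    have h1 : eLpNorm ((tube R ε).indicator (pd i (axisCutoff ε : RN N → ℝ))) 2 volume
        ≤ ENNReal.ofReal M := by
      calc _ ≤ eLpNorm ((tube R ε : Set (RN N)).indicator fun _ => C / ε) 2 volume := by
            refine eLpNorm_mono_real fun x => ?_
            by_cases hx : x ∈ tube R ε
            · simp only [Set.indicator_of_mem hx]
              exact hC ε hε i x hx.1
            · simp [Set.indicator_of_notMem hx]
        _ ≤ ‖C / ε‖ₑ * volume (tube R ε : Set (RN N)) ^ (1 / (2 : ENNReal).toReal) :=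
            eLpNorm_indicator_const_le _ _
        _ ≤ ENNReal.ofReal (C / ε) * ENNReal.ofReal (K * ε ^ 2) ^ (1 / (2 : ENNReal).toReal) := by
            rw [Real.enorm_of_nonneg (by positivity)]
            gcongr
            exact hvol ε hε
        _ = ENNReal.ofReal (C * √K) := by
            rw [ENNReal.toReal_ofNat, ENNReal.ofReal_rpow_of_nonneg (by positivity) (by norm_num),
              ← Real.sqrt_eq_rpow, ← ENNReal.ofReal_mul (by positivity),
              Real.sqrt_mul hK0, Real.sqrt_sq hε.le]
            congr 1
            field_simp
        _ ≤ ENNReal.ofReal M := ENNReal.ofReal_le_ofReal (by linarith)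
    calc _ ≤ ∫⁻ x, ‖g x * pd i (axisCutoff ε) x‖ₑ := enorm_integral_le_lintegral_enorm _
      _ = eLpNorm (fun x => g x * pd i (axisCutoff ε) x) 1 volume := by
          rw [eLpNorm_one_eq_lintegral_enorm]
      _ ≤ eLpNorm ((tube R ε).indicator (pd i (axisCutoff ε : RN N → ℝ))) 2 volume
          * eLpNorm ((tube R ε).indicator g) 2 volume := by
          rw [e]
          exact eLpNorm_smul_le_mul_eLpNorm (hg.aestronglyMeasurable.indicator hmt)
            (hpdm.indicator hmt)
      _ ≤ _ := by gcongr
  rw [Metric.tendsto_nhds]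
  intro δ hδ
  -- The factor `‖∂ᵢη_ε‖₂` only stays bounded; smallness comes from the `L²` norm of `g` over the
  -- shrinking tubes.
  obtain ⟨η, hη, hηs⟩ := hg.eLpNorm_indicator_le (by norm_num) (by simp)
    (show 0 < δ / (2 * M) by positivity)
  have h1 : Filter.Tendsto (fun ε : ℝ => K * ε ^ 2) (nhdsWithin 0 (Set.Ioi 0)) (nhds (K * 0 ^ 2)) :=
    (Continuous.tendsto (by fun_prop) 0).mono_left nhdsWithin_le_nhds
  filter_upwards [h1.eventually_lt_const (show K * (0 : ℝ) ^ 2 < η by simpa using hη),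
    self_mem_nhdsWithin] with ε hε h0
  have h2 := hηs _ (measurableSet_tube R ε)
    ((hvol ε h0).trans (ENNReal.ofReal_le_ofReal hε.le))
  have h3 := (main ε h0).trans (mul_le_mul_right h2 _)
  rw [← ENNReal.ofReal_mul hM0.le, ← ofReal_norm, ENNReal.ofReal_le_ofReal_iff (by positivity)] at h3
  rw [dist_zero_right]
  refine h3.trans_lt ?_
  have : M * (δ / (2 * M)) = δ / 2 := by field_simp
  rw [this]; linarith

lemma tendsto_integral_mul_axisCutoff {g : RN N → ℝ} (hg : Integrable g volume) :
    Filter.Tendsto (fun ε => ∫ x, g x * axisCutoff ε x) (nhdsWithin 0 (Set.Ioi 0))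
      (nhds (∫ x, g x)) := by
  refine tendsto_integral_filter_of_dominated_convergence (fun x => ‖g x‖)
    (Filter.Eventually.of_forall fun ε => hg.aestronglyMeasurable.mul
      (contDiff_axisCutoff ε).continuous.aestronglyMeasurable)
    (Filter.Eventually.of_forall fun ε => Filter.Eventually.of_forall fun x => ?_) hg.norm ?_
  · rw [norm_mul]
    exact mul_le_of_le_one_right (norm_nonneg _) (norm_axisCutoff_le_one ε x)
  · filter_upwards [ae_mem_offAxis] with x hx
    simpa using (tendsto_axisCutoff hx).const_mul (g x)

/-- An equation in divergence form with locally square integrable flux that holds off the axis holds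
on the whole space. -/
lemma divergence_equation_of_offAxis {G : Fin 2 ⊕ Fin (N - 2) → RN N → ℝ} {g : RN N → ℝ}
    (hG : ∀ i, LocallyIntegrable (G i) volume)
    (hG2 : ∀ i φ, IsTest φ → MemLp (fun x => G i x * φ x) 2 volume)
    (hg : LocallyIntegrable g volume)
    (h : ∀ φ, IsTest φ → tsupport φ ⊆ offAxis N →
      ∑ i, ∫ x, G i x * pd i φ x = ∫ x, g x * φ x)
    {φ : RN N → ℝ} (hφ : IsTest φ) :
    ∑ i, ∫ x, G i x * pd i φ x = ∫ x, g x * φ x := by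
  obtain ⟨R, hR, hφR⟩ := hφ.compact.exists_pos_le_norm
  have hgφ := integrable_mul_test hg hφ
  have hGφ := fun i => integrable_mul_test (hG i) (hφ.pd i)
  have hlim1 := tendsto_integral_mul_axisCutoff hgφ
  have hlim2 : Filter.Tendsto (fun ε => ∑ i, ((∫ x, G i x * pd i φ x * axisCutoff ε x)
      + ∫ x, G i x * φ x * pd i (axisCutoff ε) x)) (nhdsWithin 0 (Set.Ioi 0))
      (nhds (∑ i, ((∫ x, G i x * pd i φ x) + 0))) := by
    refine tendsto_finsetSum _ fun i _ => (tendsto_integral_mul_axisCutoff (hGφ i)).add ?_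
    exact tendsto_integral_mul_pd_axisCutoff (hG2 i φ hφ) hR.le
      (fun x hx => by rw [hφR x hx.le, mul_zero]) i
  simp only [add_zero] at hlim2
  refine tendsto_nhds_unique (hlim2.congr' ?_) hlim1
  filter_upwards [self_mem_nhdsWithin] with ε hε
  have hη := contDiff_axisCutoff (N := N) ε
  have hηφ : IsTest (fun x => axisCutoff ε x * φ x) := hφ.mul_left hη
  have hs : tsupport (fun x => axisCutoff ε x * φ x) ⊆ offAxis N :=
    (closure_mono (Function.support_mul_subset_left _ _)).trans (tsupport_axisCutoff_subset hε)
  have := h _ hηφ hs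
  have e : ∀ x, g x * (axisCutoff ε x * φ x) = g x * φ x * axisCutoff ε x := fun x => by ring
  simp_rw [e] at this
  rw [← this]
  refine Finset.sum_congr rfl fun i _ => ?_
  rw [← integral_add]
  · refine integral_congr_ae (Filter.Eventually.of_forall fun x => ?_)
    simp only
    rw [pd_mul (hη.differentiable (by simp) x) (hφ.differentiable x)]
    ring
  · have := integrable_mul_test (hG i) ((hφ.pd i).mul_left hη)
    refine this.congr (Filter.Eventually.of_forall fun x => ?_)
    simp only; ring
  · have := integrable_mul_test (hG i) (hφ.mul_left (contDiff_pd (i := i) hη))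
    refine this.congr (Filter.Eventually.of_forall fun x => ?_)
    simp only; ring

/-- A weak partial derivative off the axis of a function in `L^{2^*}` is a weak partial derivative
on the whole space. -/
lemma HasWeakPartialOn.of_offAxis (hN : 3 ≤ N) {i : Fin 2 ⊕ Fin (N - 2)} {u w : RN N → ℝ}
    (hu : MemLp u (critExp N) volume) (hw : LocallyIntegrable w volume)
    (h : HasWeakPartialOn (offAxis N) i u w) : HasWeakPartial i u w := by
  have hul := hu.locallyIntegrable (one_le_critExp hN)
  refine ⟨hul, hw, fun φ h1 h2 => ?_⟩
  have hsum : ∀ φ : RN N → ℝ, ∑ j, ∫ x, (if j = i then -u x else 0) * pd j φ x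
      = -∫ x, u x * pd i φ x := by
    intro φ
    rw [Finset.sum_eq_single i]
    · simp [integral_neg]
    · intro j _ hj; simp [hj]
    · simp
  have hcase : ∀ j, (fun x => if j = i then -u x else 0) = if j = i then -u else 0 := by
    intro j; split_ifs <;> rfl
  -- The weak partial derivative is the equation `-div G = w` with flux `G = -u eᵢ`.
  have := divergence_equation_of_offAxis (G := fun j x => if j = i then -u x else 0) (g := w)
    (fun j => ?_) (fun j φ hφ => ?_) hw (fun φ hφ hφs => ?_) ⟨h1, h2⟩
  · rw [hsum] at this
    exact this.symm
  · rw [hcase]; split_ifs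
    · exact hul.neg
    · exact locallyIntegrable_zero
  · by_cases hj : j = i
    · have := holderTriple_critExp hN
      have hm := hu.smul (hφ.memLp N) (r := 2)
      simp only [hj, if_true]
      refine hm.neg.ae_eq (Filter.Eventually.of_forall fun x => ?_)
      simp [mul_comm]
    · simp [hj]
  · rw [hsum]
    exact (h.2.2 φ hφ hφs).symm

end

section

variable {N : ℕ}

/-! ### The cylindrical frame -/

/-- The `j`-th component of the unit angular field `(-x₂, x₁, 0) / r`. -/
def tau (j : Fin 2 ⊕ Fin (N - 2)) (x : RN N) : ℝ := rotVec x j / rad x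

/-- The vector `(x₁, x₂, 0)`. -/
def radialVec (x : RN N) : RN N :=
  WithLp.toLp 2 (Sum.elim (fun k => x (Sum.inl k)) fun _ => 0)

/-- The `j`-th component of the unit radial field `(x₁, x₂, 0) / r`. -/
def rho (j : Fin 2 ⊕ Fin (N - 2)) (x : RN N) : ℝ := radialVec x j / rad x

@[simp] lemma radialVec_inl (x : RN N) (k : Fin 2) : radialVec x (Sum.inl k) = x (Sum.inl k) := rfl
@[simp] lemma radialVec_inr (x : RN N) (j : Fin (N - 2)) : radialVec x (Sum.inr j) = 0 := rfl

@[simp] lemma rotVec_inl_zero (x : RN N) : rotVec x (Sum.inl 0) = -x (Sum.inl 1) := rfl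
@[simp] lemma rotVec_inl_one (x : RN N) : rotVec x (Sum.inl 1) = x (Sum.inl 0) := rfl
@[simp] lemma rotVec_inr (x : RN N) (j : Fin (N - 2)) : rotVec x (Sum.inr j) = 0 := rfl

@[simp] lemma tau_inr (j : Fin (N - 2)) (x : RN N) : tau (Sum.inr j) x = 0 := by simp [tau]
@[simp] lemma rho_inr (j : Fin (N - 2)) (x : RN N) : rho (Sum.inr j) x = 0 := by simp [rho]

lemma sum_mul_tau (c : Fin 2 ⊕ Fin (N - 2) → ℝ) (x : RN N) :
    ∑ i, c i * tau i x = c (Sum.inl 0) * tau (Sum.inl 0) x + c (Sum.inl 1) * tau (Sum.inl 1) x := by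
  simp [Fintype.sum_sum_type, Fin.sum_univ_two]

lemma sum_mul_rho (c : Fin 2 ⊕ Fin (N - 2) → ℝ) (x : RN N) :
    ∑ i, c i * rho i x = c (Sum.inl 0) * rho (Sum.inl 0) x + c (Sum.inl 1) * rho (Sum.inl 1) x := by
  simp [Fintype.sum_sum_type, Fin.sum_univ_two]

lemma rad_mul_self {x : RN N} : rad x * rad x = x (Sum.inl 0) ^ 2 + x (Sum.inl 1) ^ 2 := by
  rw [← sq, rad_sq]; rfl

lemma sum_tau_mul_tau {x : RN N} (hx : x ∈ offAxis N) : ∑ i, tau i x * tau i x = 1 := by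
  have hr := (mem_offAxis.1 hx).ne'
  rw [sum_mul_tau]
  simp only [tau, rotVec_inl_zero, rotVec_inl_one]
  field_simp
  linarith [rad_mul_self (x := x)]

lemma sum_rho_mul_rho {x : RN N} (hx : x ∈ offAxis N) : ∑ i, rho i x * rho i x = 1 := by
  have hr := (mem_offAxis.1 hx).ne'
  rw [sum_mul_rho]
  simp only [rho, radialVec_inl]
  field_simp
  linarith [rad_mul_self (x := x)]

lemma sum_rho_mul_tau (x : RN N) : ∑ i, rho i x * tau i x = 0 := by
  rw [sum_mul_tau]
  simp only [rho, tau, rotVec_inl_zero, rotVec_inl_one, radialVec_inl]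
  ring

lemma sum_tau_mul_rho (x : RN N) : ∑ i, tau i x * rho i x = 0 := by
  rw [← sum_rho_mul_tau x]; exact Finset.sum_congr rfl fun i _ => mul_comm _ _

lemma abs_tau_le_one (j : Fin 2 ⊕ Fin (N - 2)) (x : RN N) : |tau j x| ≤ 1 := by
  have h := rad_mul_self (x := x)
  have h0 := rad_nonneg x
  rw [tau, abs_div, abs_of_nonneg h0]
  refine div_le_one_of_le₀ ?_ h0
  rcases j with k | j
  · refine abs_le_of_sq_le_sq ?_ h0
    fin_cases k
    · simp only [Fin.zero_eta, rotVec_inl_zero]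
      nlinarith [sq_nonneg (x (Sum.inl 0))]
    · simp only [Fin.mk_one, rotVec_inl_one]
      nlinarith [sq_nonneg (x (Sum.inl 1))]
  · simpa using h0

lemma abs_rho_le_one (j : Fin 2 ⊕ Fin (N - 2)) (x : RN N) : |rho j x| ≤ 1 := by
  have h := rad_mul_self (x := x)
  have h0 := rad_nonneg x
  rw [rho, abs_div, abs_of_nonneg h0]
  refine div_le_one_of_le₀ ?_ h0
  rcases j with k | j
  · refine abs_le_of_sq_le_sq ?_ h0
    fin_cases k
    · simp only [Fin.zero_eta, radialVec_inl]
      nlinarith [sq_nonneg (x (Sum.inl 1))]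
    · simp only [Fin.mk_one, radialVec_inl]
      nlinarith [sq_nonneg (x (Sum.inl 0))]
  · simpa using h0

lemma contDiff_rotVec (j : Fin 2 ⊕ Fin (N - 2)) : ContDiff ℝ ∞ (fun x : RN N => rotVec x j) := by
  rcases j with k | j
  · fin_cases k
    · exact (contDiff_coord _).neg
    · exact contDiff_coord _
  · exact contDiff_const

lemma contDiff_radialVec (j : Fin 2 ⊕ Fin (N - 2)) :
    ContDiff ℝ ∞ (fun x : RN N => radialVec x j) := by
  rcases j with k | j
  · exact contDiff_coord _
  · exact contDiff_const

lemma contDiffOn_rad : ContDiffOn ℝ ∞ (rad : RN N → ℝ) (offAxis N) :=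
  contDiff_radSq.contDiffOn.sqrt fun _ hx => (radSq_pos hx).ne'

lemma contDiffOn_tau (j : Fin 2 ⊕ Fin (N - 2)) : ContDiffOn ℝ ∞ (tau j) (offAxis N) :=
  (contDiff_rotVec j).contDiffOn.div contDiffOn_rad fun _ hx => hx

lemma contDiffOn_rho (j : Fin 2 ⊕ Fin (N - 2)) : ContDiffOn ℝ ∞ (rho j) (offAxis N) :=
  (contDiff_radialVec j).contDiffOn.div contDiffOn_rad fun _ hx => hx

lemma measurable_rad : Measurable (rad : RN N → ℝ) := continuous_rad.measurable

lemma measurable_tau (j : Fin 2 ⊕ Fin (N - 2)) : Measurable (tau j : RN N → ℝ) :=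
  (contDiff_rotVec j).continuous.measurable.div measurable_rad

lemma measurable_rho (j : Fin 2 ⊕ Fin (N - 2)) : Measurable (rho j : RN N → ℝ) :=
  (contDiff_radialVec j).continuous.measurable.div measurable_rad

lemma differentiableAt_of_offAxis {ζ : RN N → ℝ} (h : ContDiffOn ℝ ∞ ζ (offAxis N)) {x : RN N}
    (hx : x ∈ offAxis N) : DifferentiableAt ℝ ζ x :=
  (h.contDiffAt (isOpen_offAxis.mem_nhds hx)).differentiableAt (by simp)

lemma pd_coord (i j : Fin 2 ⊕ Fin (N - 2)) (x : RN N) :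
    pd i (fun x : RN N => x j) x = if i = j then 1 else 0 := by
  have h : HasFDerivAt (fun x : RN N => x j)
      (EuclideanSpace.proj (𝕜 := ℝ) j : RN N →L[ℝ] ℝ) x :=
    (EuclideanSpace.proj (𝕜 := ℝ) j : RN N →L[ℝ] ℝ).hasFDerivAt
  rw [pd, h.fderiv]
  simp [eq_comm]

lemma pd_const (i : Fin 2 ⊕ Fin (N - 2)) (c : ℝ) (x : RN N) : pd i (fun _ : RN N => c) x = 0 := by
  simp [pd]

lemma pd_neg (i : Fin 2 ⊕ Fin (N - 2)) (u : RN N → ℝ) (x : RN N) :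
    pd i (fun y => -u y) x = -pd i u x := by
  simp only [pd, fderiv_fun_neg, neg_apply]

lemma pd_rad (i : Fin 2 ⊕ Fin (N - 2)) {x : RN N} (hx : x ∈ offAxis N) : pd i rad x = rho i x := by
  have hr := mem_offAxis.1 hx
  have h : HasFDerivAt (rad : RN N → ℝ) _ x := (hasFDerivAt_radSq x).sqrt (radSq_pos hx).ne'
  have e : √(radSq x) = rad x := rfl
  rw [pd, h.fderiv, e, rho]
  rcases i with k | j
  · fin_cases k <;> simp <;> field_simp
  · simp

lemma pd_div_rad (i : Fin 2 ⊕ Fin (N - 2)) {c : RN N → ℝ} (hc : ContDiff ℝ ∞ c) {x : RN N}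
    (hx : x ∈ offAxis N) :
    pd i (fun y => c y / rad y) x = pd i c x / rad x - c x * rho i x / rad x ^ 2 := by
  have hr := (mem_offAxis.1 hx).ne'
  have hd : HasFDerivAt (fun y : RN N => (rad y)⁻¹) _ x := (hasDerivAt_inv hr).comp_hasFDerivAt x
    (differentiableAt_of_offAxis contDiffOn_rad hx).hasFDerivAt
  have hd' : pd i (fun y => (rad y)⁻¹) x = -(rad x ^ 2)⁻¹ * pd i rad x := by
    have h : fderiv ℝ (fun y : RN N => (rad y)⁻¹) x = _ := hd.fderiv
    rw [pd, h]
    simp [pd]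
  simp_rw [div_eq_mul_inv]
  rw [pd_mul (hc.differentiable (by simp) x) hd.differentiableAt, hd', pd_rad i hx]
  ring

/-- The only nonvanishing derivative of the angular field is the angular one, and it points in the
direction opposite to the radial field. -/
lemma pd_tau (i j : Fin 2 ⊕ Fin (N - 2)) {x : RN N} (hx : x ∈ offAxis N) :
    pd i (tau j) x = -(tau i x * rho j x / rad x) := by
  have hr := (mem_offAxis.1 hx).ne'
  have h2 := rad_mul_self (x := x)
  have e : (tau j : RN N → ℝ) = fun y => rotVec y j / rad y := rfl
  rw [e, pd_div_rad i (contDiff_rotVec j) hx]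
  rcases j with k | j
  · fin_cases k
    · have e1 : (fun y : RN N => rotVec y (Sum.inl 0)) = fun y => -y (Sum.inl 1) := rfl
      simp only [Fin.zero_eta, e1, pd_neg, pd_coord]
      rcases i with k | i
      · fin_cases k <;> simp [tau, rho] <;> field_simp
        linarith
      · simp
    · have e1 : (fun y : RN N => rotVec y (Sum.inl 1)) = fun y => y (Sum.inl 0) := rfl
      simp only [Fin.mk_one, e1, pd_coord]
      rcases i with k | i
      · fin_cases k <;> simp [tau, rho] <;> field_simp
        linarith
      · simp
  · simp [pd_const]

lemma pd_rho (i j : Fin 2 ⊕ Fin (N - 2)) {x : RN N} (hx : x ∈ offAxis N) :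
    pd i (rho j) x = tau i x * tau j x / rad x := by
  have hr := (mem_offAxis.1 hx).ne'
  have h2 := rad_mul_self (x := x)
  have e : (rho j : RN N → ℝ) = fun y => radialVec y j / rad y := rfl
  rw [e, pd_div_rad i (contDiff_radialVec j) hx]
  rcases j with k | j
  · simp only [radialVec_inl, pd_coord]
    fin_cases k
    · rcases i with k | i
      · fin_cases k <;> simp [tau, rho] <;> field_simp
        linarith
      · simp
    · rcases i with k | i
      · fin_cases k <;> simp [tau, rho] <;> field_simp
        linarith
      · simp
  · simp [pd_const]

/-! ### Rotations and invariant functions -/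

/-- The derivative along the rotations, `∂_θ φ = (-x₂, x₁, 0) · ∇φ`. -/
def angularDeriv (φ : RN N → ℝ) (x : RN N) : ℝ := ∑ i, rotVec x i * pd i φ x

lemma IsTest.angularDeriv {φ : RN N → ℝ} (hφ : IsTest φ) : IsTest (angularDeriv φ) := by
  have e : CurlCurl.angularDeriv φ = fun x => rotVec x (Sum.inl 0) * CurlCurl.pd (Sum.inl 0) φ x
      + rotVec x (Sum.inl 1) * CurlCurl.pd (Sum.inl 1) φ x := by
    funext x
    simp [CurlCurl.angularDeriv, Fintype.sum_sum_type, Fin.sum_univ_two]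
  rw [e]
  exact ((hφ.pd _).mul_left (contDiff_rotVec _)).add ((hφ.pd _).mul_left (contDiff_rotVec _))

lemma fderiv_rotVec (φ : RN N → ℝ) (x : RN N) : fderiv ℝ φ x (rotVec x) = angularDeriv φ x := by
  have hy : rotVec x = ∑ i, rotVec x i • EuclideanSpace.single i (1 : ℝ) := by
    ext j
    simp [Pi.single_apply, -Fintype.sum_sum_type]
  conv_lhs => rw [hy, map_sum]
  simp [angularDeriv, pd]

/-- The planar rotation by the angle `t`. -/
def planeRotation (t : ℝ) : Matrix.specialOrthogonalGroup (Fin 2) ℝ :=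
  ⟨!![Real.cos t, -Real.sin t; Real.sin t, Real.cos t], by
    rw [Matrix.mem_specialOrthogonalGroup_iff, Matrix.mem_orthogonalGroup_iff]
    constructor
    · ext i j
      fin_cases i <;> fin_cases j <;>
        simp [Matrix.mul_apply, Fin.sum_univ_two] <;> nlinarith [Real.sin_sq_add_cos_sq t]
    · rw [Matrix.det_fin_two_of]
      nlinarith [Real.sin_sq_add_cos_sq t]⟩

lemma soAct_inl (g : Matrix.specialOrthogonalGroup (Fin 2) ℝ) (x : RN N) (k : Fin 2) :
    soAct g x (Sum.inl k) = (g : Matrix (Fin 2) (Fin 2) ℝ) k 0 * x (Sum.inl 0)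
      + (g : Matrix (Fin 2) (Fin 2) ℝ) k 1 * x (Sum.inl 1) := by
  simp [soAct, Matrix.mulVec, dotProduct, Fintype.sum_sum_type, Fin.sum_univ_two]

lemma soAct_inr (g : Matrix.specialOrthogonalGroup (Fin 2) ℝ) (x : RN N) (j : Fin (N - 2)) :
    soAct g x (Sum.inr j) = x (Sum.inr j) := by
  simp [soAct, Matrix.mulVec, dotProduct, Fintype.sum_sum_type, Matrix.one_apply]

lemma measurePreserving_soAct (g : Matrix.specialOrthogonalGroup (Fin 2) ℝ) :
    MeasurePreserving (soAct g : RN N → RN N) volume volume := by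
  set M : Matrix (Fin 2 ⊕ Fin (N - 2)) (Fin 2 ⊕ Fin (N - 2)) ℝ :=
    Matrix.fromBlocks (g : Matrix (Fin 2) (Fin 2) ℝ) 0 0 1 with hM
  have hdet : M.det = 1 := by
    rw [hM, Matrix.det_fromBlocks_zero₂₁, Matrix.det_one, mul_one]
    exact (Matrix.mem_specialOrthogonalGroup_iff.1 g.2).2
  have h1 : MeasurePreserving (Matrix.toLin' M) volume volume := by
    refine ⟨(LinearMap.continuous_of_finiteDimensional _).measurable, ?_⟩
    rw [Real.map_matrix_volume_pi_eq_smul_volume_pi (by rw [hdet]; norm_num), hdet]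
    simp
  exact (PiLp.volume_preserving_toLp _).comp (h1.comp (PiLp.volume_preserving_ofLp _))

lemma SOInvariant.congr {u v : RN N → ℝ} (hu : SOInvariant u) (huv : u =ᵐ[volume] v) :
    SOInvariant v := by
  intro g
  have h := (measurePreserving_soAct (N := N) g).quasiMeasurePreserving.ae huv
  filter_upwards [hu g, huv, h] with x h1 h2 h3
  rw [← h3, ← h2, h1]

lemma rotation_decomposition (t : ℝ) (x : RN N) :
    soAct (planeRotation t) x
      = Real.cos t • radialVec x + Real.sin t • rotVec x + (x - radialVec x) := by
  ext i
  rcases i with k | j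
  · rw [soAct_inl]
    fin_cases k
    · simp [planeRotation]
    · simp [planeRotation]
      ring
  · rw [soAct_inr]; simp

lemma hasDerivAt_rotation (t : ℝ) (x : RN N) :
    HasDerivAt (fun s => soAct (planeRotation s) x) (rotVec (soAct (planeRotation t) x)) t := by
  simp_rw [rotation_decomposition]
  have h := (((Real.hasDerivAt_cos t).smul_const (radialVec x)).add
    ((Real.hasDerivAt_sin t).smul_const (rotVec x))).add_const (x - radialVec x)
  refine h.congr_deriv ?_
  ext i
  rcases i with k | j
  · fin_cases k
    · simp
    · simp
      ring
  · simp

lemma norm_soAct_rotation (t : ℝ) (x : RN N) : ‖soAct (planeRotation t) x‖ = ‖x‖ := by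
  rw [EuclideanSpace.norm_eq, EuclideanSpace.norm_eq]
  congr 1
  simp only [Fintype.sum_sum_type, Fin.sum_univ_two, soAct_inl, soAct_inr, Real.norm_eq_abs, sq_abs]
  congr 1
  simp [planeRotation]
  nlinarith [Real.sin_sq_add_cos_sq t]

lemma soAct_planeRotation_zero (x : RN N) : soAct (planeRotation 0) x = x := by
  ext i
  rcases i with k | j
  · rw [soAct_inl]
    fin_cases k <;> simp [planeRotation]
  · rw [soAct_inr]

/-- The weak angular derivative of an invariant function vanishes: `t ↦ ∫ u(x) φ(R_t x) dx` is
constant, and its derivative at `t = 0` is `∫ u ∂_θ φ`. -/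
lemma SOInvariant.integral_mul_angularDeriv {u : RN N → ℝ} (hu : SOInvariant u)
    (hul : LocallyIntegrable u volume) {φ : RN N → ℝ} (hφ : IsTest φ) :
    ∫ x, u x * angularDeriv φ x = 0 := by
  have hψ := hφ.angularDeriv
  obtain ⟨C, hC⟩ := hψ.compact.exists_bound_of_continuous hψ.continuous
  obtain ⟨R, hR, hψR⟩ := hψ.compact.exists_pos_le_norm
  have hrot : ∀ t, Continuous (soAct (planeRotation t) : RN N → RN N) := by
    intro t
    unfold soAct
    fun_prop
  have htest : ∀ t {χ : RN N → ℝ}, Continuous χ → HasCompactSupport χ →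
      Integrable (fun x => u x * χ (soAct (planeRotation t) x)) volume := by
    intro t χ hχ hχc
    obtain ⟨R, -, hχR⟩ := hχc.exists_pos_le_norm
    refine integrable_mul_of_tsupport_subset (s := Set.univ) (locallyIntegrableOn_univ.2 hul)
      (hχ.comp (hrot t)) ?_ (Set.subset_univ _)
    refine HasCompactSupport.intro (isCompact_closedBall 0 R) fun x hx => hχR _ ?_
    rw [norm_soAct_rotation]
    rw [mem_closedBall_zero_iff, not_le] at hx
    exact hx.le
  have hconst : ∀ t, ∫ x, u x * φ (soAct (planeRotation t) x) = ∫ x, u x * φ x := by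
    intro t
    have hmp := measurePreserving_soAct (N := N) (planeRotation t)
    have hm : AEStronglyMeasurable (fun x => u x * φ x)
        (Measure.map (soAct (planeRotation t) : RN N → RN N) volume) := by
      rw [hmp.map_eq]
      exact hul.aestronglyMeasurable.mul hφ.continuous.aestronglyMeasurable
    have := integral_map hmp.measurable.aemeasurable hm
    rw [hmp.map_eq] at this
    rw [this]
    refine integral_congr_ae ?_
    filter_upwards [hu (planeRotation t)] with x hx
    rw [hx]
  -- Rotations preserve norms, so all the integrands `u · ∂_θφ ∘ R_t` are supported in one ball, which
  -- gives a dominating function independent of `t`.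
  have hbi : Integrable (fun x => ‖(Metric.closedBall (0 : RN N) R).indicator u x‖ * C) volume := by
    refine (Integrable.norm ?_).mul_const C
    rw [integrable_indicator_iff Metric.isClosed_closedBall.measurableSet]
    exact hul.integrableOn_isCompact (isCompact_closedBall 0 R)
  have hder := (hasDerivAt_integral_of_dominated_loc_of_deriv_le (μ := volume) (x₀ := (0 : ℝ))
    (F := fun t x => u x * φ (soAct (planeRotation t) x))
    (F' := fun t x => u x * angularDeriv φ (soAct (planeRotation t) x))
    (bound := fun x => ‖(Metric.closedBall (0 : RN N) R).indicator u x‖ * C)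
    (s := Set.univ) Filter.univ_mem
    (Filter.Eventually.of_forall fun t => (htest t hφ.continuous hφ.compact).aestronglyMeasurable)
    (htest 0 hφ.continuous hφ.compact)
    (htest 0 hψ.continuous hψ.compact).aestronglyMeasurable
    (Filter.Eventually.of_forall fun x t _ => ?_) hbi
    (Filter.Eventually.of_forall fun x t _ => ?_)).2
  · simp_rw [hconst, soAct_planeRotation_zero] at hder
    exact hder.unique (hasDerivAt_const _ _)
  · by_cases hx : x ∈ Metric.closedBall (0 : RN N) R
    · rw [Set.indicator_of_mem hx, norm_mul]
      exact mul_le_mul_of_nonneg_left (hC _) (norm_nonneg _)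
    · rw [Set.indicator_of_notMem hx]
      rw [mem_closedBall_zero_iff, not_le] at hx
      rw [hψR _ (by rw [norm_soAct_rotation]; exact hx.le)]
      simp
  · have h1 := (hφ.differentiable (soAct (planeRotation t) x)).hasFDerivAt.comp_hasDerivAt t
      (hasDerivAt_rotation t x)
    rw [fderiv_rotVec] at h1
    exact h1.const_mul (u x)

/-- The pointwise form of the invariance: the weak gradient of an invariant function has no angular
component. -/
lemma SOInvariant.sum_weakPartial_mul_tau {u : RN N → ℝ} (hN : 3 ≤ N) (hu : SOInvariant u)
    (hD : u ∈ D12 N) : ∀ᵐ x ∂(volume : Measure (RN N)), ∑ i, weakPartial i u x * tau i x = 0 := by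
  have hul := hD.1.locallyIntegrable (one_le_critExp hN)
  set w := fun i => weakPartial i u with hw
  have hwl : ∀ i, LocallyIntegrable (w i) volume := fun i => (D12.hasWeakPartial hD i).2.1
  have hl : ∀ i, LocallyIntegrable (fun x => rotVec x i * w i x) volume := by
    intro i
    rw [← locallyIntegrableOn_univ]
    exact (locallyIntegrableOn_univ.2 (hwl i)).continuousOn_mul
      (contDiff_rotVec i).continuous.continuousOn isClosed_univ.isLocallyClosed
  have hzero : ∀ᵐ x ∂(volume : Measure (RN N)), ∑ i, rotVec x i * w i x = 0 := by
    refine ae_eq_zero_of_integral_contDiff_smul_eq_zero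
      (locallyIntegrable_finsetSum _ fun i _ => hl i) fun φ h1 h2 => ?_
    have hφ : IsTest φ := ⟨h1, h2⟩
    have hφi : ∀ i, IsTest (fun x => rotVec x i * φ x) := fun i => hφ.mul_left (contDiff_rotVec i)
    -- Each component of the field `(-x₂, x₁, 0)` is independent of its own variable.
    have hdiv : ∀ i x, pd i (fun x => rotVec x i * φ x) x = rotVec x i * pd i φ x := by
      intro i x
      have : pd i (fun x : RN N => rotVec x i) x = 0 := by
        rcases i with k | j
        · fin_cases k <;> simp [pd_neg, pd_coord]
        · simp [pd_const]
      rw [pd_mul ((contDiff_rotVec i).differentiable (by simp) x) (hφ.differentiable x), this]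
      ring
    calc ∫ x, φ x • ∑ i, rotVec x i * w i x
        = ∫ x, ∑ i, w i x * (rotVec x i * φ x) := by
          refine integral_congr_ae (Filter.Eventually.of_forall fun x => ?_)
          simp only [smul_eq_mul, Finset.mul_sum]
          exact Finset.sum_congr rfl fun i _ => by ring
      _ = ∑ i, ∫ x, w i x * (rotVec x i * φ x) :=
          integral_finsetSum _ fun i _ => integrable_mul_test (hwl i) (hφi i)
      _ = ∑ i, -∫ x, u x * (rotVec x i * pd i φ x) := by
          refine Finset.sum_congr rfl fun i _ => ?_
          rw [hw, (D12.hasWeakPartial hD i).integral_eq (hφi i)]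
          simp_rw [hdiv]
      _ = -∫ x, u x * angularDeriv φ x := by
          rw [Finset.sum_neg_distrib, ← integral_finsetSum]
          · simp_rw [angularDeriv, Finset.mul_sum]
          · exact fun i _ => integrable_mul_test hul ((hφ.pd i).mul_left (contDiff_rotVec i))
      _ = 0 := by rw [hu.integral_mul_angularDeriv hul hφ, neg_zero]
  filter_upwards [hzero] with x hx
  have : ∑ i, weakPartial i u x * tau i x = (∑ i, rotVec x i * w i x) / rad x := by
    rw [Finset.sum_div]
    exact Finset.sum_congr rfl fun i _ => by rw [tau, hw]; ring
  rw [this, hx, zero_div]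

end

section

variable {N : ℕ}

/-! ### The correspondence between scalar functions and angular fields -/

variable {u : RN N → ℝ} {U : RN N → RN N}

lemma Related.component_ae_eq (h : Related u U) (j : Fin 2 ⊕ Fin (N - 2)) :
    (fun x => U x j) =ᵐ[volume] fun x => tau j x * u x := by
  filter_upwards [h] with x hx
  rw [hx, tau, PiLp.smul_apply, smul_eq_mul]
  ring

lemma Related.ae_eq_sum (h : Related u U) :
    u =ᵐ[volume] fun x => ∑ j, tau j x * U x j := by
  filter_upwards [h, ae_mem_offAxis] with x hx hr
  have : ∀ j, tau j x * U x j = u x * (tau j x * tau j x) := by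
    intro j
    rw [hx, PiLp.smul_apply, smul_eq_mul, tau]
    ring
  simp_rw [this]
  rw [← Finset.mul_sum, sum_tau_mul_tau hr, mul_one]

lemma Related.norm_eq (h : Related u U) :
    ∀ᵐ x ∂(volume : Measure (RN N)), ‖U x‖ = |u x| := by
  filter_upwards [h, ae_mem_offAxis] with x hx hr
  have h1 : ‖rotVec x‖ = rad x := by
    rw [EuclideanSpace.norm_eq, rad]
    congr 1
    simp [Fintype.sum_sum_type, Fin.sum_univ_two, add_comm]
  rw [hx, norm_smul, h1, norm_div, Real.norm_of_nonneg (rad_nonneg x),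
    div_mul_cancel₀ _ (mem_offAxis.1 hr).ne', Real.norm_eq_abs]

/-- The field `(u/r) (-x₂, x₁, 0)`. -/
def angularField (u : RN N → ℝ) (x : RN N) : RN N := (u x / rad x) • rotVec x

lemma related_angularField (u : RN N → ℝ) : Related u (angularField u) :=
  Filter.Eventually.of_forall fun _ => rfl

lemma MemLp.tau_mul {p : ENNReal} {g : RN N → ℝ} (hg : MemLp g p volume)
    (j : Fin 2 ⊕ Fin (N - 2)) : MemLp (fun x => tau j x * g x) p volume := by
  refine hg.mono ((measurable_tau j).aestronglyMeasurable.mul hg.aestronglyMeasurable)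
    (Filter.Eventually.of_forall fun x => ?_)
  rw [norm_mul]
  exact mul_le_of_le_one_left (norm_nonneg _) (abs_tau_le_one j x)

lemma MemLp.rho_mul {p : ENNReal} {g : RN N → ℝ} (hg : MemLp g p volume)
    (j : Fin 2 ⊕ Fin (N - 2)) : MemLp (fun x => rho j x * g x) p volume := by
  refine hg.mono ((measurable_rho j).aestronglyMeasurable.mul hg.aestronglyMeasurable)
    (Filter.Eventually.of_forall fun x => ?_)
  rw [norm_mul]
  exact mul_le_of_le_one_left (norm_nonneg _) (abs_rho_le_one j x)

lemma spaceX.memLp_div_rad (hu : u ∈ spaceX N) :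
    MemLp (fun x => u x / rad x) 2 volume := by
  have hm : AEStronglyMeasurable (fun x => u x / rad x) volume :=
    (hu.1.1.aestronglyMeasurable.aemeasurable.div measurable_rad.aemeasurable).aestronglyMeasurable
  rw [memLp_two_iff_integrable_sq hm]
  simpa only [div_pow] using hu.2

/-- Off the axis, `∂ᵢ(u τⱼ) = τⱼ ∂ᵢu - τᵢ ρⱼ u/r`. -/
lemma HasWeakPartialOn.tau_mul {i : Fin 2 ⊕ Fin (N - 2)} {w : RN N → ℝ}
    (h : HasWeakPartialOn (offAxis N) i u w) (j : Fin 2 ⊕ Fin (N - 2)) :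
    HasWeakPartialOn (offAxis N) i (fun x => tau j x * u x)
      (fun x => tau j x * w x - tau i x * rho j x * (u x / rad x)) := by
  refine (h.mul_left isOpen_offAxis (contDiffOn_tau j)).congr (ae_eq_refl _) ?_
  filter_upwards [ae_mem_offAxis] with x hx
  rw [pd_tau i j hx]
  ring

lemma HasWeakPartial.offAxis {i : Fin 2 ⊕ Fin (N - 2)} {w : RN N → ℝ}
    (h : HasWeakPartial i u w) : HasWeakPartialOn (offAxis N) i u w :=
  (hasWeakPartialOn_univ.2 h).mono (Set.subset_univ _)

lemma Related.hasWeakPartial (hN : 3 ≤ N) (h : Related u U) (hu : u ∈ spaceX N)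
    (i j : Fin 2 ⊕ Fin (N - 2)) :
    HasWeakPartial i (fun x => U x j)
        (fun x => tau j x * weakPartial i u x - tau i x * rho j x * (u x / rad x)) ∧
      MemLp (fun x => tau j x * weakPartial i u x - tau i x * rho j x * (u x / rad x)) 2 volume := by
  have hm : MemLp (fun x => tau j x * weakPartial i u x - tau i x * rho j x * (u x / rad x)) 2
      volume := by
    refine (MemLp.tau_mul (D12.memLp_weakPartial hu.1 i) j).sub ?_
    have := MemLp.tau_mul (MemLp.rho_mul (spaceX.memLp_div_rad hu) j) i
    simpa only [mul_assoc] using this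
  refine ⟨?_, hm⟩
  have h1 := (D12.hasWeakPartial hu.1 i).offAxis.tau_mul j
  have h2 := HasWeakPartialOn.of_offAxis hN (MemLp.tau_mul hu.1.1 j)
    (hm.locallyIntegrable (by norm_num)) h1
  exact h2.congr (h.component_ae_eq j).symm (ae_eq_refl _)

/-- If `u ∈ X`, then the angular field with profile `u` belongs to `D^{1,2}`. -/
lemma Related.mem_D12Vec (hN : 3 ≤ N) (h : Related u U) (hu : u ∈ spaceX N) : U ∈ D12Vec N :=
  fun j => ⟨(MemLp.tau_mul hu.1.1 j).ae_eq (h.component_ae_eq j).symm,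
    fun i => ⟨_, h.hasWeakPartial hN hu i j⟩⟩

lemma Related.weakPartial_ae_eq (hN : 3 ≤ N) (h : Related u U) (hu : u ∈ spaceX N)
    (i j : Fin 2 ⊕ Fin (N - 2)) :
    weakPartial i (fun x => U x j) =ᵐ[volume]
      fun x => tau j x * weakPartial i u x - tau i x * rho j x * (u x / rad x) :=
  (h.hasWeakPartial hN hu i j).1.weakPartial_ae_eq

/-- If an angular field belongs to `D^{1,2}`, then its profile `u` belongs to `X`: one has
`∂ᵢu = ∑ⱼ τⱼ ∂ᵢUⱼ`, because `∂ᵢτ` is orthogonal to `τ`, and `u/r = -∑ᵢⱼ τᵢ ρⱼ ∂ᵢUⱼ`. -/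
lemma Related.mem_spaceX (hN : 3 ≤ N) (h : Related u U) (hU : U ∈ D12Vec N) : u ∈ spaceX N := by
  have hsum := h.ae_eq_sum
  have hmem : MemLp u (critExp N) volume :=
    (memLp_finsetSum _ fun j _ => MemLp.tau_mul (hU j).1 j).ae_eq hsum.symm
  have hw2 : ∀ i, MemLp (fun x => ∑ j, tau j x * weakPartial i (fun y => U y j) x) 2 volume :=
    fun i => memLp_finsetSum _ fun j _ => MemLp.tau_mul (D12.memLp_weakPartial (hU j) i) j
  have hoff : ∀ i, HasWeakPartialOn (offAxis N) i u
      (fun x => ∑ j, tau j x * weakPartial i (fun y => U y j) x) := by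
    intro i
    have h1 := HasWeakPartialOn.sum Finset.univ fun j _ =>
      (D12.hasWeakPartial (hU j) i).offAxis.mul_left isOpen_offAxis (contDiffOn_tau j)
    refine h1.congr hsum.symm ?_
    filter_upwards [h, ae_mem_offAxis] with x hx hr
    rw [Finset.sum_add_distrib, add_eq_left]
    have : ∀ j, pd i (tau j) x * U x j = -(tau i x * u x / rad x) * (tau j x * rho j x) := by
      intro j
      rw [pd_tau i j hr, hx, PiLp.smul_apply, smul_eq_mul, tau, tau]
      ring
    simp_rw [this]
    rw [← Finset.mul_sum, sum_tau_mul_rho, mul_zero]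
  have hwp : ∀ i, HasWeakPartial i u
      (fun x => ∑ j, tau j x * weakPartial i (fun y => U y j) x) := fun i =>
    HasWeakPartialOn.of_offAxis hN hmem ((hw2 i).locallyIntegrable (by norm_num)) (hoff i)
  have hD : u ∈ D12 N := ⟨hmem, fun i => ⟨_, hwp i, hw2 i⟩⟩
  refine ⟨hD, ?_⟩
  have hW : ∀ i j, ∀ᵐ x ∂(volume : Measure (RN N)), weakPartial i (fun y => U y j) x
      = tau j x * weakPartial i u x - tau i x * rho j x * (u x / rad x) := by
    intro i j
    have h1 := ((D12.hasWeakPartial hD i).offAxis.tau_mul j).congr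
      (h.component_ae_eq j).symm (ae_eq_refl _)
    have h2 := (D12.hasWeakPartial (hU j) i).offAxis.unique isOpen_offAxis h1
    filter_upwards [h2, ae_mem_offAxis] with x hx hr using hx hr
  -- `u / r` is the component of the Jacobian of `U` along `τ ⊗ ρ`, up to sign.
  have hdiv : (fun x => u x / rad x) =ᵐ[volume]
      fun x => ∑ i, ∑ j, -(tau i x * (rho j x * weakPartial i (fun y => U y j) x)) := by
    filter_upwards [ae_all_iff.2 fun i => ae_all_iff.2 (hW i), ae_mem_offAxis] with x hx hr
    have e : ∀ i j, -(tau i x * (rho j x * weakPartial i (fun y => U y j) x))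
        = u x / rad x * ((tau i x * tau i x) * (rho j x * rho j x))
          - tau i x * weakPartial i u x * (rho j x * tau j x) := by
      intro i j
      rw [hx i j]; ring
    simp_rw [e, Finset.sum_sub_distrib, ← Finset.mul_sum, sum_rho_mul_tau, sum_rho_mul_rho hr]
    simp_rw [mul_one, sum_tau_mul_tau hr]
    simp
  have hm : MemLp (fun x => u x / rad x) 2 volume := by
    refine MemLp.ae_eq hdiv.symm (memLp_finsetSum _ fun i _ => memLp_finsetSum _ fun j _ => ?_)
    exact (MemLp.tau_mul (MemLp.rho_mul (D12.memLp_weakPartial (hU j) i) j) i).neg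
  have := (memLp_two_iff_integrable_sq hm.aestronglyMeasurable).1 hm
  simpa only [div_pow] using this

/-- The first part of the correspondence: `U ∈ D_𝓕` if and only if `u ∈ X_SO`. -/
lemma Related.mem_spaceDF_iff (hN : 3 ≤ N) (h : Related u U) :
    U ∈ spaceDF N ↔ u ∈ spaceXSO N := by
  constructor
  · rintro ⟨hU, v, hv, hvU⟩
    refine ⟨h.mem_spaceX hN hU, hv.congr ?_⟩
    filter_upwards [h.ae_eq_sum, hvU.ae_eq_sum] with x h1 h2
    rw [h1, h2]
  · rintro ⟨hu, hinv⟩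
    exact ⟨h.mem_D12Vec hN hu, u, hinv, h⟩

lemma Related.gradSqVec_ae_eq (hN : 3 ≤ N) (h : Related u U) (hu : u ∈ spaceX N) :
    ∀ᵐ x ∂(volume : Measure (RN N)), gradSqVec U x = gradSq u x + u x ^ 2 / rad x ^ 2 := by
  filter_upwards [ae_all_iff.2 fun i => ae_all_iff.2 (h.weakPartial_ae_eq hN hu i),
    ae_mem_offAxis] with x hx hr
  simp only [gradSqVec, gradSq]
  rw [Finset.sum_comm]
  have e : ∀ i j, weakPartial i (fun y => U y j) x ^ 2
      = weakPartial i u x ^ 2 * (tau j x * tau j x)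
        - 2 * weakPartial i u x * tau i x * (u x / rad x) * (tau j x * rho j x)
        + (u x / rad x) ^ 2 * (tau i x * tau i x) * (rho j x * rho j x) := by
    intro i j
    rw [hx i j]; ring
  simp_rw [e, Finset.sum_add_distrib, Finset.sum_sub_distrib, ← Finset.mul_sum, sum_tau_mul_tau hr,
    sum_tau_mul_rho, sum_rho_mul_rho hr, mul_one, mul_zero, Finset.sum_const_zero, sub_zero,
    ← Finset.mul_sum, sum_tau_mul_tau hr, mul_one, div_pow]

lemma Related.divergence_ae_eq (hN : 3 ≤ N) (h : Related u U) (hu : u ∈ spaceXSO N) :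
    divergence U =ᵐ[volume] 0 := by
  filter_upwards [ae_all_iff.2 fun i => ae_all_iff.2 (h.weakPartial_ae_eq hN hu.1 i),
    hu.2.sum_weakPartial_mul_tau hN hu.1.1] with x hx h0
  simp only [divergence, hx, Pi.zero_apply]
  have e : ∀ i, tau i x * weakPartial i u x - tau i x * rho i x * (u x / rad x)
      = weakPartial i u x * tau i x - (u x / rad x) * (tau i x * rho i x) := fun i => by ring
  simp_rw [e, Finset.sum_sub_distrib, ← Finset.mul_sum, h0, sum_tau_mul_rho]
  simp

lemma integrable_gradSq {v : RN N → ℝ} (hv : v ∈ D12 N) : Integrable (gradSq v) volume :=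
  integrable_finsetSum _ fun i _ => (D12.memLp_weakPartial hv i).integrable_sq

lemma integrable_gradSqVec {V : RN N → RN N} (hV : V ∈ D12Vec N) :
    Integrable (gradSqVec V) volume :=
  integrable_finsetSum _ fun j _ => integrable_gradSq (hV j)

lemma memLp_divergence {V : RN N → RN N} (hV : V ∈ D12Vec N) :
    MemLp (divergence V) 2 volume :=
  memLp_finsetSum _ fun i _ => D12.memLp_weakPartial (hV i) i

lemma gradSqVec_nonneg (V : RN N → RN N) (x : RN N) : 0 ≤ gradSqVec V x :=
  Finset.sum_nonneg fun _ _ => Finset.sum_nonneg fun _ _ => sq_nonneg _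

lemma divergence_sq_le (V : RN N → RN N) (x : RN N) :
    divergence V x ^ 2 ≤ Fintype.card (Fin 2 ⊕ Fin (N - 2)) * gradSqVec V x := by
  have h1 := sq_sum_le_card_mul_sum_sq (s := (Finset.univ : Finset (Fin 2 ⊕ Fin (N - 2))))
    (f := fun i => weakPartial i (fun y => V y i) x)
  refine h1.trans ?_
  rw [Finset.card_univ]
  gcongr
  refine Finset.sum_le_sum fun j _ => ?_
  exact Finset.single_le_sum (f := fun i => weakPartial i (fun y => V y j) x ^ 2)
    (fun i _ => sq_nonneg _) (Finset.mem_univ j)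

/-- For `u ∈ X_SO` and a test function `φ` supported off the axis, the weak Laplacian of the field
`U = u τ` does not see the difference between `φ eⱼ` and its angular projection `φ τⱼ τ`: the two
integrands differ by `-u ∂_θ(φ ρⱼ / r²)`, whose integral vanishes by invariance. -/
lemma Related.integral_gradient_angular_projection (hN : 3 ≤ N) (h : Related u U)
    (hu : u ∈ spaceXSO N) {φ : RN N → ℝ} (hφ : IsTest φ) (hs : tsupport φ ⊆ offAxis N)
    (j : Fin 2 ⊕ Fin (N - 2)) :
    ∫ x, ∑ i, weakPartial i (fun y => U y j) x * pd i φ x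
      = ∫ x, ∑ i, ∑ k, weakPartial i (fun y => U y k) x
          * pd i (fun y => tau j y * tau k y * φ y) x := by
  have hul := hu.1.1.1.locallyIntegrable (one_le_critExp hN)
  -- `ζ = ρⱼ / r²`
  set ζ : RN N → ℝ := fun x => rho j x / rad x * (rad x)⁻¹ with hζ
  have hinv : ContDiffOn ℝ ∞ (fun x : RN N => (rad x)⁻¹) (offAxis N) :=
    contDiffOn_rad.inv fun _ hx => hx
  have hζs : ContDiffOn ℝ ∞ ζ (offAxis N) :=
    ((contDiffOn_rho j).div contDiffOn_rad fun _ hx => hx).mul hinv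
  have hψ : IsTest (fun x => ζ x * φ x) := hφ.mul_left_of_contDiffOn isOpen_offAxis hs hζs
  have htt : ∀ k, ContDiffOn ℝ ∞ (fun x => tau j x * tau k x) (offAxis N) := fun k =>
    (contDiffOn_tau j).mul (contDiffOn_tau k)
  have hWl : ∀ i k, LocallyIntegrable (weakPartial i fun y => U y k) volume := fun i k =>
    (D12.hasWeakPartial (h.mem_D12Vec hN hu.1 k) i).2.1
  have hi1 : Integrable (fun x => ∑ i, weakPartial i (fun y => U y j) x * pd i φ x) volume :=
    integrable_finsetSum _ fun i _ => integrable_mul_test (hWl i j) (hφ.pd i)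
  have hi2 : Integrable (fun x => ∑ i, ∑ k, weakPartial i (fun y => U y k) x
      * pd i (fun y => tau j y * tau k y * φ y) x) volume :=
    integrable_finsetSum _ fun i _ => integrable_finsetSum _ fun k _ =>
      integrable_mul_test (hWl i k)
        ((hφ.mul_left_of_contDiffOn isOpen_offAxis hs (htt k)).pd i)
  have hpdinv : ∀ i, ∀ x ∈ offAxis N, pd i (fun x : RN N => (rad x)⁻¹) x
      = -(rho i x / rad x ^ 2) := by
    intro i x hx
    have e : (fun x : RN N => (rad x)⁻¹) = fun x => 1 / rad x := by simp
    rw [e, pd_div_rad i contDiff_const hx, pd_const]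
    ring
  have hpdζ : ∀ i, ∀ x ∈ offAxis N, pd i ζ x
      = tau i x * tau j x / rad x ^ 3 - 2 * rho j x * rho i x / rad x ^ 3 := by
    intro i x hx
    have hr := (mem_offAxis.1 hx).ne'
    have d1 := differentiableAt_of_offAxis (contDiffOn_rho j) hx
    have d2 := differentiableAt_of_offAxis hinv hx
    have e : ζ = fun x => rho j x * (rad x)⁻¹ * (rad x)⁻¹ := by
      funext x; rw [hζ]; simp only [div_eq_mul_inv]
    rw [e, pd_mul (d1.fun_mul d2) d2, pd_mul d1 d2, hpdinv i x hx, pd_rho i j hx]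
    field_simp
    ring
  have key : (fun x => (∑ i, weakPartial i (fun y => U y j) x * pd i φ x)
      - ∑ i, ∑ k, weakPartial i (fun y => U y k) x
          * pd i (fun y => tau j y * tau k y * φ y) x) =ᵐ[volume]
      fun x => -(u x * angularDeriv (fun x => ζ x * φ x) x) := by
    filter_upwards [ae_all_iff.2 fun i => ae_all_iff.2 (h.weakPartial_ae_eq hN hu.1 i),
      hu.2.sum_weakPartial_mul_tau hN hu.1.1, ae_mem_offAxis] with x hx h0 hr
    have hr0 := (mem_offAxis.1 hr).ne'
    have dφ := hφ.differentiable x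
    have dζ := differentiableAt_of_offAxis hζs hr
    have dτ := fun k => differentiableAt_of_offAxis (contDiffOn_tau k) hr
    set v := u x / rad x with hv
    have e1 : ∑ i, weakPartial i (fun y => U y j) x * pd i φ x
        = tau j x * (∑ i, weakPartial i u x * pd i φ x)
          - rho j x * v * ∑ i, tau i x * pd i φ x := by
      rw [Finset.mul_sum, Finset.mul_sum, ← Finset.sum_sub_distrib]
      refine Finset.sum_congr rfl fun i _ => ?_
      rw [hx i j]; ring
    have e2 : ∀ i k, weakPartial i (fun y => U y k) x * pd i (fun y => tau j y * tau k y * φ y) x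
        = (weakPartial i u x * (tau j x * pd i φ x - tau i x * rho j x / rad x * φ x))
            * (tau k x * tau k x)
          - (weakPartial i u x * tau i x * tau j x * φ x / rad x
              + tau i x * v * (tau j x * pd i φ x - tau i x * rho j x / rad x * φ x))
            * (tau k x * rho k x)
          + v * tau j x * φ x / rad x * (tau i x * tau i x) * (rho k x * rho k x) := by
      intro i k
      rw [pd_mul ((dτ j).fun_mul (dτ k)) dφ, pd_mul (dτ j) (dτ k), pd_tau i j hr, pd_tau i k hr, hx i k]
      ring
    have e3 : ∑ i, ∑ k, weakPartial i (fun y => U y k) x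
          * pd i (fun y => tau j y * tau k y * φ y) x
        = tau j x * (∑ i, weakPartial i u x * pd i φ x) + v * tau j x * φ x / rad x := by
      simp_rw [e2, Finset.sum_add_distrib, Finset.sum_sub_distrib, ← Finset.mul_sum,
        sum_tau_mul_tau hr, sum_tau_mul_rho, sum_rho_mul_rho hr, mul_zero, mul_one,
        Finset.sum_const_zero, sub_zero, ← Finset.mul_sum, sum_tau_mul_tau hr, mul_one]
      congr 1
      have e4 : ∀ i, weakPartial i u x * (tau j x * pd i φ x - tau i x * rho j x / rad x * φ x)
          = tau j x * (weakPartial i u x * pd i φ x)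
            - rho j x / rad x * φ x * (weakPartial i u x * tau i x) := fun i => by ring
      simp_rw [e4, Finset.sum_sub_distrib, ← Finset.mul_sum, h0, mul_zero, sub_zero]
    have e5 : angularDeriv (fun x => ζ x * φ x) x
        = rho j x / rad x * (∑ i, tau i x * pd i φ x) + tau j x * φ x / rad x ^ 2 := by
      have e6 : ∀ i, rotVec x i * pd i (fun x => ζ x * φ x) x
          = rho j x / rad x * (tau i x * pd i φ x)
            + tau j x * φ x / rad x ^ 2 * (tau i x * tau i x)
            - 2 * rho j x * φ x / rad x ^ 2 * (tau i x * rho i x) := by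
        intro i
        have : rotVec x i = tau i x * rad x := by rw [tau, div_mul_cancel₀ _ hr0]
        rw [pd_mul dζ dφ, hpdζ i x hr, this, hζ]
        field_simp
        ring
      simp_rw [angularDeriv, e6, Finset.sum_sub_distrib, Finset.sum_add_distrib, ← Finset.mul_sum,
        sum_tau_mul_tau hr, sum_tau_mul_rho]
      ring
    rw [e1, e3, e5, hv]
    field_simp
    ring
  rw [← sub_eq_zero, ← integral_sub hi1 hi2, integral_congr_ae key, integral_neg,
    hu.2.integral_mul_angularDeriv hul hψ, neg_zero]

end

section

variable {N : ℕ}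

/-! ### The nonlinearity -/

variable {f : RN N → ℝ → ℝ} {h : RN N → RN N → RN N}

/-- A Carathéodory function agrees, off a null set of points `x`, with a jointly measurable function
that is continuous in the second variable. -/
lemma ConditionF1.exists_measurable_version (hF : ConditionF1 f) :
    ∃ g : RN N → ℝ → ℝ, Measurable (Function.uncurry g) ∧ (∀ x, Continuous (g x)) ∧
      ∀ᵐ x ∂(volume : Measure (RN N)), ∀ s, f x s = g x s := by
  classical
  -- The good points: there `f x` is continuous and agrees with measurable versions at all rational
  -- arguments. Redefining `f x` as zero on a measurable null set containing the bad points does it.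
  set G : Set (RN N) :=
    {x | Continuous (f x) ∧ ∀ r : ℚ, f x r = (hF.aemeasurable (r : ℝ)).mk _ x} with hG
  have hGae : ∀ᵐ x ∂(volume : Measure (RN N)), x ∈ G := by
    have := ae_all_iff.2 fun r : ℚ => (hF.aemeasurable (r : ℝ)).ae_eq_mk
    filter_upwards [hF.continuous, this] with x h1 h2 using ⟨h1, h2⟩
  set T : Set (RN N) := toMeasurable volume Gᶜ with hT
  have hTm : MeasurableSet T := measurableSet_toMeasurable _ _
  have hT0 : volume T = 0 := by rw [hT, measure_toMeasurable]; exact hGae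
  have hTG : ∀ x, x ∉ T → x ∈ G := fun x hx => by
    by_contra hc
    exact hx (subset_toMeasurable _ _ hc)
  set g : RN N → ℝ → ℝ := fun x s => if x ∈ T then 0 else f x s with hg
  have hgc : ∀ x, Continuous (g x) := by
    intro x
    by_cases hx : x ∈ T
    · simp only [hg, hx, if_true]; exact continuous_const
    · simp only [hg, hx, if_false]; exact (hTG x hx).1
  have hgq : ∀ r : ℚ, Measurable fun x => g x r := by
    intro r
    have e : (fun x => g x r)
        = fun x => if x ∈ T then 0 else (hF.aemeasurable (r : ℝ)).mk _ x := by
      funext x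
      by_cases hx : x ∈ T
      · simp [hg, hx]
      · simp only [hg, hx, if_false]; exact (hTG x hx).2 r
    rw [e]
    exact Measurable.ite hTm measurable_const (hF.aemeasurable (r : ℝ)).measurable_mk
  have hgm : ∀ s : ℝ, Measurable fun x => g x s := by
    intro s
    obtain ⟨r, -, -, hr⟩ := Real.exists_seq_rat_strictMono_tendsto s
    refine measurable_of_tendsto_metrizable (fun n => hgq (r n)) ?_
    rw [tendsto_pi_nhds]
    intro x
    exact ((hgc x).tendsto s).comp hr
  refine ⟨g, ?_, hgc, ?_⟩
  · have h1 := measurable_uncurry_of_continuous_of_measurable (u := fun s x => g x s)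
      (fun x => hgc x) hgm
    exact h1.comp measurable_swap
  · have : ∀ᵐ x ∂(volume : Measure (RN N)), x ∉ T := measure_eq_zero_iff_ae_notMem.1 hT0
    filter_upwards [this] with x hx s
    simp [hg, hx]

lemma ConditionF1.aemeasurable_comp (hF : ConditionF1 f) {s : RN N → ℝ}
    (hs : AEMeasurable s volume) : AEMeasurable (fun x => f x (s x)) volume := by
  obtain ⟨g, hg, -, hfg⟩ := hF.exists_measurable_version
  refine AEMeasurable.congr (f := fun x => g x (s x)) ?_ ?_
  · exact hg.comp_aemeasurable (aemeasurable_id.prodMk hs)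
  · filter_upwards [hfg] with x hx using (hx _).symm

lemma ConditionF1.aestronglyMeasurable_primF (hF : ConditionF1 f) {s : RN N → ℝ}
    (hs : AEMeasurable s volume) :
    AEStronglyMeasurable (fun x => primF f x (s x)) volume := by
  obtain ⟨g, hg, -, hfg⟩ := hF.exists_measurable_version
  have e : (fun x => primF f x (s x)) =ᵐ[volume]
      fun x => hs.mk s x * ∫ t in (0 : ℝ)..1, g x (hs.mk s x * t) := by
    filter_upwards [hfg, hs.ae_eq_mk] with x h1 h2
    rw [intervalIntegral.mul_integral_comp_mul_left, mul_zero, mul_one, ← h2, primF]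
    simp_rw [h1]
  refine AEStronglyMeasurable.congr ?_ e.symm
  have hm : Measurable (Function.uncurry fun (x : RN N) (t : ℝ) => g x (hs.mk s x * t)) :=
    hg.comp (measurable_fst.prodMk ((hs.measurable_mk.comp measurable_fst).mul measurable_snd))
  have hi : StronglyMeasurable fun x => ∫ t in (0 : ℝ)..1, g x (hs.mk s x * t) := by
    simp_rw [intervalIntegral.integral_of_le zero_le_one]
    exact hm.stronglyMeasurable.integral_prod_right
  exact (hs.measurable_mk.stronglyMeasurable.mul hi).aestronglyMeasurable

lemma exists_unit_vector : ∃ w : RN N, ‖w‖ = 1 :=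
  ⟨EuclideanSpace.single (Sum.inl 0) 1, by simp⟩

/-- Compatibility forces `f(x, ·)` to be odd and `h(x, ·)` to be radial. Oddness comes from
`αw = (-α)(-w)`; at `ξ = 0` the quotient is `0 / 0 = 0`, in accordance with `h(x, 0) = 0`. -/
lemma Compatible.apply_eq (hc : Compatible f h) :
    ∀ᵐ x ∂(volume : Measure (RN N)), f x 0 = 0 ∧ (∀ s, f x (-s) = -f x s) ∧
      ∀ ξ, h x ξ = (f x ‖ξ‖ / ‖ξ‖) • ξ := by
  filter_upwards [hc] with x hx
  obtain ⟨h0, h1⟩ := hx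
  obtain ⟨w, hw⟩ := exists_unit_vector (N := N)
  have hw0 : w ≠ 0 := by rw [← norm_ne_zero_iff, hw]; exact one_ne_zero
  refine ⟨?_, fun s => ?_, fun ξ => ?_⟩
  · have := h1 0 w hw
    rw [zero_smul, h0] at this
    exact (smul_eq_zero.1 this.symm).resolve_right hw0
  · have e1 := h1 (-s) (-w) (by rwa [norm_neg])
    have e2 := h1 s w hw
    rw [neg_smul_neg, e2, smul_neg, ← neg_smul] at e1
    have := smul_left_injective ℝ hw0 e1
    linarith
  · by_cases hξ : ξ = 0
    · simp [hξ, h0]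
    · have hn : ‖ξ‖ ≠ 0 := norm_ne_zero_iff.2 hξ
      have e := h1 ‖ξ‖ (‖ξ‖⁻¹ • ξ) (by rw [norm_smul, norm_inv, norm_norm, inv_mul_cancel₀ hn])
      rw [smul_smul, mul_inv_cancel₀ hn, one_smul] at e
      rw [e, smul_smul, div_eq_mul_inv]

lemma Compatible.primH_eq (hc : Compatible f h) :
    ∀ᵐ x ∂(volume : Measure (RN N)), ∀ ξ, primH h x ξ = primF f x ‖ξ‖ := by
  filter_upwards [hc.apply_eq] with x hx ξ
  obtain ⟨h0, -, hh⟩ := hx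
  have e := intervalIntegral.mul_integral_comp_mul_left (a := 0) (b := 1) (f := f x) ‖ξ‖
  rw [mul_zero, mul_one] at e
  rw [primH, primF, ← e, ← intervalIntegral.integral_const_mul]
  refine intervalIntegral.integral_congr fun t ht => ?_
  rw [Set.uIcc_of_le zero_le_one] at ht
  have hn : ‖t • ξ‖ = ‖ξ‖ * t := by
    rw [norm_smul, Real.norm_of_nonneg ht.1, mul_comm]
  rw [hh, hn, real_inner_smul_left, real_inner_smul_left, real_inner_self_eq_norm_sq]
  by_cases hz : ‖ξ‖ * t = 0
  · rw [hz, h0]; simp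
  · obtain ⟨h1, h2⟩ := mul_ne_zero_iff.1 hz
    field_simp

lemma Compatible.primF_abs (hc : Compatible f h) :
    ∀ᵐ x ∂(volume : Measure (RN N)), ∀ s, primF f x |s| = primF f x s := by
  filter_upwards [hc.apply_eq] with x hx s
  rcases abs_choice s with hs | hs
  · rw [hs]
  · rw [hs, primF, primF]
    have e := intervalIntegral.integral_comp_neg (a := 0) (b := s) (f x)
    simp_rw [hx.2.1, intervalIntegral.integral_neg] at e
    rw [neg_zero, intervalIntegral.integral_symm 0 (-s)] at e
    linarith

lemma abs_integral_le_of_growth {φ : ℝ → ℝ} {C q : ℝ} (hC : 0 ≤ C) (hq : 1 < q)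
    (hg : ∀ s, |φ s| ≤ C * |s| ^ (q - 1)) {s : ℝ} (hs : 0 ≤ s) :
    |∫ t in (0 : ℝ)..s, φ t| ≤ C * s ^ q := by
  have h1 := intervalIntegral.norm_integral_le_of_norm_le_const (a := 0) (b := s)
    (C := C * s ^ (q - 1)) (f := φ) fun t ht => by
      rw [Set.uIoc_of_le hs] at ht
      refine (hg t).trans ?_
      rw [abs_of_pos ht.1]
      gcongr
      · exact ht.1.le
      · exact ht.2
  rw [sub_zero, abs_of_nonneg hs, mul_assoc, ← Real.rpow_add_one' hs (by linarith),
    sub_add_cancel] at h1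
  exact h1

/-- The elementary estimate behind the differentiability of `U ↦ ∫ F(x,|U|)`.  For `|v| > η|ξ|` the
growth of `φ` suffices; for `|v| ≤ η|ξ|` the remainder is controlled by the oscillation `M` of `φ`
near `|ξ|` and by the second order remainder of the norm. -/
lemma abs_remainder_le {φ : ℝ → ℝ} (hφ : Continuous φ) {C q : ℝ} (hC : 0 ≤ C) (hq : 1 < q)
    (hg : ∀ s, |φ s| ≤ C * |s| ^ (q - 1)) (ξ v : RN N) {η M : ℝ} (hη : 0 < η)
    (hM : ∀ t, |t - ‖ξ‖| ≤ η * ‖ξ‖ → |φ t - φ ‖ξ‖| ≤ M) :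
    |(∫ t in (0 : ℝ)..‖ξ + v‖, φ t) - (∫ t in (0 : ℝ)..‖ξ‖, φ t) - φ ‖ξ‖ / ‖ξ‖ * inner ℝ ξ v|
      ≤ 3 * C * (η⁻¹ + 1) ^ q * ‖v‖ ^ q + (M + 2 * C * η * ‖ξ‖ ^ (q - 1)) * ‖v‖ := by
  set a := ‖ξ‖ with ha
  set b := ‖ξ + v‖ with hb
  set m := ‖v‖ with hm
  have ha0 : 0 ≤ a := norm_nonneg _
  have hb0 : 0 ≤ b := norm_nonneg _
  have hm0 : 0 ≤ m := norm_nonneg _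
  have hM0 : 0 ≤ M := by
    have := hM a (by simp; positivity)
    simpa using this
  have hab : |b - a| ≤ m := by
    have := abs_norm_sub_norm_le (ξ + v) ξ
    simpa [ha, hb, hm] using this
  have hin : |inner ℝ ξ v| ≤ a * m := abs_real_inner_le_norm ξ v
  have hga : |φ a| ≤ C * a ^ (q - 1) := by simpa [abs_of_nonneg ha0] using hg a
  have hdiv : |φ a / a * inner ℝ ξ v| ≤ |φ a| * m := by
    rcases ha0.eq_or_lt with h0 | h0
    · rw [← h0]; simp; positivity
    · rw [abs_mul, abs_div, abs_of_pos h0, div_mul_eq_mul_div, div_le_iff₀ h0]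
      calc |φ a| * |inner ℝ ξ v| ≤ |φ a| * (a * m) := by gcongr
        _ = _ := by ring
  rcases lt_or_ge (η * a) m with hcase | hcase
  -- Case `|v| > η|ξ|`: all three terms are at most `C (κ|v|)^q`.
  · set κ := η⁻¹ + 1 with hκ
    have hκ0 : 0 < κ := by positivity
    have hκ1 : 1 ≤ κ := by rw [hκ]; linarith [inv_pos.2 hη]
    have hηa : a ≤ η⁻¹ * m := by
      rw [inv_mul_eq_div, le_div_iff₀ hη]; linarith
    have haκ : a ≤ κ * m := by rw [hκ]; linarith
    have hbκ : b ≤ κ * m := by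
      rw [hκ]; linarith [(abs_le.1 hab).2]
    have hmκ : m ≤ κ * m := le_mul_of_one_le_left hm0 hκ1
    have hpow : (κ * m) ^ q = κ ^ q * m ^ q := Real.mul_rpow hκ0.le hm0
    have h1 : |∫ t in (0 : ℝ)..b, φ t| ≤ C * (κ * m) ^ q :=
      (abs_integral_le_of_growth hC hq hg hb0).trans (by gcongr)
    have h2 : |∫ t in (0 : ℝ)..a, φ t| ≤ C * (κ * m) ^ q :=
      (abs_integral_le_of_growth hC hq hg ha0).trans (by gcongr)
    have h3 : |φ a / a * inner ℝ ξ v| ≤ C * (κ * m) ^ q := by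
      refine hdiv.trans ?_
      calc |φ a| * m ≤ C * (κ * m) ^ (q - 1) * (κ * m) := by
            gcongr
            refine hga.trans ?_
            gcongr
        _ = C * (κ * m) ^ q := by
            rw [mul_assoc, ← Real.rpow_add_one' (by positivity) (by linarith), sub_add_cancel]
    have h4 : 0 ≤ (M + 2 * C * η * a ^ (q - 1)) * m := by positivity
    calc _ ≤ |∫ t in (0 : ℝ)..b, φ t| + |∫ t in (0 : ℝ)..a, φ t| + |φ a / a * inner ℝ ξ v| :=
          (abs_sub _ _).trans (add_le_add_left (abs_sub _ _) _)
      _ ≤ 3 * C * κ ^ q * m ^ q := by rw [hpow] at h1 h2 h3; linarith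
      _ ≤ _ := by linarith
  · rcases ha0.eq_or_lt with h0 | h0
    · have hm' : m = 0 := le_antisymm (by rw [← h0, mul_zero] at hcase; exact hcase) hm0
      have hv : v = 0 := norm_eq_zero.1 hm'
      have hba : b = a := by rw [hb, hv, add_zero]
      rw [hba, hv, hm']
      simp
      positivity
    -- Case `|v| ≤ η|ξ|` with `ξ ≠ 0`.
    have h1 : (∫ t in (0 : ℝ)..b, φ t) - (∫ t in (0 : ℝ)..a, φ t) = ∫ t in a..b, φ t :=
      intervalIntegral.integral_interval_sub_left (hφ.intervalIntegrable _ _)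
        (hφ.intervalIntegrable _ _)
    have h2 : ∫ t in a..b, (φ t - φ a) = (∫ t in a..b, φ t) - (b - a) * φ a := by
      rw [intervalIntegral.integral_sub (hφ.intervalIntegrable _ _)
        intervalIntegrable_const, intervalIntegral.integral_const, smul_eq_mul]
    have h3 : |∫ t in a..b, (φ t - φ a)| ≤ M * |b - a| := by
      refine intervalIntegral.norm_integral_le_of_norm_le_const (f := fun t => φ t - φ a)
        fun t ht => hM t ?_
      have : |t - a| ≤ |b - a| := by
        have := Set.abs_sub_left_of_mem_uIcc (Set.uIoc_subset_uIcc ht)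
        rwa [abs_sub_comm t a, abs_sub_comm b a, abs_sub_comm a t, abs_sub_comm a b]
      linarith
    have hsq : b ^ 2 = a ^ 2 + 2 * inner ℝ ξ v + m ^ 2 := norm_add_sq_real ξ v
    set c := inner ℝ ξ v / a with hc
    have hcv : inner ℝ ξ v = a * c := by rw [hc]; field_simp
    have hcm : |c| ≤ m := by
      rw [hc, abs_div, abs_of_pos h0, div_le_iff₀ h0]; linarith
    -- `b - a - c = (m² + c (a - b)) / (a + b)`
    have h4 : |b - a - c| ≤ 2 * η * m := by
      have hab0 : 0 < a + b := by linarith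
      have e : b - a - c = (m ^ 2 + c * (a - b)) / (a + b) := by
        rw [eq_div_iff hab0.ne']
        rw [hcv] at hsq
        nlinarith
      rw [e, abs_div, abs_of_pos hab0, div_le_iff₀ hab0]
      have h5 : |c * (a - b)| ≤ m * m := by
        rw [abs_mul, abs_sub_comm a b]
        exact mul_le_mul hcm hab (abs_nonneg _) hm0
      calc |m ^ 2 + c * (a - b)| ≤ |m ^ 2| + |c * (a - b)| := abs_add_le _ _
        _ ≤ m ^ 2 + m * m := by rw [abs_of_nonneg (sq_nonneg m)]; linarith
        _ = 2 * m * m := by ring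
        _ ≤ 2 * m * (η * a) := by gcongr
        _ ≤ 2 * η * m * (a + b) := by nlinarith [mul_nonneg (mul_nonneg hη.le hm0) hb0]
    have e : (∫ t in (0 : ℝ)..b, φ t) - (∫ t in (0 : ℝ)..a, φ t) - φ a / a * inner ℝ ξ v
        = (∫ t in a..b, (φ t - φ a)) + φ a * (b - a - c) := by
      rw [h1, h2, hc]; field_simp; ring
    have hk0 : 0 ≤ 3 * C * (η⁻¹ + 1) ^ q * m ^ q := by positivity
    rw [e]
    calc _ ≤ |∫ t in a..b, (φ t - φ a)| + |φ a * (b - a - c)| := abs_add_le _ _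
      _ ≤ M * m + C * a ^ (q - 1) * (2 * η * m) := by
          rw [abs_mul]
          gcongr
          exact h3.trans (by gcongr)
      _ ≤ _ := by linarith

/-- The oscillation of `g(x, ·)` on the interval `|t - a| < 2ηa`, computed along rational
parameters so as to be measurable in `x`. -/
def osc (g : RN N → ℝ → ℝ) (a : RN N → ℝ) (η : ℝ) (x : RN N) : ENNReal :=
  ⨆ r : {r : ℚ // |(r : ℝ)| < 2}, ‖g x (a x * (1 + η * r)) - g x (a x)‖ₑ

lemma measurable_osc {g : RN N → ℝ → ℝ} (hg : Measurable (Function.uncurry g)) {a : RN N → ℝ}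
    (ha : Measurable a) (η : ℝ) : Measurable (osc g a η) := by
  refine Measurable.iSup fun r => Measurable.enorm (Measurable.sub ?_ ?_)
  · exact hg.comp (measurable_id.prodMk (ha.mul_const _))
  · exact hg.comp (measurable_id.prodMk ha)

/-- By continuity, the supremum over rational parameters bounds the oscillation at every real `t` with
`|t - a| ≤ ηa`; the margin `2` in `osc` leaves room for rational approximation. -/
lemma enorm_sub_le_osc {g : RN N → ℝ → ℝ} {a : RN N → ℝ} {η : ℝ} (hη : 0 < η) {x : RN N}
    (hg : Continuous (g x)) (ha : 0 ≤ a x) {t : ℝ} (ht : |t - a x| ≤ η * a x) :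
    ‖g x t - g x (a x)‖ₑ ≤ osc g a η x := by
  rcases ha.eq_or_lt with h0 | h0
  · rw [← h0, mul_zero, sub_zero] at ht
    have : t = 0 := abs_nonpos_iff.1 ht
    simp [this, ← h0]
  set s := (t - a x) / (η * a x) with hs
  have hηa : 0 < η * a x := by positivity
  have hs1 : |s| < 2 := by
    rw [hs, abs_div, abs_of_pos hηa, div_lt_iff₀ hηa]
    linarith
  have hts : t = a x * (1 + η * s) := by rw [hs]; field_simp; ring
  by_contra! hlt
  have hopen : IsOpen ({s : ℝ | |s| < 2} ∩
      {s : ℝ | osc g a η x < ‖g x (a x * (1 + η * s)) - g x (a x)‖ₑ}) := by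
    refine (isOpen_lt continuous_abs continuous_const).inter (isOpen_lt continuous_const ?_)
    exact ((hg.comp (by fun_prop)).sub continuous_const).enorm
  obtain ⟨r, ⟨hr1, hr2⟩, q, rfl⟩ := (dense_iff_inter_open.1
    (Rat.denseRange_cast (𝕜 := ℝ))) _ hopen ⟨s, hs1, by rw [Set.mem_ofPred_eq, ← hts]; exact hlt⟩
  exact absurd (le_iSup (fun r : {r : ℚ // |(r : ℝ)| < 2} =>
    ‖g x (a x * (1 + η * r)) - g x (a x)‖ₑ) ⟨q, hr1⟩) (not_le.2 hr2)

lemma osc_le {g : RN N → ℝ → ℝ} {a : RN N → ℝ} {η C q : ℝ} (hη : 0 < η) (hη1 : η ≤ 1) (hC : 0 ≤ C)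
    (hq : 1 < q) {x : RN N} (hg : ∀ s, |g x s| ≤ C * |s| ^ (q - 1)) (ha : 0 ≤ a x) :
    osc g a η x ≤ ENNReal.ofReal (C * (3 ^ (q - 1) + 1) * a x ^ (q - 1)) := by
  refine iSup_le fun r => ?_
  rw [← ofReal_norm]
  refine ENNReal.ofReal_le_ofReal ((norm_sub_le _ _).trans ?_)
  have h1 : |g x (a x * (1 + η * r))| ≤ C * (3 * a x) ^ (q - 1) := by
    refine (hg _).trans ?_
    have h2 : |η * (r : ℝ)| ≤ 2 := by
      rw [abs_mul, abs_of_pos hη]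
      nlinarith [r.2, abs_nonneg ((r : ℚ) : ℝ)]
    have : |a x * (1 + η * r)| ≤ 3 * a x := by
      rw [abs_mul, abs_of_nonneg ha, mul_comm]
      gcongr
      refine (abs_add_le _ _).trans ?_
      rw [abs_one]; linarith
    gcongr
  have h3 := hg (a x)
  rw [abs_of_nonneg ha] at h3
  rw [Real.mul_rpow (by norm_num) ha] at h1
  simp only [Real.norm_eq_abs]
  calc _ ≤ C * (3 ^ (q - 1) * a x ^ (q - 1)) + C * a x ^ (q - 1) := add_le_add h1 h3
    _ = _ := by ring

lemma tendsto_osc {g : RN N → ℝ → ℝ} {a : RN N → ℝ} {x : RN N} (hg : Continuous (g x))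
    (ha : 0 ≤ a x) {η : ℕ → ℝ} (hη : ∀ n, 0 < η n)
    (hlim : Filter.Tendsto η Filter.atTop (nhds 0)) :
    Filter.Tendsto (fun n => osc g a (η n) x) Filter.atTop (nhds 0) := by
  rw [ENNReal.tendsto_nhds_zero]
  intro ε hε
  have hc : Filter.Tendsto (fun t => ‖g x t - g x (a x)‖ₑ) (nhds (a x)) (nhds 0) := by
    have : Continuous fun t => ‖g x t - g x (a x)‖ₑ := (hg.sub continuous_const).enorm
    simpa using this.tendsto (a x)
  obtain ⟨δ, hδ, hball⟩ := Metric.eventually_nhds_iff.1 ((ENNReal.tendsto_nhds_zero.1 hc) ε hε)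
  have h1 : Filter.Tendsto (fun n => 2 * a x * η n) Filter.atTop (nhds 0) := by
    simpa using hlim.const_mul (2 * a x)
  filter_upwards [h1.eventually_lt_const hδ] with n hn
  refine iSup_le fun r => hball ?_
  rw [Real.dist_eq]
  have e : a x * (1 + η n * r) - a x = a x * η n * r := by ring
  rw [e, abs_mul, abs_of_nonneg (mul_nonneg ha (hη n).le)]
  have := mul_nonneg ha (hη n).le
  nlinarith [r.2, abs_nonneg ((r : ℚ) : ℝ)]

end

section

variable {N : ℕ} {f : RN N → ℝ → ℝ} {h : RN N → RN N → RN N} {C : ℝ}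

/-- The growth condition `|f(x,s)| ≤ C |s|^{2^*-1}` for a.e. `x` and every `s`. -/
def CriticalGrowth (f : RN N → ℝ → ℝ) (C : ℝ) : Prop :=
  ∀ᵐ x ∂(volume : Measure (RN N)), ∀ s : ℝ, |f x s| ≤ C * |s| ^ (twoStar N - 1)

lemma critExp_toReal (hN : 3 ≤ N) : (critExp N).toReal = twoStar N :=
  ENNReal.toReal_ofReal (by linarith [two_lt_twoStar hN])

lemma critExp_ne_zero (hN : 3 ≤ N) : critExp N ≠ 0 :=
  (lt_of_lt_of_le one_pos (one_le_critExp hN)).ne'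

lemma integrable_norm_rpow_twoStar (hN : 3 ≤ N) {U : RN N → RN N}
    (hU : MemLp U (critExp N) volume) : Integrable (fun x => ‖U x‖ ^ twoStar N) volume := by
  have := hU.integrable_norm_rpow (critExp_ne_zero hN) critExp_ne_top
  rwa [critExp_toReal hN] at this

lemma Compatible.integrable_primH (hN : 3 ≤ N) (hF : ConditionF1 f) (hC : 0 ≤ C)
    (hg : CriticalGrowth f C) (hc : Compatible f h) {U : RN N → RN N}
    (hU : MemLp U (critExp N) volume) : Integrable (fun x => primH h x (U x)) volume := by
  have hq := two_lt_twoStar hN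
  have hm := hF.aestronglyMeasurable_primF hU.aestronglyMeasurable.norm.aemeasurable
  have hint : Integrable (fun x => primF f x ‖U x‖) volume := by
    refine ((integrable_norm_rpow_twoStar hN hU).const_mul C).mono' hm ?_
    filter_upwards [hg] with x hx
    exact abs_integral_le_of_growth hC (by linarith) hx (norm_nonneg _)
  refine hint.congr ?_
  filter_upwards [hc.primH_eq] with x hx using (hx _).symm

lemma Compatible.integrable_inner (hN : 3 ≤ N) (hF : ConditionF1 f) (hC : 0 ≤ C)
    (hg : CriticalGrowth f C) (hc : Compatible f h) {U V : RN N → RN N}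
    (hU : MemLp U (critExp N) volume) (hV : MemLp V (critExp N) volume) :
    Integrable (fun x => inner ℝ (h x (U x)) (V x)) volume := by
  have hq := two_lt_twoStar hN
  have hn := hU.aestronglyMeasurable.norm.aemeasurable
  have hm : AEStronglyMeasurable (fun x => f x ‖U x‖ / ‖U x‖ * inner ℝ (U x) (V x)) volume :=
    ((hF.aemeasurable_comp hn).div hn).aestronglyMeasurable.mul
      (hU.aestronglyMeasurable.inner hV.aestronglyMeasurable)
  have hint : Integrable (fun x => f x ‖U x‖ / ‖U x‖ * inner ℝ (U x) (V x)) volume := by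
    refine (((integrable_norm_rpow_twoStar hN hU).add
      (integrable_norm_rpow_twoStar hN hV)).const_mul C).mono' hm ?_
    filter_upwards [hg] with x hx
    have h1 := hx ‖U x‖
    rw [abs_norm] at h1
    have h2 : ‖f x ‖U x‖ / ‖U x‖ * inner ℝ (U x) (V x)‖ ≤ |f x ‖U x‖| * ‖V x‖ := by
      rw [norm_mul, norm_div, norm_norm]
      rcases (norm_nonneg (U x)).eq_or_lt with h0 | h0
      · rw [← h0]; simp; positivity
      · rw [div_mul_eq_mul_div, div_le_iff₀ h0]
        calc _ ≤ ‖f x ‖U x‖‖ * (‖U x‖ * ‖V x‖) := by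
              gcongr; exact norm_inner_le_norm _ _
          _ = _ := by rw [Real.norm_eq_abs]; ring
    set m := max ‖U x‖ ‖V x‖ with hm
    have hm0 : 0 ≤ m := (norm_nonneg _).trans (le_max_left _ _)
    have hmq : m ^ twoStar N ≤ ‖U x‖ ^ twoStar N + ‖V x‖ ^ twoStar N := by
      have n1 : 0 ≤ ‖U x‖ ^ twoStar N := by positivity
      have n2 : 0 ≤ ‖V x‖ ^ twoStar N := by positivity
      rcases max_choice ‖U x‖ ‖V x‖ with he | he
      · rw [hm, he]; linarith
      · rw [hm, he]; linarith
    calc _ ≤ |f x ‖U x‖| * ‖V x‖ := h2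
      _ ≤ C * m ^ (twoStar N - 1) * m := by
          gcongr
          · refine h1.trans ?_
            gcongr
            · linarith
            · exact le_max_left _ _
          · exact le_max_right _ _
      _ = C * m ^ twoStar N := by
          rw [mul_assoc, ← Real.rpow_add_one' hm0 (by linarith), sub_add_cancel]
      _ ≤ _ := by simp only [Pi.add_apply]; gcongr
  refine hint.congr ?_
  filter_upwards [hc.apply_eq] with x hx
  rw [hx.2.2, real_inner_smul_left]

/-- The functional `U ↦ ∫ H(x,U)` is Fréchet differentiable on `L^{2^*}`, with differential
`V ↦ ∫ h(x,U)·V`. -/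
lemma Compatible.exists_remainder_le (hN : 3 ≤ N) (hF : ConditionF1 f) (hC : 0 ≤ C)
    (hg : CriticalGrowth f C) (hc : Compatible f h) {U : RN N → RN N}
    (hU : MemLp U (critExp N) volume) {ε : ℝ} (hε : 0 < ε) :
    ∃ δ > 0, ∀ V : RN N → RN N, MemLp V (critExp N) volume →
      eLpNorm V (critExp N) volume ≤ ENNReal.ofReal δ →
      ‖∫ x, (primH h x (U x + V x) - primH h x (U x) - inner ℝ (h x (U x)) (V x))‖ₑ
        ≤ ENNReal.ofReal ε * eLpNorm V (critExp N) volume := by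
  have hq := two_lt_twoStar hN
  set q := twoStar N with hqdef
  have hq0 : 0 < q := by linarith
  have hq1 : 0 < q - 1 := by linarith
  set q' := q.conjExponent with hq'
  have hconj : q'.HolderConjugate q := (Real.HolderConjugate.conjExponent (by linarith)).symm
  have hq'0 : 0 < q' := hconj.pos
  have hqq' : (q - 1) * q' = q := by
    rw [hq', Real.conjExponent]; field_simp
  -- `a` is a measurable version of `|U|`, and `Ω n` is the coefficient of `|V|` in `abs_remainder_le`
  -- for `η = 1 / (n + 1)`.
  obtain ⟨g, hgm, hgc, hfg⟩ := hF.exists_measurable_version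
  have hUn := hU.aestronglyMeasurable.norm.aemeasurable
  set a := hUn.mk _ with ha
  have ham : Measurable a := hUn.measurable_mk
  have hae : ∀ᵐ x ∂(volume : Measure (RN N)), ‖U x‖ = a x := hUn.ae_eq_mk
  set η : ℕ → ℝ := fun n => 1 / ((n : ℝ) + 1) with hη
  have hη0 : ∀ n, 0 < η n := fun n => by positivity
  have hη1 : ∀ n, η n ≤ 1 := fun n => by
    rw [hη]; simp only
    rw [div_le_one (by positivity)]; linarith [n.cast_nonneg (α := ℝ)]
  have hηlim : Filter.Tendsto η Filter.atTop (nhds 0) := tendsto_one_div_add_atTop_nhds_zero_nat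
  set Ω : ℕ → RN N → ENNReal := fun n x =>
    osc g a (η n) x + ENNReal.ofReal (2 * C * η n * a x ^ (q - 1)) with hΩ
  have hΩm : ∀ n, Measurable (Ω n) := fun n =>
    (measurable_osc hgm ham _).add ((ham.pow_const _).const_mul _).ennreal_ofReal
  set K : ℝ := C * (3 ^ (q - 1) + 1) + 2 * C with hK
  have hK0 : 0 ≤ K := by positivity
  have hosc : ∀ n, ∀ᵐ x ∂(volume : Measure (RN N)),
      osc g a (η n) x ≤ ENNReal.ofReal (C * (3 ^ (q - 1) + 1) * a x ^ (q - 1)) := by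
    intro n
    filter_upwards [hg, hfg, hae] with x h1 h2 h3
    refine osc_le (hη0 n) (hη1 n) hC (by linarith) (fun s => ?_) (h3 ▸ norm_nonneg _)
    rw [← h2 s]; exact h1 s
  have hΩb : ∀ n, ∀ᵐ x ∂(volume : Measure (RN N)),
      Ω n x ≤ ENNReal.ofReal (K * a x ^ (q - 1)) := by
    intro n
    filter_upwards [hosc n, hae] with x h1 h3
    have ha0 : 0 ≤ a x := h3 ▸ norm_nonneg _
    have hp : 0 ≤ a x ^ (q - 1) := by positivity
    have hη0' := (hη0 n).le
    rw [hK, add_mul, ENNReal.ofReal_add (by positivity) (by positivity)]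
    refine add_le_add h1 (ENNReal.ofReal_le_ofReal ?_)
    have : 2 * C * η n ≤ 2 * C := mul_le_of_le_one_right (by positivity) (hη1 n)
    gcongr
  -- `Ω n → 0` in `L^{q'}` by dominated convergence; the dominating function is integrable because
  -- `(q - 1) q' = q`.
  have hlim : Filter.Tendsto (fun n => ∫⁻ x, Ω n x ^ q') Filter.atTop (nhds 0) := by
    have := tendsto_lintegral_of_dominated_convergence (μ := (volume : Measure (RN N)))
      (F := fun n x => Ω n x ^ q') (f := fun _ => 0)
      (fun x => ENNReal.ofReal (K * a x ^ (q - 1)) ^ q')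
      (fun n => (hΩm n).pow_const _)
      (fun n => by
        filter_upwards [hΩb n] with x hx
        exact ENNReal.rpow_le_rpow hx hq'0.le) ?_ ?_
    · simpa using this
    · have hi := ((integrable_norm_rpow_twoStar hN hU).const_mul (K ^ q')).lintegral_lt_top
      refine ((lintegral_congr_ae ?_).trans_lt hi).ne
      filter_upwards [hae] with x h3
      have ha0 : 0 ≤ a x := h3 ▸ norm_nonneg _
      rw [ENNReal.ofReal_rpow_of_nonneg (by positivity) hq'0.le, Real.mul_rpow hK0 (by positivity),
        ← Real.rpow_mul ha0, hqq', h3]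
    · filter_upwards [hae] with x h3
      have ha0 : 0 ≤ a x := h3 ▸ norm_nonneg _
      have t1 := tendsto_osc (hgc x) ha0 hη0 hηlim
      have t2 : Filter.Tendsto (fun n => ENNReal.ofReal (2 * C * η n * a x ^ (q - 1)))
          Filter.atTop (nhds (ENNReal.ofReal (2 * C * 0 * a x ^ (q - 1)))) :=
        ENNReal.tendsto_ofReal ((hηlim.const_mul _).mul_const _)
      have t3 := ((ENNReal.continuous_rpow_const (y := q')).tendsto _).comp (t1.add t2)
      simpa [hq'0, Function.comp_def] using t3
  have hlim' : Filter.Tendsto (fun n => (∫⁻ x, Ω n x ^ q') ^ (1 / q')) Filter.atTop (nhds 0) := by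
    have := ((ENNReal.continuous_rpow_const (y := 1 / q')).tendsto _).comp hlim
    simpa [hq'0, Function.comp_def] using this
  obtain ⟨n, hn⟩ := ((ENNReal.tendsto_nhds_zero.1 hlim') (ENNReal.ofReal (ε / 2))
    (by simpa using hε)).exists
  set A : ℝ := 3 * C * ((η n)⁻¹ + 1) ^ q with hA
  have hη0' := hη0 n
  have hA0 : 0 ≤ A := by positivity
  -- With `n` fixed, the term `A ‖V‖^q` is absorbed since `q > 1`: this `δ` makes `A δ^(q-1)` at most
  -- `ε / 2`.
  refine ⟨(ε / (2 * (A + 1))) ^ (1 / (q - 1)), by positivity, fun V hV hVδ => ?_⟩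
  have hpt : ∀ᵐ x ∂(volume : Measure (RN N)),
      ‖primH h x (U x + V x) - primH h x (U x) - inner ℝ (h x (U x)) (V x)‖ₑ
        ≤ ENNReal.ofReal A * ‖V x‖ₑ ^ q + (Ω n * fun x => ‖V x‖ₑ) x := by
    filter_upwards [hg, hfg, hae, hosc n, hc.apply_eq, hc.primH_eq] with x h1 h2 h3 h4 h5 h6
    have ha0 : 0 ≤ a x := h3 ▸ norm_nonneg _
    have hot : osc g a (η n) x ≠ ⊤ := ne_top_of_le_ne_top ENNReal.ofReal_ne_top h4
    have hfx : f x = g x := funext h2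
    have hcont : Continuous (f x) := hfx ▸ hgc x
    have key := abs_remainder_le hcont hC (q := q) (by linarith) h1 (U x) (V x) (η := η n)
      (M := (osc g a (η n) x).toReal) hη0' (fun t ht => by
        rw [h3] at ht ⊢
        have := enorm_sub_le_osc hη0' (hgc x) ha0 ht
        rw [hfx, ← Real.norm_eq_abs, ← toReal_enorm]
        exact ENNReal.toReal_mono hot this)
    rw [h6, h6, h5.2.2, real_inner_smul_left, ← ofReal_norm, Pi.mul_apply, ← ofReal_norm,
      ENNReal.ofReal_rpow_of_nonneg (norm_nonneg _) hq0.le, hΩ]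
    simp only
    rw [← ENNReal.ofReal_toReal hot, ← ENNReal.ofReal_add ENNReal.toReal_nonneg (by positivity),
      ← ENNReal.ofReal_mul hA0, ← ENNReal.ofReal_mul (by positivity),
      ← ENNReal.ofReal_add (by positivity) (by positivity), ← h3]
    exact ENNReal.ofReal_le_ofReal key
  set E := eLpNorm V (critExp N) volume with hE
  have hE1 : E = (∫⁻ x, ‖V x‖ₑ ^ q) ^ (1 / q) := by
    rw [hE, eLpNorm_eq_lintegral_rpow_enorm_toReal (critExp_ne_zero hN) critExp_ne_top,
      critExp_toReal hN]
  have hE2 : ∫⁻ x, ‖V x‖ₑ ^ q = E ^ (q - 1) * E := by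
    have : E ^ q = ∫⁻ x, ‖V x‖ₑ ^ q := by
      rw [hE1, ← ENNReal.rpow_mul, one_div_mul_cancel hq0.ne', ENNReal.rpow_one]
    rw [← this]
    conv_rhs => rw [← ENNReal.rpow_one E, ← ENNReal.rpow_mul, one_mul]
    rw [← ENNReal.rpow_add_of_nonneg _ _ hq1.le zero_le_one, sub_add_cancel]
  have hVm : AEMeasurable (fun x => ‖V x‖ₑ) volume := hV.aestronglyMeasurable.enorm
  have hδ : ENNReal.ofReal A * E ^ (q - 1) ≤ ENNReal.ofReal (ε / 2) := by
    calc _ ≤ ENNReal.ofReal A * ENNReal.ofReal ((ε / (2 * (A + 1))) ^ (1 / (q - 1))) ^ (q - 1) := by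
          gcongr
      _ = ENNReal.ofReal (A * (ε / (2 * (A + 1)))) := by
          rw [ENNReal.ofReal_rpow_of_nonneg (by positivity) hq1.le, ← Real.rpow_mul (by positivity),
            one_div_mul_cancel hq1.ne', Real.rpow_one, ENNReal.ofReal_mul hA0]
      _ ≤ _ := by
          refine ENNReal.ofReal_le_ofReal ?_
          rw [mul_div_assoc', div_le_div_iff₀ (by positivity) (by norm_num)]
          nlinarith
  calc _ ≤ ∫⁻ x, ‖primH h x (U x + V x) - primH h x (U x) - inner ℝ (h x (U x)) (V x)‖ₑ :=
        enorm_integral_le_lintegral_enorm _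
    _ ≤ ∫⁻ x, (ENNReal.ofReal A * ‖V x‖ₑ ^ q + (Ω n * fun x => ‖V x‖ₑ) x) := lintegral_mono_ae hpt
    _ = ENNReal.ofReal A * (∫⁻ x, ‖V x‖ₑ ^ q) + ∫⁻ x, (Ω n * fun x => ‖V x‖ₑ) x := by
        rw [lintegral_add_left' ((hVm.pow_const _).const_mul _),
          lintegral_const_mul'' _ (hVm.pow_const _)]
    _ ≤ ENNReal.ofReal A * (E ^ (q - 1) * E) + (∫⁻ x, Ω n x ^ q') ^ (1 / q') * E := by
        rw [hE2]
        gcongr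
        rw [hE1]
        exact ENNReal.lintegral_mul_le_Lp_mul_Lq volume hconj (hΩm n).aemeasurable hVm
    _ = (ENNReal.ofReal A * E ^ (q - 1) + (∫⁻ x, Ω n x ^ q') ^ (1 / q')) * E := by ring
    _ ≤ (ENNReal.ofReal (ε / 2) + ENNReal.ofReal (ε / 2)) * E := by gcongr
    _ = _ := by rw [← ENNReal.ofReal_add (by positivity) (by positivity), add_halves]

end

section

variable {N : ℕ} {f : RN N → ℝ → ℝ} {h : RN N → RN N → RN N} {C : ℝ}

/-! ### The space `D^{1,2}(ℝ^N, ℝ^N)` -/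

namespace D12Vec

variable {U V : RN N → RN N}

lemma add (hU : U ∈ D12Vec N) (hV : V ∈ D12Vec N) : U + V ∈ D12Vec N :=
  fun j => D12.add (hU j) (hV j)

lemma const_smul (c : ℝ) (hV : V ∈ D12Vec N) : c • V ∈ D12Vec N :=
  fun j => D12.const_mul c (hV j)

lemma eq_sum (U : RN N → RN N) :
    U = fun x => ∑ j, U x j • (EuclideanSpace.single j (1 : ℝ) : RN N) := by
  funext x
  ext k
  simp [Pi.single_apply, -Fintype.sum_sum_type]

lemma memLp_smul_single {p : ENNReal} {u : RN N → ℝ} (hu : MemLp u p volume)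
    (j : Fin 2 ⊕ Fin (N - 2)) :
    MemLp (fun x => u x • (EuclideanSpace.single j (1 : ℝ) : RN N)) p volume := by
  refine hu.of_le (hu.aestronglyMeasurable.smul_const _) (Filter.Eventually.of_forall fun x => ?_)
  simp [norm_smul]

lemma memLp (hU : U ∈ D12Vec N) : MemLp U (critExp N) volume := by
  rw [eq_sum U]
  exact memLp_finsetSum _ fun j _ => memLp_smul_single (hU j).1 j

lemma normD12Vec_sq (U : RN N → RN N) : normD12Vec U ^ 2 = ∫ x, gradSqVec U x :=
  Real.sq_sqrt (integral_nonneg fun x => gradSqVec_nonneg U x)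

lemma normD12Vec_nonneg (U : RN N → RN N) : 0 ≤ normD12Vec U := Real.sqrt_nonneg _

/-- The constant is not optimal; only the order in the norm matters for critical points. -/
lemma integral_divergence_sq_le (hU : U ∈ D12Vec N) :
    ∫ x, divergence U x ^ 2 ≤ Fintype.card (Fin 2 ⊕ Fin (N - 2)) * normD12Vec U ^ 2 := by
  rw [normD12Vec_sq U, ← integral_const_mul]
  exact integral_mono (memLp_divergence hU).integrable_sq ((integrable_gradSqVec hU).const_mul _)
    fun x => divergence_sq_le U x

lemma eLpNorm_weakPartial_le (hU : U ∈ D12Vec N) (i j : Fin 2 ⊕ Fin (N - 2)) :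
    eLpNorm (weakPartial i fun x => U x j) 2 volume ≤ ENNReal.ofReal (normD12Vec U) := by
  have hw := D12.memLp_weakPartial (hU j) i
  rw [hw.eLpNorm_eq_integral_rpow_norm (by norm_num) (by simp)]
  refine ENNReal.ofReal_le_ofReal ?_
  rw [ENNReal.toReal_ofNat, inv_eq_one_div, ← Real.sqrt_eq_rpow, normD12Vec]
  refine Real.sqrt_le_sqrt (integral_mono ?_ (integrable_gradSqVec hU) fun x => ?_)
  · simpa using hw.integrable_sq
  · simp only [Real.rpow_ofNat, Real.norm_eq_abs, sq_abs]
    calc weakPartial i (fun x => U x j) x ^ 2 ≤ gradSq (fun x => U x j) x :=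
          Finset.single_le_sum (f := fun i => weakPartial i (fun x => U x j) x ^ 2)
            (fun _ _ => sq_nonneg _) (Finset.mem_univ i)
      _ ≤ gradSqVec U x :=
          Finset.single_le_sum (f := fun j => gradSq (fun x => U x j) x)
            (fun _ _ => Finset.sum_nonneg fun _ _ => sq_nonneg _) (Finset.mem_univ j)

/-- The Sobolev inequality for vector fields. -/
lemma exists_sobolev (hN : 3 ≤ N) : ∃ M > 0, ∀ U ∈ D12Vec N,
    eLpNorm U (critExp N) volume ≤ ENNReal.ofReal (M * normD12Vec U) := by
  obtain ⟨S, hS, hSob⟩ := CurlCurl.exists_sobolev hN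
  set K : ℝ := (Fintype.card (Fin 2 ⊕ Fin (N - 2)) : ℝ) with hK
  refine ⟨K * (S.toReal * K) + 1, by positivity, fun U hU => ?_⟩
  set n := normD12Vec U with hn
  have hn0 : 0 ≤ n := normD12Vec_nonneg U
  have hcomp : ∀ j, eLpNorm (fun x => U x j) (critExp N) volume
      ≤ ENNReal.ofReal (S.toReal * (K * n)) := by
    intro j
    refine (hSob _ (hU j)).trans ?_
    calc _ ≤ S * ∑ _i : Fin 2 ⊕ Fin (N - 2), ENNReal.ofReal n := by
          gcongr with i; exact eLpNorm_weakPartial_le hU i j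
      _ = _ := by
          rw [Finset.sum_const, Finset.card_univ, nsmul_eq_mul,
            ENNReal.ofReal_mul ENNReal.toReal_nonneg, ENNReal.ofReal_toReal hS,
            ENNReal.ofReal_mul (by positivity), hK, ENNReal.ofReal_natCast]
  have h1 : eLpNorm U (critExp N) volume
      ≤ ∑ j, eLpNorm (fun x => U x j • (EuclideanSpace.single j (1 : ℝ) : RN N))
        (critExp N) volume := by
    have e : U = ∑ j, fun x => U x j • (EuclideanSpace.single j (1 : ℝ) : RN N) := by
      conv_lhs => rw [eq_sum U]
      funext x
      rw [Finset.sum_apply]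
    conv_lhs => rw [e]
    exact eLpNorm_sum_le (fun j _ => (memLp_smul_single (hU j).1 j).aestronglyMeasurable)
      (one_le_critExp hN)
  refine h1.trans ?_
  calc _ ≤ ∑ _j : Fin 2 ⊕ Fin (N - 2), ENNReal.ofReal (S.toReal * (K * n)) := by
        refine Finset.sum_le_sum fun j _ => le_trans (eLpNorm_mono fun x => ?_) (hcomp j)
        simp [norm_smul]
    _ = ENNReal.ofReal (K * (S.toReal * (K * n))) := by
        rw [Finset.sum_const, Finset.card_univ, nsmul_eq_mul, ENNReal.ofReal_mul (p := K) (by positivity),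
          hK, ENNReal.ofReal_natCast]
    _ ≤ _ := by
        refine ENNReal.ofReal_le_ofReal ?_
        nlinarith

lemma weakPartial_add (hU : U ∈ D12Vec N) (hV : V ∈ D12Vec N) (i j : Fin 2 ⊕ Fin (N - 2)) :
    weakPartial i (fun x => (U + V) x j) =ᵐ[volume]
      fun x => weakPartial i (fun y => U y j) x + weakPartial i (fun y => V y j) x :=
  D12.weakPartial_add (hU j) (hV j) i

lemma divergence_add (hU : U ∈ D12Vec N) (hV : V ∈ D12Vec N) :
    divergence (U + V) =ᵐ[volume] fun x => divergence U x + divergence V x := by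
  filter_upwards [ae_all_iff.2 fun i => weakPartial_add hU hV i i] with x hx
  simp only [divergence, hx, Finset.sum_add_distrib]

lemma weakPartial_const_smul (c : ℝ) (hV : V ∈ D12Vec N) (i j : Fin 2 ⊕ Fin (N - 2)) :
    weakPartial i (fun x => (c • V) x j) =ᵐ[volume]
      fun x => c * weakPartial i (fun y => V y j) x :=
  D12.weakPartial_const_mul c (hV j) i

lemma divergence_const_smul (c : ℝ) (hV : V ∈ D12Vec N) :
    divergence (c • V) =ᵐ[volume] fun x => c * divergence V x := by
  filter_upwards [ae_all_iff.2 fun i => weakPartial_const_smul c hV i i] with x hx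
  simp only [divergence, hx, Finset.mul_sum]

lemma normD12Vec_const_smul {c : ℝ} (hc : 0 ≤ c) (hV : V ∈ D12Vec N) :
    normD12Vec (c • V) = c * normD12Vec V := by
  have e : gradSqVec (c • V) =ᵐ[volume] fun x => c ^ 2 * gradSqVec V x := by
    filter_upwards [ae_all_iff.2 fun i => ae_all_iff.2 fun j => weakPartial_const_smul c hV i j]
      with x hx
    simp only [gradSqVec, gradSq, hx, Finset.mul_sum, mul_pow]
  rw [normD12Vec, integral_congr_ae e, integral_const_mul, Real.sqrt_mul (sq_nonneg c),
    Real.sqrt_sq hc, normD12Vec]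

end D12Vec

/-! ### The energies -/

/-- The differential `E'(U)[V]` of the curl-curl energy. -/
def diffE (h : RN N → RN N → RN N) (U V : RN N → RN N) : ℝ :=
  ∫ x, ((∑ j, ∑ i, weakPartial i (fun y => U y j) x * weakPartial i (fun y => V y j) x)
    - divergence U x * divergence V x - inner ℝ (h x (U x)) (V x))

lemma integrable_gradient_mul {U V : RN N → RN N} (hU : U ∈ D12Vec N) (hV : V ∈ D12Vec N) :
    Integrable (fun x => ∑ j, ∑ i, weakPartial i (fun y => U y j) x
      * weakPartial i (fun y => V y j) x) volume :=
  integrable_finsetSum _ fun j _ => integrable_finsetSum _ fun i _ =>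
    (D12.memLp_weakPartial (hU j) i).integrable_mul (D12.memLp_weakPartial (hV j) i)

lemma integrable_densityE (hN : 3 ≤ N) (hF : ConditionF1 f) (hC : 0 ≤ C)
    (hg : CriticalGrowth f C) (hc : Compatible f h) {U : RN N → RN N} (hU : U ∈ D12Vec N) :
    Integrable (densityE h U) volume :=
  (((integrable_gradSqVec hU).sub (memLp_divergence hU).integrable_sq).const_mul (1 / 2)).sub
    (hc.integrable_primH hN hF hC hg (D12Vec.memLp hU))

lemma diffE_const_smul {U V : RN N → RN N} (c : ℝ) (hV : V ∈ D12Vec N) :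
    diffE h U (c • V) = c * diffE h U V := by
  rw [diffE, diffE, ← integral_const_mul]
  refine integral_congr_ae ?_
  filter_upwards [ae_all_iff.2 fun i => ae_all_iff.2 fun j =>
    D12Vec.weakPartial_const_smul c hV i j, D12Vec.divergence_const_smul c hV] with x h1 h2
  simp only [h1, h2]
  rw [Pi.smul_apply, real_inner_smul_right]
  simp only [mul_sub, Finset.mul_sum]
  congr 1
  congr 1
  · exact Finset.sum_congr rfl fun j _ => Finset.sum_congr rfl fun i _ => by ring
  · ring

/-- The curl-curl energy is Fréchet differentiable on `D^{1,2}`. -/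
lemma energyE_expansion (hN : 3 ≤ N) (hF : ConditionF1 f) (hC : 0 ≤ C)
    (hg : CriticalGrowth f C) (hc : Compatible f h) {U : RN N → RN N} (hU : U ∈ D12Vec N)
    {ε : ℝ} (hε : 0 < ε) :
    ∃ δ > 0, ∀ V ∈ D12Vec N, normD12Vec V < δ →
      |energyE h (U + V) - energyE h U - diffE h U V| ≤ ε * normD12Vec V := by
  obtain ⟨M, hM, hSob⟩ := D12Vec.exists_sobolev hN
  obtain ⟨δ, hδ, hrem⟩ := hc.exists_remainder_le hN hF hC hg (D12Vec.memLp hU)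
    (show 0 < ε / (2 * M) by positivity)
  set K : ℝ := (Fintype.card (Fin 2 ⊕ Fin (N - 2)) : ℝ) with hK
  have hK0 : 0 ≤ K := by positivity
  refine ⟨min (δ / M) (ε / (1 + K)), by positivity, fun V hV hVn => ?_⟩
  set n := normD12Vec V with hn
  have hn0 : 0 ≤ n := D12Vec.normD12Vec_nonneg V
  have hn1 : M * n ≤ δ := by
    have := (hVn.trans_le (min_le_left _ _)).le
    rw [le_div_iff₀ hM] at this; linarith
  have hn2 : n * (1 + K) ≤ ε := by
    have := (hVn.trans_le (min_le_right _ _)).le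
    rwa [le_div_iff₀ (by positivity)] at this
  have hUV := D12Vec.add hU hV
  have hUm := D12Vec.memLp hU
  have hVm := D12Vec.memLp hV
  have i1 := hc.integrable_primH hN hF hC hg (D12Vec.memLp hUV)
  have i2 := hc.integrable_primH hN hF hC hg hUm
  have i3 := hc.integrable_inner hN hF hC hg hUm hVm
  have iR : Integrable (fun x => primH h x (U x + V x) - primH h x (U x)
      - inner ℝ (h x (U x)) (V x)) volume := (i1.sub i2).sub i3
  have iG := integrable_gradSqVec hV
  have iD := (memLp_divergence hV).integrable_sq
  have iQ : Integrable (fun x => 1 / 2 * (gradSqVec V x - divergence V x ^ 2)) volume :=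
    (iG.sub iD).const_mul _
  have iL : Integrable (fun x => (∑ j, ∑ i, weakPartial i (fun y => U y j) x
      * weakPartial i (fun y => V y j) x) - divergence U x * divergence V x
      - inner ℝ (h x (U x)) (V x)) volume :=
    ((integrable_gradient_mul hU hV).sub
      ((memLp_divergence hU).integrable_mul (memLp_divergence hV))).sub i3
  have key : energyE h (U + V) - energyE h U - diffE h U V
      = (∫ x, 1 / 2 * (gradSqVec V x - divergence V x ^ 2))
        - ∫ x, (primH h x (U x + V x) - primH h x (U x) - inner ℝ (h x (U x)) (V x)) := by
    have iE : Integrable (fun x => densityE h (U + V) x - densityE h U x) volume :=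
      (integrable_densityE hN hF hC hg hc hUV).sub (integrable_densityE hN hF hC hg hc hU)
    rw [energyE, energyE, diffE,
      ← integral_sub (integrable_densityE hN hF hC hg hc hUV)
        (integrable_densityE hN hF hC hg hc hU), ← integral_sub iE iL, ← integral_sub iQ iR]
    refine integral_congr_ae ?_
    filter_upwards [ae_all_iff.2 fun i => ae_all_iff.2 fun j => D12Vec.weakPartial_add hU hV i j,
      D12Vec.divergence_add hU hV] with x h1 h2
    have e1 : gradSqVec (U + V) x = gradSqVec U x + gradSqVec V x
        + 2 * ∑ j, ∑ i, weakPartial i (fun y => U y j) x * weakPartial i (fun y => V y j) x := by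
      simp only [gradSqVec, gradSq, h1, Finset.mul_sum, ← Finset.sum_add_distrib]
      exact Finset.sum_congr rfl fun j _ => Finset.sum_congr rfl fun i _ => by ring
    simp only [densityE, h2, e1, Pi.add_apply]
    ring
  have hquad : |∫ x, 1 / 2 * (gradSqVec V x - divergence V x ^ 2)| ≤ ε / 2 * n := by
    rw [integral_const_mul, integral_sub iG iD, ← D12Vec.normD12Vec_sq V, ← hn]
    have hd := D12Vec.integral_divergence_sq_le hV
    rw [← hn, ← hK] at hd
    have hd0 : 0 ≤ ∫ x, divergence V x ^ 2 := integral_nonneg fun x => sq_nonneg _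
    rw [abs_le]
    constructor <;> nlinarith
  have hR : |∫ x, (primH h x (U x + V x) - primH h x (U x) - inner ℝ (h x (U x)) (V x))|
      ≤ ε / 2 * n := by
    have h1 := hrem V hVm ((hSob V hV).trans (ENNReal.ofReal_le_ofReal hn1))
    have h2 := h1.trans (mul_le_mul_right (hSob V hV) _)
    rw [← ENNReal.ofReal_mul (by positivity), ← ofReal_norm,
      ENNReal.ofReal_le_ofReal_iff (by positivity)] at h2
    refine h2.trans (le_of_eq ?_)
    rw [← hn]
    field_simp
  rw [key]
  calc _ ≤ _ := abs_sub _ _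
    _ ≤ ε / 2 * n + ε / 2 * n := add_le_add hquad hR
    _ = ε * n := by ring

section Angular

variable {u v : RN N → ℝ} {U V : RN N → RN N}

lemma Related.add (hU : Related u U) (hV : Related v V) : Related (u + v) (U + V) := by
  filter_upwards [hU, hV] with x h1 h2
  rw [Pi.add_apply, h1, h2, Pi.add_apply, add_div, add_smul]

lemma Related.const_smul (c : ℝ) (hV : Related v V) : Related (c • v) (c • V) := by
  filter_upwards [hV] with x h2
  rw [Pi.smul_apply, h2, Pi.smul_apply, smul_eq_mul, smul_smul, mul_div_assoc]

lemma Related.normX_eq (hN : 3 ≤ N) (h : Related u U) (hu : u ∈ spaceX N) :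
    normX u = normD12Vec U := by
  rw [normX, normD12Vec, integral_congr_ae (h.gradSqVec_ae_eq hN hu)]

/-- The densities of the two energies differ by the divergence term only. -/
lemma Related.densityE_ae_eq (hN : 3 ≤ N) (hc : Compatible f h) (hr : Related u U)
    (hu : u ∈ spaceX N) :
    densityE h U =ᵐ[volume] fun x => densityJ f u x - 1 / 2 * divergence U x ^ 2 := by
  filter_upwards [hr.gradSqVec_ae_eq hN hu, hr.norm_eq, hc.primH_eq, hc.primF_abs] with x h1 h2 h3 h4
  rw [densityE, densityJ, h1, h3, h2, h4]
  ring

lemma Related.integrable_densityJ (hN : 3 ≤ N) (hF : ConditionF1 f) (hC : 0 ≤ C)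
    (hg : CriticalGrowth f C) (hc : Compatible f h) (hr : Related u U) (hu : u ∈ spaceX N) :
    Integrable (densityJ f u) volume := by
  have hU := hr.mem_D12Vec hN hu
  refine ((integrable_densityE hN hF hC hg hc hU).add
    ((memLp_divergence hU).integrable_sq.const_mul (1 / 2))).congr ?_
  filter_upwards [hr.densityE_ae_eq hN hc hu] with x hx
  rw [Pi.add_apply, hx]
  ring

lemma Related.energyE_eq (hN : 3 ≤ N) (hF : ConditionF1 f) (hC : 0 ≤ C)
    (hg : CriticalGrowth f C) (hc : Compatible f h) (hr : Related u U) (hu : u ∈ spaceX N) :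
    energyE h U = energyJ f u - 1 / 2 * ∫ x, divergence U x ^ 2 := by
  rw [energyE, integral_congr_ae (hr.densityE_ae_eq hN hc hu), integral_sub
    (hr.integrable_densityJ hN hF hC hg hc hu)
    ((memLp_divergence (hr.mem_D12Vec hN hu)).integrable_sq.const_mul _), integral_const_mul]
  rfl

lemma Related.energyE_eq_energyJ (hN : 3 ≤ N) (hF : ConditionF1 f) (hC : 0 ≤ C)
    (hg : CriticalGrowth f C) (hc : Compatible f h) (hr : Related u U) (hu : u ∈ spaceXSO N) :
    energyE h U = energyJ f u := by
  rw [hr.energyE_eq hN hF hC hg hc hu.1, integral_congr_ae (g := fun _ => 0), integral_zero,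
    mul_zero, sub_zero]
  filter_upwards [hr.divergence_ae_eq hN hu] with x hx
  rw [hx]; simp

/-- Moving from `u ∈ X_SO` in an arbitrary direction `v ∈ X` changes `J` and `E` by the same amount,
up to a term of second order in `v`. -/
lemma Related.energyE_add (hN : 3 ≤ N) (hF : ConditionF1 f) (hC : 0 ≤ C)
    (hg : CriticalGrowth f C) (hc : Compatible f h) (hr : Related u U) (hu : u ∈ spaceXSO N)
    (hr' : Related v V) (hv : v ∈ spaceX N) :
    energyE h (U + V) - energyE h U
      = energyJ f (u + v) - energyJ f u - 1 / 2 * ∫ x, divergence V x ^ 2 := by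
  have hU := hr.mem_D12Vec hN hu.1
  have hV := hr'.mem_D12Vec hN hv
  have huv := (hr.add hr').mem_spaceX hN (D12Vec.add hU hV)
  rw [(hr.add hr').energyE_eq hN hF hC hg hc huv, hr.energyE_eq_energyJ hN hF hC hg hc hu]
  have : ∫ x, divergence (U + V) x ^ 2 = ∫ x, divergence V x ^ 2 := by
    refine integral_congr_ae ?_
    filter_upwards [D12Vec.divergence_add hU hV, hr.divergence_ae_eq hN hu] with x h1 h2
    rw [h1, h2]; simp
  rw [this]
  ring

/-! ### Critical points -/

/-- A critical point of `E` of angular type yields a critical point of `J`. -/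
lemma Related.isSolutionSchrodinger (hN : 3 ≤ N) (hF : ConditionF1 f) (hC : 0 ≤ C)
    (hg : CriticalGrowth f C) (hc : Compatible f h) (hr : Related u U) (hu : u ∈ spaceXSO N)
    (hcrit : IsSolutionCurlCurl h U) : IsSolutionSchrodinger f u := by
  refine ⟨hu.1, fun ε hε => ?_⟩
  obtain ⟨δ, hδ, hE⟩ := hcrit.2 (ε / 2) (by positivity)
  set K : ℝ := (Fintype.card (Fin 2 ⊕ Fin (N - 2)) : ℝ) with hK
  have hK0 : 0 ≤ K := by positivity
  refine ⟨min δ (ε / (1 + K)), by positivity, fun v hv hvn => ?_⟩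
  have hr' := related_angularField v
  have hV := hr'.mem_D12Vec hN hv
  rw [hr'.normX_eq hN hv] at hvn ⊢
  have h1 := hE _ hV (hvn.trans_le (min_le_left _ _))
  have h2 := hr.energyE_add hN hF hC hg hc hu hr' hv
  set n := normD12Vec (angularField v) with hn
  have hn0 : 0 ≤ n := D12Vec.normD12Vec_nonneg _
  have hn2 : n * (1 + K) ≤ ε := by
    have := (hvn.trans_le (min_le_right _ _)).le
    rwa [le_div_iff₀ (by positivity)] at this
  have hd := D12Vec.integral_divergence_sq_le hV
  rw [← hn, ← hK] at hd
  have hd0 : 0 ≤ ∫ x, divergence (angularField v) x ^ 2 := integral_nonneg fun x => sq_nonneg _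
  rw [h2] at h1
  rw [abs_le] at h1 ⊢
  constructor <;> nlinarith

/-- If `u` is critical for `J`, then `E'(U)` vanishes in all angular directions `V = v τ`. -/
lemma Related.diffE_angular_eq_zero (hN : 3 ≤ N) (hF : ConditionF1 f) (hC : 0 ≤ C)
    (hg : CriticalGrowth f C) (hc : Compatible f h) (hr : Related u U) (hu : u ∈ spaceXSO N)
    (hcrit : IsSolutionSchrodinger f u) (hr' : Related v V) (hv : v ∈ spaceX N) :
    diffE h U V = 0 := by
  have hU := hr.mem_D12Vec hN hu.1
  have hV := hr'.mem_D12Vec hN hv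
  set K : ℝ := (Fintype.card (Fin 2 ⊕ Fin (N - 2)) : ℝ) with hK
  have hK0 : 0 ≤ K := by positivity
  set n := normD12Vec V with hn
  have hn0 : 0 ≤ n := D12Vec.normD12Vec_nonneg V
  set B : ℝ := 2 * n + K * n ^ 2 with hB
  have hB0 : 0 ≤ B := by positivity
  have main : ∀ ε > 0, |diffE h U V| ≤ ε * B := by
    intro ε hε
    obtain ⟨δ₁, hδ₁, h1⟩ := energyE_expansion hN hF hC hg hc hU hε
    obtain ⟨δ₂, hδ₂, h2⟩ := hcrit.2 ε hε
    -- Both expansions apply to the direction `t V`, and `t ≤ ε` makes the quadratic divergence term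
    -- `O(ε t)`; dividing by `t` leaves `|E'(U)[V]| ≤ ε B`.
    set t : ℝ := min ε (min δ₁ δ₂ / (n + 1)) with ht
    have ht0 : 0 < t := by positivity
    have htε : t ≤ ε := min_le_left _ _
    have htn : t * n < min δ₁ δ₂ := by
      have : t * (n + 1) ≤ min δ₁ δ₂ := by
        rw [← le_div_iff₀ (by positivity)]; exact min_le_right _ _
      linarith
    have hrt := hr'.const_smul t
    have hVt := D12Vec.const_smul t hV
    have hvt := hrt.mem_spaceX hN hVt
    have hnt : normD12Vec (t • V) = t * n := D12Vec.normD12Vec_const_smul ht0.le hV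
    have e1 := h1 _ hVt (by rw [hnt]; exact htn.trans_le (min_le_left _ _))
    have e2 := h2 _ hvt (by
      rw [hrt.normX_eq hN hvt, hnt]; exact htn.trans_le (min_le_right _ _))
    rw [hrt.normX_eq hN hvt, hnt] at e2
    rw [hr.energyE_add hN hF hC hg hc hu hrt hvt, diffE_const_smul t hV, hnt] at e1
    have hd := D12Vec.integral_divergence_sq_le hVt
    rw [hnt, ← hK] at hd
    have hd0 : 0 ≤ ∫ x, divergence (t • V) x ^ 2 := integral_nonneg fun x => sq_nonneg _
    have hd' : K * (t * n) ^ 2 ≤ t * (ε * (K * n ^ 2)) := by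
      have : t * (K * n ^ 2) ≤ ε * (K * n ^ 2) := by gcongr
      nlinarith
    have : t * |diffE h U V| ≤ t * (ε * B) := by
      rw [← abs_of_pos ht0, ← abs_mul, abs_of_pos ht0]
      rw [abs_le] at e1 e2 ⊢
      rw [hB]
      constructor <;> nlinarith
    exact le_of_mul_le_mul_left this ht0
  by_contra hne
  have hpos : 0 < |diffE h U V| := abs_pos.2 hne
  have := main (|diffE h U V| / (2 * (B + 1))) (by positivity)
  rw [div_mul_eq_mul_div, le_div_iff₀ (by positivity)] at this
  nlinarith

lemma holderTriple_conj (hN : 3 ≤ N) :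
    ENNReal.HolderTriple (ENNReal.ofReal (twoStar N / (twoStar N - 1))) (critExp N) 1 := by
  have hq := two_lt_twoStar hN
  constructor
  rw [critExp, ← ENNReal.ofReal_inv_of_pos (div_pos (by linarith) (by linarith)),
    ← ENNReal.ofReal_inv_of_pos (by linarith), ← ENNReal.ofReal_add
      (inv_nonneg.2 (div_nonneg (by linarith) (by linarith))) (inv_nonneg.2 (by linarith)),
    inv_one, ← ENNReal.ofReal_one]
  congr 1
  have : twoStar N ≠ 0 := by linarith
  field_simp
  ring

/-- The superposition operator of `h` maps `L^{2^*}` to the dual space `L^{(2^*)'}`. -/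
lemma Compatible.memLp_apply (hN : 3 ≤ N) (hF : ConditionF1 f)
    (hg : CriticalGrowth f C) (hc : Compatible f h) (hU : MemLp U (critExp N) volume)
    (j : Fin 2 ⊕ Fin (N - 2)) :
    MemLp (fun x => h x (U x) j) (ENNReal.ofReal (twoStar N / (twoStar N - 1))) volume := by
  have hq := two_lt_twoStar hN
  have hn := hU.aestronglyMeasurable.norm.aemeasurable
  have hcoord : AEMeasurable (fun x => U x j) volume :=
    (contDiff_coord j).continuous.measurable.comp_aemeasurable hU.aestronglyMeasurable.aemeasurable
  have hm : AEStronglyMeasurable (fun x => f x ‖U x‖ / ‖U x‖ * U x j) volume :=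
    (((hF.aemeasurable_comp hn).div hn).mul hcoord).aestronglyMeasurable
  have hb : MemLp (fun x => C * ‖U x‖ ^ (twoStar N - 1))
      (ENNReal.ofReal (twoStar N / (twoStar N - 1))) volume := by
    have := (hU.norm_rpow_div (ENNReal.ofReal (twoStar N - 1))).const_mul C
    rwa [ENNReal.toReal_ofReal (by linarith), critExp, ← ENNReal.ofReal_div_of_pos (by linarith)]
      at this
  have hmem : MemLp (fun x => f x ‖U x‖ / ‖U x‖ * U x j)
      (ENNReal.ofReal (twoStar N / (twoStar N - 1))) volume := by
    refine hb.mono' hm ?_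
    filter_upwards [hg] with x hx
    have h1 := hx ‖U x‖
    rw [abs_norm] at h1
    refine le_trans ?_ h1
    rw [norm_mul, norm_div, norm_norm]
    rcases (norm_nonneg (U x)).eq_or_lt with h0 | h0
    · rw [← h0]; simp
    · rw [div_mul_eq_mul_div, div_le_iff₀ h0, Real.norm_eq_abs]
      gcongr
      exact PiLp.norm_apply_le (U x) j
  refine hmem.ae_eq ?_
  filter_upwards [hc.apply_eq] with x hx
  rw [hx.2.2, PiLp.smul_apply, smul_eq_mul]

lemma enorm_integral_mul_le {p q : ENNReal} [p.HolderTriple q 1] {a b : RN N → ℝ}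
    (ha : AEStronglyMeasurable a volume) (hb : AEStronglyMeasurable b volume) :
    ‖∫ x, a x * b x‖ₑ ≤ eLpNorm a p volume * eLpNorm b q volume := by
  refine (enorm_integral_le_lintegral_enorm _).trans ?_
  rw [← eLpNorm_one_eq_lintegral_enorm]
  have := eLpNorm_smul_le_mul_eLpNorm (p := p) (q := q) (r := 1) hb ha
  exact this

/-- An equation in divergence form tested with test functions extends to all of `D^{1,2}` by
density. -/
lemma divergence_equation_of_test (hN : 3 ≤ N) {G : Fin 2 ⊕ Fin (N - 2) → RN N → ℝ}
    {g : RN N → ℝ} (hG : ∀ i, MemLp (G i) 2 volume)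
    (hg : MemLp g (ENNReal.ofReal (twoStar N / (twoStar N - 1))) volume)
    (hT : ∀ φ, IsTest φ → ∑ i, ∫ x, G i x * pd i φ x = ∫ x, g x * φ x) (hv : v ∈ D12 N) :
    ∑ i, ∫ x, G i x * weakPartial i v x = ∫ x, g x * v x := by
  have := holderTriple_conj hN
  set S : ENNReal := ∑ i, eLpNorm (G i) 2 volume
    + eLpNorm g (ENNReal.ofReal (twoStar N / (twoStar N - 1))) volume with hS
  have hSt : S ≠ ⊤ := ENNReal.add_ne_top.2
    ⟨ENNReal.sum_ne_top.2 fun i _ => (hG i).eLpNorm_ne_top, hg.eLpNorm_ne_top⟩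
  have main : ∀ ε : ENNReal, ε ≠ 0 →
      ‖∑ i, (∫ x, G i x * weakPartial i v x) - ∫ x, g x * v x‖ₑ ≤ ε * S := by
    intro ε hε
    obtain ⟨φ, hφ, h1, h2⟩ := D12.exists_test_approx hN hv hε
    have hwm := fun i => D12.memLp_weakPartial hv i
    have hφm := fun i => (hφ.pd i).memLp 2
    have hgv : Integrable (fun x => g x * v x) volume := hg.integrable_mul (D12.memLp hv)
    have hgφ : Integrable (fun x => g x * φ x) volume := hg.integrable_mul (hφ.memLp (critExp N))
    have e : ∑ i, (∫ x, G i x * weakPartial i v x) - ∫ x, g x * v x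
        = ∑ i, (∫ x, G i x * (weakPartial i v x - pd i φ x)) - ∫ x, g x * (v x - φ x) := by
      have e1 : ∀ i, ∫ x, G i x * (weakPartial i v x - pd i φ x)
          = (∫ x, G i x * weakPartial i v x) - ∫ x, G i x * pd i φ x := by
        intro i
        simp_rw [mul_sub]
        exact integral_sub ((hG i).integrable_mul (hwm i)) ((hG i).integrable_mul (hφm i))
      have e2 : ∫ x, g x * (v x - φ x) = (∫ x, g x * v x) - ∫ x, g x * φ x := by
        simp_rw [mul_sub]
        exact integral_sub hgv hgφ
      simp_rw [e1, Finset.sum_sub_distrib, e2, hT φ hφ]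
      ring
    rw [e]
    refine (enorm_sub_le).trans ?_
    refine (add_le_add_left (enorm_sum_le _ _) _).trans ?_
    rw [hS, mul_add, Finset.mul_sum]
    refine add_le_add (Finset.sum_le_sum fun i _ => ?_) ?_
    · refine (enorm_integral_mul_le (p := 2) (q := 2) (hG i).aestronglyMeasurable
        ((hwm i).aestronglyMeasurable.sub (hφm i).aestronglyMeasurable)).trans ?_
      rw [mul_comm]
      gcongr
      exact h2 i
    · refine (enorm_integral_mul_le (p := ENNReal.ofReal (twoStar N / (twoStar N - 1)))
        (q := critExp N) hg.aestronglyMeasurable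
        (hv.1.aestronglyMeasurable.sub hφ.continuous.aestronglyMeasurable)).trans ?_
      rw [mul_comm]
      gcongr
      exact h1
  rw [← sub_eq_zero, ← enorm_eq_zero]
  by_contra hne
  obtain ⟨ε, hε, hlt⟩ := ENNReal.exists_nnreal_pos_mul_lt hSt hne
  exact absurd (main ε (by simpa using hε.ne')) (not_le.2 hlt)

/-- If `u ∈ X_SO` is critical for `J`, the weak curl-curl equation holds for test functions supported
off the axis, component by component: the direction `φ eⱼ` may be replaced by its angular projection
`φ τⱼ τ`. -/
lemma Related.equation_offAxis (hN : 3 ≤ N) (hF : ConditionF1 f) (hC : 0 ≤ C)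
    (hg : CriticalGrowth f C) (hc : Compatible f h) (hr : Related u U) (hu : u ∈ spaceXSO N)
    (hcrit : IsSolutionSchrodinger f u) (j : Fin 2 ⊕ Fin (N - 2)) {φ : RN N → ℝ} (hφ : IsTest φ)
    (hs : tsupport φ ⊆ offAxis N) :
    ∑ i, ∫ x, weakPartial i (fun y => U y j) x * pd i φ x = ∫ x, h x (U x) j * φ x := by
  have hU := hr.mem_D12Vec hN hu.1
  have hWl : ∀ i, LocallyIntegrable (weakPartial i fun y => U y j) volume := fun i =>
    (D12.hasWeakPartial (hU j) i).2.1
  have htt : ∀ k, IsTest (fun x => tau j x * tau k x * φ x) := fun k =>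
    hφ.mul_left_of_contDiffOn isOpen_offAxis hs ((contDiffOn_tau j).mul (contDiffOn_tau k))
  set v : RN N → ℝ := fun x => tau j x * φ x with hv
  set V := angularField v with hVdef
  have hr' : Related v V := related_angularField v
  have hVk : ∀ k, (fun x => V x k) = fun x => tau j x * tau k x * φ x := by
    intro k
    funext x
    have hk : tau k x = rotVec x k / rad x := rfl
    rw [hVdef, angularField, PiLp.smul_apply, smul_eq_mul, hv, hk]
    ring
  have hV : V ∈ D12Vec N := fun k => by rw [hVk k]; exact D12.of_test (htt k)
  have hvX := hr'.mem_spaceX hN hV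
  have h0 := hr.diffE_angular_eq_zero hN hF hC hg hc hu hcrit hr' hvX
  have i1 := integrable_gradient_mul hU hV
  have i2 := hc.integrable_inner hN hF hC hg (D12Vec.memLp hU) (D12Vec.memLp hV)
  have e1 : diffE h U V = (∫ x, ∑ i, ∑ k, weakPartial i (fun y => U y k) x
          * pd i (fun y => tau j y * tau k y * φ y) x) - ∫ x, h x (U x) j * φ x := by
    -- `h(x, U)` is parallel to `τ`, so `h(x, U) · (φ τⱼ τ) = h(x, U)ⱼ φ`.
    have a1 : (fun x => h x (U x) j * φ x) =ᵐ[volume] fun x => inner ℝ (h x (U x)) (V x) := by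
      filter_upwards [hc.apply_eq, hr, ae_mem_offAxis] with x h1 h2 h3
      have hUk : ∀ k, U x k = u x * tau k x := by
        intro k
        rw [h2, PiLp.smul_apply, smul_eq_mul, tau]; ring
      have hVx : ∀ k, V x k = tau j x * tau k x * φ x := fun k => congrFun (hVk k) x
      rw [h1.2.2, real_inner_smul_left, PiLp.smul_apply, smul_eq_mul, PiLp.inner_apply]
      have e : ∀ k, inner ℝ (U x k) (V x k) = u x * tau j x * φ x * (tau k x * tau k x) := by
        intro k
        rw [hUk, hVx]
        simp only [RCLike.inner_apply, conj_trivial]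
        ring
      simp_rw [e]
      rw [← Finset.mul_sum, sum_tau_mul_tau h3, hUk]
      ring
    have a2 : (fun x => ∑ i, ∑ k, weakPartial i (fun y => U y k) x
        * pd i (fun y => tau j y * tau k y * φ y) x) =ᵐ[volume] fun x =>
        ∑ k, ∑ i, weakPartial i (fun y => U y k) x * weakPartial i (fun y => V y k) x := by
      have : ∀ i k, weakPartial i (fun y => V y k) =ᵐ[volume]
          pd i (fun y => tau j y * tau k y * φ y) := fun i k => by
        rw [hVk k]; exact (htt k).weakPartial_ae_eq i
      filter_upwards [ae_all_iff.2 fun i => ae_all_iff.2 (this i)] with x hx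
      rw [Finset.sum_comm]
      simp_rw [hx]
    rw [integral_congr_ae a1, integral_congr_ae a2, ← integral_sub i1 i2, diffE]
    refine integral_congr_ae ?_
    filter_upwards [hr.divergence_ae_eq hN hu] with x hx
    rw [hx]; simp
  rw [h0, ← hr.integral_gradient_angular_projection hN hu hφ hs j] at e1
  rw [← integral_finsetSum _ fun i _ => integrable_mul_test (hWl i) (hφ.pd i)]
  linarith

/-- A critical point `u ∈ X_SO` of `J` yields a critical point of `E`. -/
lemma Related.isSolutionCurlCurl (hN : 3 ≤ N) (hF : ConditionF1 f) (hC : 0 ≤ C)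
    (hg : CriticalGrowth f C) (hc : Compatible f h) (hr : Related u U) (hu : u ∈ spaceXSO N)
    (hcrit : IsSolutionSchrodinger f u) : IsSolutionCurlCurl h U := by
  have hU := hr.mem_D12Vec hN hu.1
  have hUm := D12Vec.memLp hU
  have hq := two_lt_twoStar hN
  have hH := fun j => hc.memLp_apply hN hF hg hUm j
  have hq1 : 1 ≤ ENNReal.ofReal (twoStar N / (twoStar N - 1)) := by
    rw [← ENNReal.ofReal_one]
    refine ENNReal.ofReal_le_ofReal ?_
    rw [le_div_iff₀ (by linarith)]; linarith
  have hW := fun i j => D12.memLp_weakPartial (hU j) i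
  have heq : ∀ j, ∀ v ∈ D12 N, ∑ i, ∫ x, weakPartial i (fun y => U y j) x * weakPartial i v x
      = ∫ x, h x (U x) j * v x := by
    intro j v hv
    refine divergence_equation_of_test hN (fun i => hW i j) (hH j) (fun φ hφ => ?_) hv
    refine divergence_equation_of_offAxis (fun i => (hW i j).locallyIntegrable (by norm_num))
      (fun i φ hφ => ?_) ((hH j).locallyIntegrable hq1)
      (fun φ hφ hs => hr.equation_offAxis hN hF hC hg hc hu hcrit j hφ hs) hφ
    have := (hW i j).smul (hφ.memLp ⊤) (r := 2)
    refine this.ae_eq (Filter.Eventually.of_forall fun x => ?_)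
    simp [mul_comm]
  have hzero : ∀ V ∈ D12Vec N, diffE h U V = 0 := by
    intro V hV
    have := holderTriple_conj hN
    have i1 := integrable_gradient_mul hU hV
    have i2 : ∀ j, Integrable (fun x => h x (U x) j * V x j) volume := fun j =>
      (hH j).integrable_mul (D12.memLp (hV j))
    have e : diffE h U V = (∫ x, ∑ j, ∑ i, weakPartial i (fun y => U y j) x
        * weakPartial i (fun y => V y j) x) - ∫ x, ∑ j, h x (U x) j * V x j := by
      rw [← integral_sub i1 (integrable_finsetSum _ fun j _ => i2 j), diffE]
      refine integral_congr_ae ?_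
      filter_upwards [hr.divergence_ae_eq hN hu] with x hx
      rw [hx, PiLp.inner_apply]
      simp [mul_comm]
    have i4 : ∀ j i, Integrable (fun x => weakPartial i (fun y => U y j) x
        * weakPartial i (fun y => V y j) x) volume := fun j i =>
      (hW i j).integrable_mul (D12.memLp_weakPartial (hV j) i)
    have i3 : ∀ j, Integrable (fun x => ∑ i, weakPartial i (fun y => U y j) x
        * weakPartial i (fun y => V y j) x) volume := fun j =>
      integrable_finsetSum _ fun i _ => i4 j i
    rw [e, integral_finsetSum _ fun j _ => i2 j, integral_finsetSum _ fun j _ => i3 j, sub_eq_zero]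
    refine Finset.sum_congr rfl fun j _ => ?_
    rw [integral_finsetSum _ fun i _ => i4 j i]
    exact heq j _ (hV j)
  refine ⟨hU, fun ε hε => ?_⟩
  obtain ⟨δ, hδ, hE⟩ := energyE_expansion hN hF hC hg hc hU hε
  refine ⟨δ, hδ, fun V hV hVn => ?_⟩
  have := hE V hV hVn
  rwa [hzero V hV, sub_zero] at this

end Angular

end

end CurlCurl

end

theorem theorem4p6 (N : ℕ) (hN : 3 ≤ N)
    (f : RN N → ℝ → ℝ) (h : RN N → RN N → RN N)
    (hF1 : ConditionF1 f)
    (hgrowth : ∃ C > 0, ∀ᵐ x ∂(volume : Measure (RN N)), ∀ s : ℝ,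
      |f x s| ≤ C * |s| ^ (twoStar N - 1))
    (hfh : Compatible f h)
    (u : RN N → ℝ) (U : RN N → RN N) (huU : Related u U) :
    (U ∈ spaceDF N ↔ u ∈ spaceXSO N) ∧
    (u ∈ spaceXSO N →
      divergence U =ᵐ[volume] 0 ∧
      Integrable (densityJ f u) volume ∧ Integrable (densityE h U) volume ∧
      energyJ f u = energyE h U) ∧
    ((u ∈ spaceXSO N ∧ IsSolutionSchrodinger f u) ↔
      (U ∈ spaceDF N ∧ IsSolutionCurlCurl h U)) := by
  obtain ⟨C, hC0, hC⟩ := hgrowth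
  have hiff := huU.mem_spaceDF_iff hN
  refine ⟨hiff, fun hu => ⟨huU.divergence_ae_eq hN hu, ?_, ?_, ?_⟩, ?_, ?_⟩
  · exact huU.integrable_densityJ hN hF1 hC0.le hC hfh hu.1
  · exact integrable_densityE hN hF1 hC0.le hC hfh (huU.mem_D12Vec hN hu.1)
  · exact (huU.energyE_eq_energyJ hN hF1 hC0.le hC hfh hu).symm
  · rintro ⟨hu, hcrit⟩
    exact ⟨hiff.2 hu, huU.isSolutionCurlCurl hN hF1 hC0.le hC hfh hu hcrit⟩
  · rintro ⟨hU, hcrit⟩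
    have hu := hiff.1 hU
    exact ⟨hu, huU.isSolutionSchrodinger hN hF1 hC0.le hC hfh hu hcrit⟩
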